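/- Let $X$ be a scheme, let $\mathscr E$ be a vector bundle of rank $n$ on $X$, let $k<n$, and let $\langle,\dots,\rangle_1,\dots,\langle,\dots,\rangle_m$ be $r$-linear alternating forms on $\mathscr E$, that is, morphisms $\bigwedge^r\mathscr E\to\mathscr O_X$. Let $G(k,\mathscr E)\to X$ be the Grassmannian of rank-$k$ subbundles of $\mathscr E$, and let $GAG\subseteq G(k,\mathscr E)$ be the generalized alternating Grassmannian: the closed subscheme over which the universal subbundle is isotropic for every $\langle,\dots,\rangle_i$ (the form vanishes on it). Let $K$ be a field, $x$ a $K$-valued point of $X$, and $V\subseteq\mathscr E|_x$ a $k$-dimensional subspace, isotropic for all the forms, corresponding to a $K$-valued point $z$ of $GAG$ over $x$. Then $GAG$ is, at the image of the point $z$, smooth over $X$ of codimension $m\binom{k}{r}$ inside $G(k,\mathscr E)$ (that is, smooth over $X$, of relative dimension smaller by $m\binom kr$ than that of $G(k,\mathscr E)$) if and only if the $K$-linear map $$\Bigl(\bigwedge^r V\Bigr)^{\oplus m}\to\operatorname{Hom}(V,\mathscr E|_x/V)^*,\qquad \sum_{i=1}^m v_{1,i}\wedge\dots\wedge v_{r,i}\mapsto\Bigl(\varphi\mapsto\sum_{i=1}^m\sum_{j=1}^r\langle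 v_{1,i},\dots,\varphi(v_{j,i}),\dots,v_{r,i}\rangle_i\Bigr)$$ is injective. -/

import Mathlib

open CategoryTheory AlgebraicGeometry TopologicalSpace

universe u

noncomputable section

namespace AltGrass

open Scheme.Modules

/-! ### Linear algebra -/

section
variable {R : Type*} [CommRing R] {N : Type*} [AddCommGroup N] [Module R N] {n r : ℕ}

/-- The alternating form `t ↦ ∑ l, d l * ∏ j, c (t j) (l j)` with coefficients `d`, in the
coordinates `c`. -/
def altOf (c : N →ₗ[R] (Fin n → R)) (d : (Fin r → Fin n) → R)
    (hd : ∀ l a b, a ≠ b → d (l ∘ Equiv.swap a b) = - d l)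
    (hd' : ∀ l a b, a ≠ b → l a = l b → d l = 0) : N [⋀^Fin r]→ₗ[R] R :=
  { (∑ l : Fin r → Fin n, d l • (MultilinearMap.mkPiAlgebra R (Fin r) R).compLinearMap
      (fun j => (LinearMap.proj (l j)).comp c) : MultilinearMap R (fun _ : Fin r => N) R) with
    map_eq_zero_of_eq' := by
      intro t a b hab hne
      simp only [MultilinearMap.toFun_eq_coe, sum_apply, _root_.smul_apply,
        MultilinearMap.compLinearMap_apply, LinearMap.comp_apply, LinearMap.proj_apply,
        MultilinearMap.mkPiAlgebra_apply, smul_eq_mul]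
      refine Finset.sum_involution (fun l _ => l ∘ Equiv.swap a b) ?_ ?_ (by simp) ?_
      · intro l _
        have : ∏ j, c (t j) ((l ∘ Equiv.swap a b) j) = ∏ j, c (t j) (l j) := by
          rw [← Equiv.prod_comp (Equiv.swap a b)]
          refine Finset.prod_congr rfl fun j _ => ?_
          simp only [Function.comp_apply, Equiv.swap_apply_self]
          rcases eq_or_ne j a with rfl | h1
          · rw [Equiv.swap_apply_left, hab]
          · rcases eq_or_ne j b with rfl | h2
            · rw [Equiv.swap_apply_right, hab]
            · rw [Equiv.swap_apply_of_ne_of_ne h1 h2]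
        rw [this, hd l a b hne]
        ring
      · intro l _ h0 h1
        refine h0 ?_
        have : l a = l b := by
          have := congrFun h1 b
          simpa using this
        rw [hd' l a b hne this, zero_mul]
      · intro l _
        funext j
        simp }

lemma altOf_apply (c : N →ₗ[R] (Fin n → R)) (d : (Fin r → Fin n) → R) (hd) (hd') (t : Fin r → N) :
    altOf c d hd hd' t = ∑ l : Fin r → Fin n, d l * ∏ j, c (t j) (l j) := by
  change (∑ l : Fin r → Fin n, d l • (MultilinearMap.mkPiAlgebra R (Fin r) R).compLinearMap
      (fun j => (LinearMap.proj (l j)).comp c) : MultilinearMap R (fun _ : Fin r => N) R) t = _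
  simp

lemma alt_expand (A : N [⋀^Fin r]→ₗ[R] R) (e : Fin n → N) (c : Fin r → Fin n → R) (t : Fin r → N)
    (h : ∀ j, ∑ l, c j l • e l = t j) :
    A t = ∑ l : Fin r → Fin n, A (e ∘ l) * ∏ j, c j (l j) := by
  have : t = fun j => ∑ l, c j l • e l := funext fun j => (h j).symm
  rw [this]
  change A.toMultilinearMap _ = _
  rw [MultilinearMap.map_sum]
  refine Finset.sum_congr rfl fun l _ => ?_
  rw [MultilinearMap.map_smul_univ, smul_eq_mul, mul_comm]
  rfl

lemma alt_swap (A : N [⋀^Fin r]→ₗ[R] R) (e : Fin n → N) (l : Fin r → Fin n) (a b : Fin r)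
    (h : a ≠ b) : A (e ∘ (l ∘ Equiv.swap a b)) = - A (e ∘ l) :=
  A.map_swap (e ∘ l) h
end

section LinearAlgebra
variable {K : Type*} [Field K] {W : Type*} [AddCommGroup W] [Module K W]

/-- The restriction of `ω` to the subspace `V` is zero. -/
def IsIsotropicSubspace {r : ℕ} (ω : W [⋀^Fin r]→ₗ[K] K) (V : Submodule K W) : Prop :=
  ∀ v : Fin r → V, ω (fun j => (v j : W)) = 0

/-- For `V` isotropic, the functional `w ↦ ω (v₁, …, w, …, v_r)` (with `w` in position `j`) vanishes
on `V`, so it is defined on `W ⧸ V`. -/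
def slot {r : ℕ} (ω : W [⋀^Fin r]→ₗ[K] K) {V : Submodule K W} (h : IsIsotropicSubspace ω V)
    (v : Fin r → V) (j : Fin r) : W ⧸ V →ₗ[K] K :=
  V.liftQ (ω.toMultilinearMap.toLinearMap (fun i => (v i : W)) j) (by
    intro w hw
    rw [LinearMap.mem_ker]
    refine Eq.trans (congrArg ω ?_) (h (Function.update v j ⟨w, hw⟩))
    funext i
    rcases eq_or_ne i j with rfl | hij
    · simp
    · simp [hij])

lemma slot_mk {r : ℕ} (ω : W [⋀^Fin r]→ₗ[K] K) {V : Submodule K W} (h : IsIsotropicSubspace ω V)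
    (v : Fin r → V) (j : Fin r) (w : W) :
    slot ω h v j (Submodule.Quotient.mk w) = ω (Function.update (fun i => (v i : W)) j w) := rfl

lemma exists_tangentForm {r : ℕ} (ω : W [⋀^Fin r]→ₗ[K] K) {V : Submodule K W}
    (h : IsIsotropicSubspace ω V) (φ : V →ₗ[K] W ⧸ V) :
    ∃ D : V [⋀^Fin r]→ₗ[K] K, ∀ v, D v = ∑ j, slot ω h v j (φ (v j)) := by
  obtain ⟨σ, hσ⟩ := LinearMap.exists_rightInverse_of_surjective V.mkQ
    (LinearMap.range_eq_top.2 V.mkQ_surjective)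
  let ψ : V →ₗ[K] W := σ ∘ₗ φ
  have key (v : Fin r → V) (j : Fin r) : slot ω h v j (φ (v j)) =
      ω (Function.update (fun i => (v i : W)) j (ψ (v j))) := by
    rw [← slot_mk ω h]
    exact congrArg _ (LinearMap.congr_fun hσ (φ (v j))).symm
  let D : MultilinearMap K (fun _ : Fin r => V) K :=
    ∑ j, ω.toMultilinearMap.compLinearMap (Function.update (fun _ => V.subtype) j ψ)
  have hD (v : Fin r → V) : D v = ∑ j, slot ω h v j (φ (v j)) := by
    change (∑ j, ω.toMultilinearMap.compLinearMap (Function.update (fun _ => V.subtype) j ψ)) v = _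
    rw [sum_apply]
    refine Finset.sum_congr rfl fun j _ => ?_
    rw [key, MultilinearMap.compLinearMap_apply]
    refine congrArg ω ?_
    funext i
    rcases eq_or_ne i j with rfl | hij
    · simp
    · simp [hij]
  refine ⟨{ D with map_eq_zero_of_eq' := ?_ }, hD⟩
  intro v a b hab hne
  refine (hD v).trans ?_
  rw [Finset.sum_eq_add a b hne]
  · rw [key, key, ← hab, ← neg_eq_iff_add_eq_zero, ← ω.map_swap _ hne]
    refine congrArg ω ?_
    funext i
    simp only [Function.comp_apply]
    rcases eq_or_ne i a with rfl | hia
    · simp [hne, hne.symm, hab]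
    · rcases eq_or_ne i b with rfl | hib
      · simp [hab]
      · simp [Equiv.swap_apply_of_ne_of_ne hia hib, hia, hib]
  · rintro c - ⟨hca, hcb⟩
    rw [key]
    exact ω.map_eq_zero_of_eq _ (by simp [hca.symm, hcb.symm, hab]) hne
  · simp
  · simp

/-- For `φ : V → W ⧸ V`, the alternating form
`(v₁, …, v_r) ↦ ∑ j, ω (v₁, …, φ (v_j), …, v_r)` on `V`. -/
def tangentForm {r : ℕ} (ω : W [⋀^Fin r]→ₗ[K] K) {V : Submodule K W}
    (h : IsIsotropicSubspace ω V) (φ : V →ₗ[K] W ⧸ V) : V [⋀^Fin r]→ₗ[K] K where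
  toFun v := ∑ j, slot ω h v j (φ (v j))
  map_update_add' := by
    obtain ⟨D, hD⟩ := exists_tangentForm ω h φ
    intro hdec v j a b
    obtain rfl : hdec = instDecidableEqFin r := Subsingleton.elim _ _
    rw [← hD, ← hD, ← hD, D.map_update_add]
  map_update_smul' := by
    obtain ⟨D, hD⟩ := exists_tangentForm ω h φ
    intro hdec v j a b
    obtain rfl : hdec = instDecidableEqFin r := Subsingleton.elim _ _
    rw [← hD, ← hD, D.map_update_smul]
  map_eq_zero_of_eq' := by
    obtain ⟨D, hD⟩ := exists_tangentForm ω h φ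
    intro v i j hij hne
    rw [← hD, D.map_eq_zero_of_eq v hij hne]

lemma tangentForm_add {r : ℕ} (ω : W [⋀^Fin r]→ₗ[K] K) {V : Submodule K W}
    (h : IsIsotropicSubspace ω V) (φ ψ : V →ₗ[K] W ⧸ V) :
    tangentForm ω h (φ + ψ) = tangentForm ω h φ + tangentForm ω h ψ := by
  ext v
  simp [tangentForm, Finset.sum_add_distrib]

lemma tangentForm_smul {r : ℕ} (ω : W [⋀^Fin r]→ₗ[K] K) {V : Submodule K W}
    (h : IsIsotropicSubspace ω V) (a : K) (φ : V →ₗ[K] W ⧸ V) :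
    tangentForm ω h (a • φ) = a • tangentForm ω h φ := by
  ext v
  simp [tangentForm, Finset.mul_sum]

/-- The linear map `(⋀^r V)^{⊕ m} → Hom(V, W/V)^*`, given on decomposable vectors by
`∑ i, v_{1,i} ∧ … ∧ v_{r,i} ↦ (φ ↦ ∑ i, ∑ j, ω_i (v_{1,i}, …, φ (v_{j,i}), …, v_{r,i}))`. -/
def tangentMap {r m : ℕ} (ω : Fin m → W [⋀^Fin r]→ₗ[K] K) {V : Submodule K W}
    (h : ∀ i, IsIsotropicSubspace (ω i) V) :
    (Fin m → ⋀[K]^r V) →ₗ[K] Module.Dual K (V →ₗ[K] W ⧸ V) :=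
  LinearMap.mk₂ K
    (fun y φ => ∑ i, exteriorPower.alternatingMapLinearEquiv (tangentForm (ω i) (h i) φ) (y i))
    (by intros; simp [Finset.sum_add_distrib])
    (by intros; simp [Finset.mul_sum])
    (by
      intro y φ ψ
      simp only [tangentForm_add, map_add, LinearMap.add_apply, Finset.sum_add_distrib])
    (by 
      intro a y φ
      simp only [tangentForm_smul, LinearEquiv.map_smul, LinearMap.smul_apply, Finset.smul_sum])

end LinearAlgebra

/-! ### Vector bundles and alternating forms on a scheme -/

variable {X T : Scheme.{u}}


/-- A sheaf of modules which is locally isomorphic to `𝒪^n`. -/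
def IsVectorBundle (n : ℕ) (M : X.Modules) : Prop :=
  ∀ p : X, ∃ U : X.Opens, p ∈ U ∧
    Nonempty (M.restrict U.ι ≅ SheafOfModules.free (R := U.toScheme.ringCatSheaf) (ULift.{u} (Fin n)))

/-- Restriction of sections of a sheaf of modules. -/
def res (M : X.Modules) {U V : X.Opens} (h : V ≤ U) : Γ(M, U) →+ Γ(M, V) :=
  (M.presheaf.map (homOfLE h).op).hom

/-- Restriction of functions. -/
def resO {U V : X.Opens} (h : V ≤ U) : Γ(X, U) →+* Γ(X, V) :=
  (X.presheaf.map (homOfLE h).op).hom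

/-- An `r`-linear alternating form on `M`: a morphism of sheaves `⋀^r M → 𝒪_X`, that is, alternating
`r`-linear maps `M(U)^r → 𝒪_X(U)` for all open `U`, compatible with restriction. -/
@[ext] structure AltForm (M : X.Modules) (r : ℕ) where
  app (U : X.Opens) : Γ(M, U) [⋀^Fin r]→ₗ[Γ(X, U)] Γ(X, U)
  res_app {U V : X.Opens} (h : V ≤ U) (s : Fin r → Γ(M, U)) :
    resO h (app U s) = app V (fun j => res M h (s j))

lemma res_smul (M : X.Modules) {U V : X.Opens} (h : V ≤ U) (a : Γ(X, U)) (s : Γ(M, U)) :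
    res M h (a • s) = resO h a • res M h s := M.map_smul _ _ _
lemma res_res (M : X.Modules) {U V W : X.Opens} (h : V ≤ U) (h' : W ≤ V) (s : Γ(M, U)) :
    res M h' (res M h s) = res M (h'.trans h) s := by
  have := M.presheaf.map_comp (homOfLE h).op (homOfLE h').op
  exact (congr($(this).hom s)).symm
lemma res_self (M : X.Modules) {U : X.Opens} (h : U ≤ U) (s : Γ(M, U)) :
    res M h s = s := by
  have := M.presheaf.map_id (.op U)
  exact congr($(this).hom s)
lemma resO_resO {U V W : X.Opens} (h : V ≤ U) (h' : W ≤ V) (s : Γ(X, U)) :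
    resO h' (resO h s) = resO (h'.trans h) s := by
  have := X.presheaf.map_comp (homOfLE h).op (homOfLE h').op
  exact (congr($(this).hom s)).symm
lemma resO_self {U : X.Opens} (h : U ≤ U) (s : Γ(X, U)) : resO h s = s := by
  have := X.presheaf.map_id (.op U)
  exact congr($(this).hom s)

/-- Morphisms of sheaves of modules from maps on sections. -/
def homMk {M N : X.Modules} (φ : ∀ U : X.Opens, Γ(M, U) →+ Γ(N, U))
    (hs : ∀ U (a : Γ(X, U)) (s : Γ(M, U)), φ U (a • s) = a • φ U s)
    (hr : ∀ {U V : X.Opens} (h : V ≤ U) (s : Γ(M, U)), φ V (res M h s) = res N h (φ U s)) :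
    M ⟶ N :=
  ⟨PresheafOfModules.homMk
    { app := fun U => AddCommGrpCat.ofHom (φ U.unop)
      naturality := fun U V i => by
        ext s
        exact hr (leOfHom i.unop) s } (fun U a s => hs U.unop a s)⟩

@[simp] lemma homMk_app {M N : X.Modules} (φ : ∀ U : X.Opens, Γ(M, U) →+ Γ(N, U)) (hs) (hr)
  (U : X.Opens) (s : Γ(M, U)) : (homMk (M := M) (N := N) φ hs hr).app U s = φ U s := rfl

lemma app_res {M N : X.Modules} (φ : M ⟶ N) {U V : X.Opens} (h : V ≤ U) (s : Γ(M, U)) :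
    φ.app V (res M h s) = res N h (φ.app U s) :=
  (congr($(φ.mapPresheaf.naturality (homOfLE h).op).hom s))

/-- The pulled back section `f^* s` of `f^* M`. -/
def pullSec (f : T ⟶ X) (M : X.Modules) (U : X.Opens) (s : Γ(M, U)) :
    Γ((pullback f).obj M, f ⁻¹ᵁ U) :=
  ((pullbackPushforwardAdjunction f).unit.app M).app U s

/-- The sections `e` form a basis of `M` over every open subset of `U`. -/
def IsFrame (M : X.Modules) {n : ℕ} (U : X.Opens) (e : Fin n → Γ(M, U)) : Prop :=
  ∀ (V : X.Opens) (h : V ≤ U) (t : Γ(M, V)), ∃! a : Fin n → Γ(X, V), ∑ l, a l • res M h (e l) = t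

lemma pullSec_smul (f : T ⟶ X) (M : X.Modules) (U : X.Opens) (a : Γ(X, U)) (s : Γ(M, U)) :
    pullSec f M U (a • s) = (f.app U a) • pullSec f M U s :=
  ((pullbackPushforwardAdjunction f).unit.app M).app_smul a s
lemma pullSec_add (f : T ⟶ X) (M : X.Modules) (U : X.Opens) (s t : Γ(M, U)) :
    pullSec f M U (s + t) = pullSec f M U s + pullSec f M U t :=
  map_add (((pullbackPushforwardAdjunction f).unit.app M).app U).hom s t
lemma pullSec_res (f : T ⟶ X) (M : X.Modules) {U V : X.Opens} (h : V ≤ U) (s : Γ(M, U)) :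
    pullSec f M V (res M h s) = res _ (f.preimage_mono h) (pullSec f M U s) :=
  app_res ((pullbackPushforwardAdjunction f).unit.app M) h s

lemma pullSec_sum (f : T ⟶ X) (M : X.Modules) (U : X.Opens) {ι : Type*} (S : Finset ι)
    (s : ι → Γ(M, U)) :
    pullSec f M U (∑ l ∈ S, s l) = ∑ l ∈ S, pullSec f M U (s l) :=
  map_sum (((pullbackPushforwardAdjunction f).unit.app M).app U).hom s S

lemma pullback_hom_ext (f : T ⟶ X) (M : X.Modules) {N : T.Modules} (α β : (pullback f).obj M ⟶ N)
    (h : ∀ U s, α.app (f ⁻¹ᵁ U) (pullSec f M U s) = β.app (f ⁻¹ᵁ U) (pullSec f M U s)) : α = β := by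
  apply ((pullbackPushforwardAdjunction f).homEquiv _ _).injective
  rw [Adjunction.homEquiv_unit, Adjunction.homEquiv_unit]
  ext U s
  exact h U s

lemma exists_pullback_hom (f : T ⟶ X) (M : X.Modules) {N : T.Modules} (g : M ⟶ (pushforward f).obj N) :
   ∃ α : (pullback f).obj M ⟶ N, ∀ U s, α.app (f ⁻¹ᵁ U) (pullSec f M U s) = g.app U s := by
  refine ⟨((pullbackPushforwardAdjunction f).homEquiv _ _).symm g, fun U s => ?_⟩
  have := ((pullbackPushforwardAdjunction f).homEquiv _ _).apply_symm_apply g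
  rw [Adjunction.homEquiv_unit] at this
  exact congr(($this).app U s)



variable (X) in
/-- The structure sheaf as a module over itself. -/
def unitMod : X.Modules := SheafOfModules.unit X.ringCatSheaf

/-- Functions as sections of `unitMod X`. -/
def unitSec (U : X.Opens) : Γ(X, U) ≃+ Γ(unitMod X, U) := AddEquiv.refl _

lemma unitSec_mul (U : X.Opens) (a b : Γ(X, U)) : unitSec U (a * b) = a • unitSec U b := rfl
lemma unitSec_symm_smul (U : X.Opens) (a : Γ(X, U)) (b : Γ(unitMod X, U)) :
    (unitSec U).symm (a • b) = a * (unitSec U).symm b := rfl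
lemma unitSec_res {U V : X.Opens} (h : V ≤ U) (a : Γ(X, U)) :
    res _ h (unitSec U a) = unitSec V (resO h a) := rfl
lemma unitSec_symm_res {U V : X.Opens} (h : V ≤ U) (a : Γ(unitMod X, U)) :
    (unitSec V).symm (res _ h a) = resO h ((unitSec U).symm a) := rfl

lemma app_sum {M N : X.Modules} {ι : Type*} (s : Finset ι) (φ : ι → (M ⟶ N)) (U : X.Opens)
    (t : Γ(M, U)) : (∑ l ∈ s, φ l).app U t = ∑ l ∈ s, (φ l).app U t := by
  classical
  induction s using Finset.induction_on with
  | empty => simp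
  | insert a s ha ih =>
    rw [Finset.sum_insert ha, Finset.sum_insert ha, ← ih]
    rfl

lemma isFrame_free (n : ℕ) : ∃ e : Fin n → Γ((SheafOfModules.free (R := X.ringCatSheaf) (ULift.{u} (Fin n)) : X.Modules), ⊤),
    IsFrame _ ⊤ e := by
  let R := X.ringCatSheaf
  let F : X.Modules := SheafOfModules.free (R := R) (ULift.{u} (Fin n))
  let i : ULift.{u} (Fin n) → (unitMod X ⟶ F) := fun l => SheafOfModules.ιFree l
  let hF : Limits.IsColimit (Limits.Cofan.mk F i) := SheafOfModules.isColimitFreeCofan (R := R) (ULift.{u} (Fin n))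
  let p : ULift.{u} (Fin n) → (F ⟶ unitMod X) := fun l =>
    Limits.Cofan.IsColimit.desc hF (fun m => if m = l then 𝟙 _ else 0)
  have hp (l m) : i m ≫ p l = if m = l then 𝟙 _ else 0 :=
    Limits.Cofan.IsColimit.fac hF _ _
  have hid : ∑ l, p l ≫ i l = 𝟙 F := by
    refine Limits.Cofan.IsColimit.hom_ext hF _ _ fun m => ?_
    change i m ≫ _ = i m ≫ _
    rw [Preadditive.comp_sum, Finset.sum_eq_single m]
    · rw [← Category.assoc, hp, if_pos rfl, Category.id_comp, Category.comp_id]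
    · intro l _ h
      rw [← Category.assoc, hp, if_neg h.symm, Limits.zero_comp]
    · simp
  clear_value p
  clear hF
  change ∃ e : Fin n → Γ(F, ⊤), IsFrame F ⊤ e
  clear_value i F
  refine ⟨fun l => (i ⟨l⟩).app ⊤ (unitSec ⊤ 1), ?_⟩
  intro V h t
  have key (a : Fin n → Γ(X, V)) :
      ∑ l, a l • res F h ((i ⟨l⟩).app ⊤ (unitSec ⊤ 1)) = ∑ l, (i ⟨l⟩).app V (unitSec V (a l)) := by
    refine Finset.sum_congr rfl fun l _ => ?_
    rw [← app_res, unitSec_res, map_one, ← Hom.app_smul, ← unitSec_mul, mul_one]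
  simp only [key]
  refine ⟨fun l => (unitSec V).symm ((p ⟨l⟩).app V t), ?_, ?_⟩
  · have := congr(($hid).app V t)
    rw [app_sum] at this
    simp only [AddEquiv.apply_symm_apply]
    exact (Equiv.sum_comp Equiv.ulift.symm
      (fun l => (i l).app V ((p l).app V t))).trans this
  · rintro a rfl
    funext m
    rw [map_sum, map_sum, Finset.sum_eq_single m]
    · have := congr(($(hp ⟨m⟩ ⟨m⟩)).app V (unitSec V (a m)))
      rw [if_pos rfl] at this
      exact ((unitSec V).eq_symm_apply.2 (this.symm))
    · intro l _ hl
      have := congr(($(hp ⟨m⟩ ⟨l⟩)).app V (unitSec V (a l)))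
      rw [if_neg (by simpa using hl)] at this
      exact ((unitSec V).symm_apply_eq.2 (this.trans (map_zero _).symm))
    · simp

lemma IsFrame.map_iso {M N : X.Modules} (φ : M ≅ N) {n : ℕ} {U : X.Opens} {e : Fin n → Γ(M, U)}
    (he : IsFrame M U e) : IsFrame N U (fun l => φ.hom.app U (e l)) := by
  intro V h t
  have hinv (s : Γ(N, V)) : φ.hom.app V (φ.inv.app V s) = s := congr(($(φ.inv_hom_id)).app V s)
  have hinv' (s : Γ(M, V)) : φ.inv.app V (φ.hom.app V s) = s := congr(($(φ.hom_inv_id)).app V s)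
  have key (a : Fin n → Γ(X, V)) : ∑ l, a l • res N h (φ.hom.app U (e l)) =
      φ.hom.app V (∑ l, a l • res M h (e l)) := by
    rw [map_sum]
    simp only [Hom.app_smul, app_res]
  obtain ⟨a, ha, hu⟩ := he V h (φ.inv.app V t)
  simp only [key]
  refine ⟨a, ?_, fun b hb => hu b ?_⟩
  · simp only [ha, hinv]
  · simp only at hb ⊢
    rw [← hb, hinv']

lemma IsFrame.res {M : X.Modules} {n : ℕ} {U U' : X.Opens} {e : Fin n → Γ(M, U)}
    (he : IsFrame M U e) (h' : U' ≤ U) : IsFrame M U' (fun l => res M h' (e l)) := by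
  intro V h t
  simpa only [res_res] using he V (h.trans h') t

lemma IsFrame.of_restrict {M : X.Modules} {n : ℕ} {U : X.Opens}
    {e : Fin n → Γ(M.restrict U.ι, ⊤)} (he : IsFrame (M.restrict U.ι) ⊤ e) :
    ∃ e' : Fin n → Γ(M, U), IsFrame M U e' := by
  refine ⟨fun l => AltGrass.res M (by simp) (show Γ(M, U.ι ''ᵁ ⊤) from e l), ?_⟩
  intro V h t
  obtain ⟨W, rfl⟩ : ∃ W : U.toScheme.Opens, U.ι ''ᵁ W = V :=
    ⟨U.ι ⁻¹ᵁ V, by rw [Scheme.Hom.image_preimage_eq_opensRange_inf]; simpa using h⟩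
  let e' : Fin n → Γ(M, U.ι ''ᵁ ⊤) := e
  have hr (l : Fin n) : AltGrass.res M h (AltGrass.res M (by simp) (e' l)) =
      AltGrass.res M (U.ι.image_mono le_top) (e' l) := res_res ..
  change ∃! a : Fin n → Γ(X, U.ι ''ᵁ W), ∑ l, a l • AltGrass.res M h (AltGrass.res M _ (e' l)) = t
  simp only [hr]
  obtain ⟨a, ha, hu⟩ := he W le_top (show Γ(M, U.ι ''ᵁ W) from t)
  have key (b : Fin n → Γ(U, W)) : (∑ l, b l • AltGrass.res (M.restrict U.ι) le_top (e l) : Γ(M.restrict U.ι, W)) =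
      (∑ l, ((U.ι.appIso W).inv (b l)) • AltGrass.res M (U.ι.image_mono le_top) (e' l) : Γ(M, U.ι ''ᵁ W)) := rfl
  refine ⟨fun l => (U.ι.appIso W).inv (a l), (key a).symm.trans ha, fun b hb => ?_⟩
  have h1 : (fun l => (U.ι.appIso W).hom (b l)) = a := by
    refine hu _ ((key _).trans (Eq.trans ?_ hb))
    refine Finset.sum_congr rfl fun l _ => ?_
    congr 1
    exact congr($((U.ι.appIso W).hom_inv_id) (b l))
  funext l
  rw [← h1]
  exact congr($((U.ι.appIso W).hom_inv_id) (b l)).symm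

lemma app_resO (f : T ⟶ X) {U V : X.Opens} (h : V ≤ U) (a : Γ(X, U)) :
    f.app V (resO h a) = resO (f.preimage_mono h) (f.app U a) :=
  congr($(f.naturality (homOfLE h).op) a)

lemma isVectorBundle_frame {n : ℕ} {M : X.Modules} (hM : IsVectorBundle n M) (p : X) :
   ∃ U : X.Opens, p ∈ U ∧ ∃ e : Fin n → Γ(M, U), IsFrame M U e := by
  obtain ⟨U, hp, ⟨φ⟩⟩ := hM p
  obtain ⟨e, he⟩ := isFrame_free (X := U) n
  exact ⟨U, hp, (he.map_iso φ.symm).of_restrict⟩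


/-- The sheaf `V ↦ N(V ∩ W)`. -/
def loc (N : X.Modules) (W : X.Opens) : X.Modules :=
  (Scheme.Modules.pushforward W.ι).obj (N.restrict W.ι)

lemma loc_aux (W V : X.Opens) : W.ι ''ᵁ (W.ι ⁻¹ᵁ V) = V ⊓ W := by
  rw [Scheme.Hom.image_preimage_eq_opensRange_inf, Scheme.Opens.opensRange_ι, inf_comm]

/-- The sections of `loc N W`. -/
def locSec (N : X.Modules) (W V : X.Opens) : Γ(loc N W, V) ≃+ Γ(N, V ⊓ W) where
  toFun s := res N (loc_aux W V).ge s
  invFun s := (res N (loc_aux W V).le s : Γ(N, W.ι ''ᵁ (W.ι ⁻¹ᵁ V)))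
  left_inv s := (res_res N (loc_aux W V).ge (loc_aux W V).le s).trans (res_self ..)
  right_inv s := (res_res N (loc_aux W V).le (loc_aux W V).ge s).trans (res_self ..)
  map_add' s t := map_add (res N (loc_aux W V).ge) s t

lemma locSec_smul (N : X.Modules) (W V : X.Opens) (a : Γ(X, V)) (s : Γ(loc N W, V)) :
    locSec N W V (a • s) = resO (inf_le_left : V ⊓ W ≤ V) a • locSec N W V s := by
  let s' : Γ(N, W.ι ''ᵁ (W.ι ⁻¹ᵁ V)) := s
  have h1 : (a • s : Γ(loc N W, V)) =
    (((W.ι.appIso (W.ι ⁻¹ᵁ V)).inv (W.ι.app V a)) • s' : Γ(N, W.ι ''ᵁ (W.ι ⁻¹ᵁ V))) := rfl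
  have h2 : (W.ι.appIso (W.ι ⁻¹ᵁ V)).inv (W.ι.app V a) = resO (W.ι.image_preimage_le V) a :=
    congr($(W.ι.app_appIso_inv V) a)
  rw [h1, h2]
  change res N (loc_aux W V).ge (_ • s') = _ • res N (loc_aux W V).ge s'
  rw [res_smul, resO_resO]

lemma locSec_res (N : X.Modules) (W : X.Opens) {U V : X.Opens} (h : V ≤ U) (s : Γ(loc N W, U)) :
    locSec N W V (res _ h s) = res N (inf_le_inf_right W h) (locSec N W U s) := by
  let s' : Γ(N, W.ι ''ᵁ (W.ι ⁻¹ᵁ U)) := s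
  have h1 : (res _ h s : Γ(loc N W, V)) =
    (res N (W.ι.image_mono (W.ι.preimage_mono h)) s' : Γ(N, W.ι ''ᵁ (W.ι ⁻¹ᵁ V))) := rfl
  rw [h1]
  change res N (loc_aux W V).ge (res N _ s') = res N _ (res N (loc_aux W U).ge s')
  rw [res_res, res_res]

/-- Morphisms into `loc N W`. -/
def homLoc {M N : X.Modules} (W : X.Opens) (φ : ∀ U : X.Opens, Γ(M, U) →+ Γ(N, U ⊓ W))
    (hs : ∀ U (a : Γ(X, U)) (s : Γ(M, U)), φ U (a • s) = resO (inf_le_left : U ⊓ W ≤ U) a • φ U s)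
    (hr : ∀ {U V : X.Opens} (h : V ≤ U) (s : Γ(M, U)),
      φ V (res M h s) = res N (inf_le_inf_right W h) (φ U s)) :
    M ⟶ loc N W :=
  homMk (fun U => ((locSec N W U).symm : _ →+ _).comp (φ U))
    (fun U a s => (locSec N W U).injective (by
      rw [locSec_smul]
      simp [hs]))
    (fun h s => (locSec N W _).injective (by
      rw [locSec_res]
      simp [hr]))

lemma homLoc_app {M N : X.Modules} (W : X.Opens) (φ : ∀ U : X.Opens, Γ(M, U) →+ Γ(N, U ⊓ W)) (hs) (hr) (U s) :
    locSec N W U ((homLoc (M := M) (N := N) W φ hs hr).app U s) = φ U s :=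
  (locSec N W U).apply_symm_apply _

namespace IsFrame
variable {M : X.Modules} {n : ℕ} {U : X.Opens} {e : Fin n → Γ(M, U)} (he : IsFrame M U e)

/-- The coordinates of a section in a frame. -/
def coord {V : X.Opens} (h : V ≤ U) : Γ(M, V) →ₗ[Γ(X, V)] (Fin n → Γ(X, V)) where
  toFun t := (he V h t).choose
  map_add' s t := by
    refine ((he V h (s + t)).choose_spec.2 _ ?_).symm
    simp only [Pi.add_apply, add_smul, Finset.sum_add_distrib]
    exact congrArg₂ _ (he V h s).choose_spec.1 (he V h t).choose_spec.1
  map_smul' a t := by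
    refine ((he V h (a • t)).choose_spec.2 _ ?_).symm
    simp only [Pi.smul_apply, smul_eq_mul, mul_smul, RingHom.id_apply, ← Finset.smul_sum]
    exact congrArg _ (he V h t).choose_spec.1

lemma coord_spec {V : X.Opens} (h : V ≤ U) (t : Γ(M, V)) :
    ∑ l, he.coord h t l • AltGrass.res M h (e l) = t := (he V h t).choose_spec.1

lemma coord_eq {V : X.Opens} (h : V ≤ U) {t : Γ(M, V)} {a : Fin n → Γ(X, V)}
    (ha : ∑ l, a l • AltGrass.res M h (e l) = t) : he.coord h t = a :=
  ((he V h t).choose_spec.2 a ha).symm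

lemma coord_res {V V' : X.Opens} (h : V ≤ U) (h' : V' ≤ V) (t : Γ(M, V)) (l : Fin n) :
    he.coord (h'.trans h) (AltGrass.res M h' t) l = resO h' (he.coord h t l) := by
  refine congrFun (he.coord_eq (h'.trans h) (a := fun l => resO h' (he.coord h t l)) ?_) l
  conv_rhs => rw [← he.coord_spec h t]
  simp only [map_sum, res_smul, res_res]

/-- Pullback of the coordinate functions. -/
def pullCoord (he : IsFrame M U e) (f : T ⟶ X) (m : Fin n) (V : X.Opens) :
    Γ(M, V) →+ Γ(T, f ⁻¹ᵁ V ⊓ f ⁻¹ᵁ U) where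
  toFun s := f.app (V ⊓ U) (he.coord (V := V ⊓ U) inf_le_right (AltGrass.res M inf_le_left s) m)
  map_zero' := by
    rw [map_zero, map_zero, Pi.zero_apply, map_zero]; rfl
  map_add' s t := by
    rw [map_add, map_add, Pi.add_apply, map_add]; rfl

lemma pullCoord_smul (he : IsFrame M U e) (f : T ⟶ X) (m : Fin n) (V : X.Opens) (a : Γ(X, V))
    (s : Γ(M, V)) : he.pullCoord f m V (a • s) =
      resO (inf_le_left : f ⁻¹ᵁ V ⊓ f ⁻¹ᵁ U ≤ f ⁻¹ᵁ V) (f.app V a) * he.pullCoord f m V s := by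
  change f.app (V ⊓ U) (he.coord (V := V ⊓ U) _ (AltGrass.res M _ (a • s)) m) = _ * f.app (V ⊓ U) _
  rw [res_smul, _root_.map_smul, Pi.smul_apply, smul_eq_mul, map_mul, app_resO]
  rfl

lemma pullCoord_res (he : IsFrame M U e) (f : T ⟶ X) (m : Fin n) {V V' : X.Opens} (h : V' ≤ V)
    (s : Γ(M, V)) : he.pullCoord f m V' (AltGrass.res M h s) =
      resO (inf_le_inf_right _ (f.preimage_mono h)) (he.pullCoord f m V s) := by
  have h1 := he.coord_res (V := V ⊓ U) (V' := V' ⊓ U) inf_le_right (inf_le_inf_right U h)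
    (AltGrass.res M inf_le_left s) m
  rw [res_res] at h1
  refine Eq.trans ?_ (app_resO f (inf_le_inf_right U h) _)
  rw [← h1]
  change f.app (V' ⊓ U) (he.coord (V := V' ⊓ U) _ (AltGrass.res M _ (AltGrass.res M h s)) m) = _
  rw [res_res]

lemma pullCoord_frame (he : IsFrame M U e) (f : T ⟶ X) (m l : Fin n) :
    he.pullCoord f m U (e l) = if l = m then 1 else 0 := by
  have he1 : he.coord (V := U ⊓ U) inf_le_right (AltGrass.res M inf_le_left (e l)) =
        Pi.single l 1 := he.coord_eq _ (by simp [Pi.single_apply, ite_smul])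
  change f.app (U ⊓ U) (he.coord (V := U ⊓ U) _ (AltGrass.res M _ (e l)) m) = _
  rw [he1, Pi.single_apply]
  split_ifs with h h' h'
  · exact map_one (f.app (U ⊓ U)).hom
  · exact absurd h.symm h'
  · exact absurd h'.symm h
  · exact map_zero (f.app (U ⊓ U)).hom

lemma pullCoord_spec (he : IsFrame M U e) (f : T ⟶ X) (V : X.Opens) (s : Γ(M, V)) :
    ∑ l, he.pullCoord f l V s • AltGrass.res ((Scheme.Modules.pullback f).obj M) inf_le_right
      (pullSec f M U (e l)) =
      AltGrass.res ((Scheme.Modules.pullback f).obj M) inf_le_left (pullSec f M V s) := by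
  have h1 := congr(pullSec f M (V ⊓ U) $(he.coord_spec (V := V ⊓ U) inf_le_right
      (AltGrass.res M inf_le_left s)))
  rw [pullSec_res, pullSec_sum] at h1
  simp only [pullSec_smul, pullSec_res] at h1
  exact h1

lemma pull (he : IsFrame M U e) (f : T ⟶ X) : IsFrame ((Scheme.Modules.pullback f).obj M) (f ⁻¹ᵁ U)
    (fun l => pullSec f M U (e l)) := by
  set W := f ⁻¹ᵁ U with hW
  have hex (m : Fin n) : ∃ α : (Scheme.Modules.pullback f).obj M ⟶ loc (unitMod T) W,
      ∀ V s, α.app (f ⁻¹ᵁ V) (pullSec f M V s) = (locSec _ W (f ⁻¹ᵁ V)).symm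
        (unitSec _ (he.pullCoord f m V s)) := by
    obtain ⟨α, hα⟩ := exists_pullback_hom f M (N := loc (unitMod T) W) (homMk
      (fun V => (locSec (unitMod T) W (f ⁻¹ᵁ V)).symm.toAddMonoidHom.comp
        ((unitSec (f ⁻¹ᵁ V ⊓ W)).toAddMonoidHom.comp (he.pullCoord f m V)))
      (fun V a s => (locSec (unitMod T) W (f ⁻¹ᵁ V)).injective (by
        refine Eq.trans ?_ (locSec_smul (unitMod T) W (f ⁻¹ᵁ V) (f.app V a) _).symm
        change locSec (unitMod T) W (f ⁻¹ᵁ V) ((locSec (unitMod T) W (f ⁻¹ᵁ V)).symm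
            (unitSec _ (he.pullCoord f m V (a • s)))) =
          (resO inf_le_left (f.app V a) : Γ(T, f ⁻¹ᵁ V ⊓ W)) •
            locSec (unitMod T) W (f ⁻¹ᵁ V) ((locSec (unitMod T) W (f ⁻¹ᵁ V)).symm
            (unitSec _ (he.pullCoord f m V s)))
        rw [AddEquiv.apply_symm_apply, AddEquiv.apply_symm_apply, pullCoord_smul, unitSec_mul]))
      (fun {V V'} h s => (locSec (unitMod T) W (f ⁻¹ᵁ V')).injective (by
        refine Eq.trans ?_ (locSec_res (unitMod T) W (f.preimage_mono h) _).symm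
        change locSec (unitMod T) W (f ⁻¹ᵁ V') ((locSec (unitMod T) W (f ⁻¹ᵁ V')).symm
            (unitSec _ (he.pullCoord f m V' (AltGrass.res M h s)))) =
          AltGrass.res _ _ (locSec (unitMod T) W (f ⁻¹ᵁ V) ((locSec (unitMod T) W (f ⁻¹ᵁ V)).symm
            (unitSec _ (he.pullCoord f m V s))))
        rw [AddEquiv.apply_symm_apply, AddEquiv.apply_symm_apply, unitSec_res, pullCoord_res])))
    exact ⟨α, hα⟩
  choose c hc using hex
  let M' := (Scheme.Modules.pullback f).obj M
  let α : M' ⟶ loc M' W := homLoc W (fun V => AltGrass.res M' inf_le_left)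
    (fun V a s => res_smul _ _ _ _) (fun h s => by rw [res_res, res_res])
  let cc (V : T.Opens) (t : Γ(M', V)) (l : Fin n) : Γ(T, V ⊓ W) :=
     (unitSec _).symm (locSec _ W V ((c l).app V t))
  have cc_add (V) (s t : Γ(M', V)) (l) : cc V (s + t) l = cc V s l + cc V t l := by
    simp only [cc, map_add]
  have cc_smul (V) (a : Γ(T, V)) (t : Γ(M', V)) (l) :
      cc V (a • t) l = resO inf_le_left a * cc V t l := by
    simp only [cc, Hom.app_smul, locSec_smul, unitSec_symm_smul]
  have cc_res {V V' : T.Opens} (h : V' ≤ V) (t : Γ(M', V)) (l) :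
      cc V' (AltGrass.res M' h t) l = resO (inf_le_inf_right W h) (cc V t l) := by
    have h1 := app_res (c l) h t
    have h2 := locSec_res (unitMod T) W h ((c l).app V t)
    exact congrArg (unitSec (V' ⊓ W)).symm ((congrArg (locSec (unitMod T) W V') h1).trans h2)
  have cc_pull (V : X.Opens) (s : Γ(M, V)) (l) : cc (f ⁻¹ᵁ V) (pullSec f M V s) l =
      he.pullCoord f l V s := by
    simp only [cc, hc, AddEquiv.apply_symm_apply]
    exact AddEquiv.symm_apply_apply _ _
  let β : M' ⟶ loc M' W := homLoc W
    (fun V => { toFun := fun t => ∑ l, cc V t l • AltGrass.res M' inf_le_right (pullSec f M U (e l))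
                map_zero' := by simp [cc]
                map_add' := fun s t => by simp only [cc_add, add_smul, Finset.sum_add_distrib] })
    (fun V a s => by
      simp only [AddMonoidHom.coe_mk, ZeroHom.coe_mk, cc_smul, mul_smul, Finset.smul_sum])
    (fun h s => by
      simp only [AddMonoidHom.coe_mk, ZeroHom.coe_mk, cc_res, map_sum, res_smul, res_res])
  have hαβ : α = β := by
    refine pullback_hom_ext f M α β fun V s => (locSec M' W _).injective ?_
    rw [homLoc_app, homLoc_app]
    change AltGrass.res M' _ (pullSec f M V s) =
      ∑ l, cc (f ⁻¹ᵁ V) (pullSec f M V s) l • AltGrass.res M' _ (pullSec f M U (e l))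
    simp only [cc_pull]
    exact (he.pullCoord_spec f V s).symm
  intro V h t
  have hVW : V ≤ V ⊓ W := le_inf le_rfl h
  refine ⟨fun l => resO hVW (cc V t l), ?_, ?_⟩
  · have := congr(AltGrass.res M' hVW (locSec M' W V (($hαβ).app V t)))
    rw [homLoc_app, homLoc_app] at this
    simp only [AddMonoidHom.coe_mk, ZeroHom.coe_mk, map_sum, res_smul, res_res, res_self] at this
    exact this.symm
  · rintro a rfl
    funext m
    have hadd (s : Finset (Fin n)) (g : Fin n → Γ(M', V)) :
        cc V (∑ l ∈ s, g l) m = ∑ l ∈ s, cc V (g l) m := by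
      classical
      induction s using Finset.induction_on with
      | empty => simp [cc]
      | insert a s ha ih => rw [Finset.sum_insert ha, Finset.sum_insert ha, cc_add, ih]
    rw [hadd, map_sum, Finset.sum_eq_single m]
    · rw [cc_smul, cc_res, cc_pull, pullCoord_frame, if_pos rfl, map_one, mul_one, resO_resO,
        resO_self]
    · intro l _ hl
      rw [cc_smul, cc_res, cc_pull, pullCoord_frame, if_neg hl, map_zero, mul_zero, map_zero]
    · simp

end IsFrame

lemma eq_of_locally_res {V : T.Opens} (c c' : Γ(T, V))
    (h : ∀ p ∈ V, ∃ (W : T.Opens) (hW : W ≤ V), p ∈ W ∧ resO hW c = resO hW c') : c = c' := by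
  choose W hW hp hc using h
  refine T.sheaf.eq_of_locally_eq' (fun p : V => W p.1 p.2) V (fun p => homOfLE (hW p.1 p.2)) ?_ c c'
    (fun p => hc p.1 p.2)
  intro p hpV
  exact Opens.mem_iSup.2 ⟨⟨p, hpV⟩, hp p hpV⟩

variable {M : X.Modules} {r n : ℕ} (ω : AltForm M r) (f : T ⟶ X)

/-- The pulled back form over an open set on which a frame is given. -/
def locForm {U : X.Opens} {e : Fin n → Γ(M, U)} (he : IsFrame M U e) {W : T.Opens}
    (h : W ≤ f ⁻¹ᵁ U) : Γ((pullback f).obj M, W) [⋀^Fin r]→ₗ[Γ(T, W)] Γ(T, W) :=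
  altOf ((he.pull f).coord h) (fun l => resO h (f.app U (ω.app U (e ∘ l))))
    (fun l a b hab => by rw [alt_swap _ _ _ _ _ hab, map_neg, map_neg])
    (fun l a b hab h' => by
      rw [(ω.app U).map_eq_zero_of_eq (e ∘ l) (congrArg e h') hab, map_zero, map_zero])

lemma locForm_apply {U : X.Opens} {e : Fin n → Γ(M, U)} (he : IsFrame M U e) {W : T.Opens}
    (h : W ≤ f ⁻¹ᵁ U) (t : Fin r → Γ((pullback f).obj M, W)) :
    locForm ω f he h t = ∑ l : Fin r → Fin n, resO h (f.app U (ω.app U (e ∘ l))) *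
      ∏ j, (he.pull f).coord h (t j) (l j) := altOf_apply ..

lemma locForm_res {U : X.Opens} {e : Fin n → Γ(M, U)} (he : IsFrame M U e) {W W' : T.Opens}
    (h : W ≤ f ⁻¹ᵁ U) (h' : W' ≤ W) (t : Fin r → Γ((pullback f).obj M, W)) :
    resO h' (locForm ω f he h t) = locForm ω f he (h'.trans h) (fun j => res _ h' (t j)) := by
  simp only [locForm_apply, map_sum, map_mul, map_prod, resO_resO]
  refine Finset.sum_congr rfl fun l _ => congrArg _ (Finset.prod_congr rfl fun j _ => ?_)
  exact ((he.pull f).coord_res h h' (t j) (l j)).symm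

lemma locForm_pullSec {U : X.Opens} {e : Fin n → Γ(M, U)} (he : IsFrame M U e) {W : T.Opens}
    (h : W ≤ f ⁻¹ᵁ U) {V : X.Opens} (h' : W ≤ f ⁻¹ᵁ V) (s : Fin r → Γ(M, V)) :
    locForm ω f he h (fun j => res _ h' (pullSec f M V (s j))) = resO h' (f.app V (ω.app V s)) := by
  have hW : W ≤ f ⁻¹ᵁ (V ⊓ U) := le_inf h' h
  have hcoord (j : Fin r) : (he.pull f).coord h (res _ h' (pullSec f M V (s j))) =
      fun l => resO hW (he.pullCoord f l V (s j)) := by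
    refine (he.pull f).coord_eq h ?_
    have hW : W ≤ f ⁻¹ᵁ V ⊓ f ⁻¹ᵁ U := hW
    have := congr(res _ hW $(he.pullCoord_spec f V (s j)))
    simp only [map_sum, res_smul, res_res] at this
    exact this
  have h1 : ω.app (V ⊓ U) (fun j => res M inf_le_left (s j)) =
      ∑ l : Fin r → Fin n, resO inf_le_right (ω.app U (e ∘ l)) *
        ∏ j, he.coord (V := V ⊓ U) inf_le_right (res M inf_le_left (s j)) (l j) := by
    rw [alt_expand (ω.app (V ⊓ U)) (fun l => res M inf_le_right (e l))
      (fun j => he.coord (V := V ⊓ U) inf_le_right (res M inf_le_left (s j))) _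
      (fun j => he.coord_spec _ _)]
    refine Finset.sum_congr rfl fun l _ => ?_
    rw [ω.res_app]
    rfl
  have h2 : resO h' (f.app V (ω.app V s)) =
      resO hW (f.app (V ⊓ U) (ω.app (V ⊓ U) (fun j => res M inf_le_left (s j)))) := by
    rw [← ω.res_app, app_resO, resO_resO]
  rw [h2, h1, locForm_apply]
  simp only [map_sum, map_mul, map_prod, app_resO, resO_resO, hcoord]
  rfl

lemma locForm_indep {U : X.Opens} {e : Fin n → Γ(M, U)} (he : IsFrame M U e)
    {U' : X.Opens} {e' : Fin n → Γ(M, U')} (he' : IsFrame M U' e') {W : T.Opens}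
    (h : W ≤ f ⁻¹ᵁ U) (h' : W ≤ f ⁻¹ᵁ U') : locForm ω f he h = locForm ω f he' h' := by
  ext t
  rw [alt_expand (locForm ω f he' h') (fun l => res _ h (pullSec f M U (e l)))
    (fun j => (he.pull f).coord h (t j)) t (fun j => (he.pull f).coord_spec _ _), locForm_apply]
  refine Finset.sum_congr rfl fun l _ => ?_
  rw [← locForm_pullSec ω f he' h' h (e ∘ l)]
  rfl

lemma exists_value (hM : IsVectorBundle n M) (V : T.Opens)
    (t : Fin r → Γ((pullback f).obj M, V)) :
    ∃ c : Γ(T, V), ∀ (U : X.Opens) (e : Fin n → Γ(M, U)) (he : IsFrame M U e) (W : T.Opens)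
      (hWV : W ≤ V) (hWU : W ≤ f ⁻¹ᵁ U),
      resO hWV c = locForm ω f he hWU (fun j => res _ hWV (t j)) := by
  choose U hU e he using isVectorBundle_frame hM
  have hex := T.sheaf.existsUnique_gluing' (fun p : T => V ⊓ f ⁻¹ᵁ (U (f p))) V
    (fun p => homOfLE inf_le_left)
    (fun p hp => Opens.mem_iSup.2 ⟨p, hp, hU (f p)⟩)
    (fun p => locForm ω f (he (f p)) inf_le_right (fun j => res _ inf_le_left (t j))) (by
      intro p q
      refine (locForm_res ω f (he (f p)) inf_le_right inf_le_left _).trans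
        (Eq.trans ?_ (locForm_res ω f (he (f q)) inf_le_right inf_le_right _).symm)
      simp only [res_res]
      rw [locForm_indep ω f (he (f p)) (he (f q))])
  obtain ⟨c, hc, -⟩ := hex
  refine ⟨c, fun U' e' he' W hWV hWU => eq_of_locally_res _ _ fun p hp => ?_⟩
  refine ⟨W ⊓ f ⁻¹ᵁ (U (f p)), inf_le_left, ⟨hp, hU (f p)⟩, ?_⟩
  have := congrArg (resO (inf_le_inf_right (f ⁻¹ᵁ (U (f p))) hWV)) (hc p)
  rw [locForm_res] at this
  refine Eq.trans (Eq.trans ?_ this) ?_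
  · exact (resO_resO _ _ _).trans (resO_resO _ _ _).symm
  · rw [locForm_res]
    simp only [res_res]
    rw [locForm_indep ω f (he (f p)) he']

lemma AltForm.existsUnique_pullback (ω : AltForm M r) (hM : IsVectorBundle n M) (f : T ⟶ X) :
    ∃! ω' : AltForm ((Scheme.Modules.pullback f).obj M) r, ∀ (V : X.Opens) (s : Fin r → Γ(M, V)),
      ω'.app (f ⁻¹ᵁ V) (fun j => pullSec f M V (s j)) = f.app V (ω.app V s) := by
  have hex := exists_value ω f hM
  choose c hc using hex
  have hext (V : T.Opens) (a b : Γ(T, V)) (h : ∀ (U : X.Opens) (e : Fin n → Γ(M, U))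
      (he : IsFrame M U e) (W : T.Opens) (hWV : W ≤ V) (hWU : W ≤ f ⁻¹ᵁ U),
      resO hWV a = resO hWV b) : a = b := by
    refine eq_of_locally_res _ _ fun p hp => ?_
    obtain ⟨U, hU, e, he⟩ := isVectorBundle_frame hM (f p)
    exact ⟨V ⊓ f ⁻¹ᵁ U, inf_le_left, ⟨hp, hU⟩, h U e he _ _ inf_le_right⟩
  let ω' : AltForm ((Scheme.Modules.pullback f).obj M) r :=
  { app V :=
    { toFun := c V
      map_update_add' := by
        intro hdec t j a b
        obtain rfl : hdec = instDecidableEqFin r := Subsingleton.elim _ _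
        refine hext V _ _ fun U e he W hWV hWU => ?_
        rw [map_add, hc V _ U e he _ _ hWU, hc V _ U e he _ _ hWU, hc V _ U e he _ _ hWU]
        have := fun x => Function.comp_update (res ((Scheme.Modules.pullback f).obj M) hWV) t j x
        simp only [Function.comp_def] at this
        rw [this, this, this, map_add, AlternatingMap.map_update_add]
      map_update_smul' := by
        intro hdec t j a b
        obtain rfl : hdec = instDecidableEqFin r := Subsingleton.elim _ _
        refine hext V _ _ fun U e he W hWV hWU => ?_
        rw [smul_eq_mul, map_mul, hc V _ U e he _ _ hWU, hc V _ U e he _ _ hWU]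
        have := fun x => Function.comp_update (res ((Scheme.Modules.pullback f).obj M) hWV) t j x
        simp only [Function.comp_def] at this
        rw [this, this, res_smul, AlternatingMap.map_update_smul, smul_eq_mul]
      map_eq_zero_of_eq' := by
        intro t i j hij hne
        refine hext V _ _ fun U e he W hWV hWU => ?_
        rw [hc V _ U e he _ _ hWU, map_zero]
        exact AlternatingMap.map_eq_zero_of_eq _ _ (congrArg _ hij) hne }
    res_app := by
      intro V V' h t
      refine hext V' _ _ fun U e he W hWV hWU => ?_
      refine (resO_resO h hWV _).trans ((hc V t U e he W (hWV.trans h) hWU).trans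
        (Eq.trans ?_ (hc V' _ U e he W hWV hWU).symm))
      simp only [res_res] }

  refine ⟨ω', fun V s => ?_, fun ω'' h'' => ?_⟩
  · refine hext _ _ _ fun U e he W hWV hWU => ?_
    exact (hc _ _ U e he W hWV hWU).trans (locForm_pullSec ω f he _ _ _)
  · have : ω''.app = ω'.app := by
      funext V
      ext t
      refine hext _ _ _ fun U e he W hWV hWU => ?_
      refine Eq.trans ?_ (hc _ _ U e he W hWV hWU).symm
      rw [ω''.res_app, locForm_apply, alt_expand (ω''.app W)
        (fun l => res _ hWU (pullSec f M U (e l)))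
        (fun j => (he.pull f).coord hWU (res _ hWV (t j))) _ (fun j => (he.pull f).coord_spec _ _)]
      refine Finset.sum_congr rfl fun l _ => ?_
      rw [← h'', ω''.res_app]
      rfl
    exact AltForm.ext this

/-- The pullback `f^* ω`: the unique alternating form on `f^* M` with
`(f^* ω) (f^* s₁, …, f^* s_r) = f^* (ω (s₁, …, s_r))`. -/
def AltForm.pullback (ω : AltForm M r) (hM : IsVectorBundle n M) (f : T ⟶ X) :
    AltForm ((Scheme.Modules.pullback f).obj M) r :=
  (ω.existsUnique_pullback hM f).choose
/-! ### The fibre of a vector bundle at a field-valued point -/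

section Fiber

variable (K : Type u) [Field K] (x : Spec (.of K) ⟶ X) (M : X.Modules)

/-- The fibre `M|_x` at a `K`-valued point `x`: the global sections of `x^* M` on `Spec K`. -/
def fiber : Type u := Γ((pullback x).obj M, ⊤)

instance : AddCommGroup (fiber K x M) :=
  inferInstanceAs (AddCommGroup Γ((pullback x).obj M, ⊤))

instance : Module K (fiber K x M) :=
  Module.compHom Γ((pullback x).obj M, ⊤) (Scheme.ΓSpecIso (.of K)).inv.hom

variable {K x M}
lemma fiber_smul (a : K) (v : fiber K x M) :
    a • v = ((Scheme.ΓSpecIso (.of K)).inv a • (show Γ((pullback x).obj M, ⊤) from v) :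
      Γ((pullback x).obj M, ⊤)) := rfl

/-- The form induced on the fibre `M|_x`. -/
def AltForm.atFiber {n r : ℕ} (ω : AltForm M r) (hM : IsVectorBundle n M) (x : Spec (.of K) ⟶ X) :
    (fiber K x M) [⋀^Fin r]→ₗ[K] K where
  toFun v := (Scheme.ΓSpecIso (.of K)).hom ((ω.pullback hM x).app ⊤ v)
  map_update_add' v j a b :=
    (congrArg _ (((ω.pullback hM x).app ⊤).map_update_add v j a b)).trans (map_add _ _ _)
  map_update_smul' v j a b := by
    refine (congrArg _ (((ω.pullback hM x).app ⊤).map_update_smul v j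
      ((Scheme.ΓSpecIso (.of K)).inv a) b)).trans ((map_mul (Scheme.ΓSpecIso (.of K)).hom.hom _ _).trans ?_)
    exact congrArg (· * _) (congr($((Scheme.ΓSpecIso (.of K)).inv_hom_id) a))
  map_eq_zero_of_eq' v i j h hne :=
    (congrArg _ (((ω.pullback hM x).app ⊤).map_eq_zero_of_eq v h hne)).trans (map_zero _)

variable {T G : Scheme.{u}}

/-- A rank `k` subbundle of a vector bundle of rank `n`: a locally free subsheaf of rank `k` with
locally free quotient of rank `n - k`. -/
def IsSubbundle (n k : ℕ) {N : T.Modules} (F : Subobject N) : Prop :=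
  IsVectorBundle k (F : T.Modules) ∧ IsVectorBundle (n - k) (Limits.cokernel F.arrow)

/-- For `f = π ∘ g`, the pullback along `g` of a subsheaf `S` of `π^* M`, as a subsheaf of `f^* M`:
the image of `g^* S → g^* π^* M ≅ f^* M`. -/
def pullbackSub {π : G ⟶ X} (S : Subobject ((pullback π).obj M)) (g : T ⟶ G) (f : T ⟶ X)
    (h : g ≫ π = f) : Subobject ((pullback f).obj M) :=
  Limits.imageSubobject ((pullback g).map S.arrow ≫ (pullbackComp g π).hom.app M ≫
    (pullbackCongr h).hom.app M)

/-- `π : G ⟶ X` with the subbundle `S ⊆ π^* M` is the Grassmannian `G(k, M)` of rank `k` subbundles of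
the vector bundle `M` of rank `n`, with its universal subbundle: the rank `k` subbundles of `f^* M`, for
`f : T ⟶ X`, are the pullbacks of `S` along unique morphisms `T ⟶ G` over `X`. -/
structure IsGrassmannian (M : X.Modules) (n k : ℕ) (π : G ⟶ X) (S : Subobject ((pullback π).obj M)) : Prop where
  isSubbundle : IsSubbundle n k S
  existsUnique {T : Scheme.{u}} (f : T ⟶ X) (F : Subobject ((pullback f).obj M)) :
    IsSubbundle n k F → ∃! g : T ⟶ G, ∃ h : g ≫ π = f, pullbackSub S g f h = F

/-- The ideal sheaf generated by the values of the forms on local sections of the universal subbundle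
(the smallest quasi-coherent ideal sheaf that contains them). -/
def isotropyIdeal {n r m : ℕ} (hM : IsVectorBundle n M) (ω : Fin m → AltForm M r)
    (π : G ⟶ X) (S : Subobject ((pullback π).obj M)) : G.IdealSheafData :=
  sInf {I | ∀ (i : Fin m) (U : G.affineOpens) (s : Fin r → Γ((S : G.Modules), U)),
    ((ω i).pullback hM π).app U (fun j => S.arrow.app U (s j)) ∈ I.ideal U}

/-- The generalized alternating Grassmannian: the closed subscheme of the Grassmannian over which the
universal subbundle is isotropic for all the forms; a morphism `g : T ⟶ G` factors through it if and only
if the forms vanish on the subbundle that corresponds to `g`. -/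
abbrev genAltGrassmannian {n r m : ℕ} (hM : IsVectorBundle n M) (ω : Fin m → AltForm M r)
    (π : G ⟶ X) (S : Subobject ((pullback π).obj M)) : Scheme.{u} :=
  (isotropyIdeal hM ω π S).subscheme

/-- The subspace of the fibre `M|_x` cut out by a subsheaf of `x^* M`. -/
def globalSubspace (F : Subobject ((pullback x).obj M)) : Submodule K (fiber K x M) where
  carrier := Set.range (F.arrow.app ⊤)
  add_mem' := by
    rintro _ _ ⟨a, rfl⟩ ⟨b, rfl⟩
    exact ⟨a + b, map_add _ _ _⟩
  zero_mem' := ⟨0, map_zero _⟩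
  smul_mem' := by
    rintro c _ ⟨a, rfl⟩
    exact ⟨(Scheme.ΓSpecIso (.of K)).inv c • a, F.arrow.app_smul _ _⟩

end Fiber

/-- `p` is smooth of relative dimension `d` at the point `z`. -/
def SmoothOfRelativeDimensionAt {Z X : Scheme.{u}} (d : ℕ) (p : Z ⟶ X) (z : Z) : Prop :=
  ∃ U : Z.Opens, z ∈ U ∧ SmoothOfRelativeDimension d (U.ι ≫ p)

/-- `Z` is smooth over `X` of codimension `c` inside `G` at `z`: both `Z` and `G` are smooth over `X`
at `z`, and the relative dimension of `Z` is that of `G` minus `c`. -/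
def SmoothOfCodimensionAt {Z G X : Scheme.{u}} (c : ℕ) (i : Z ⟶ G) (π : G ⟶ X) (z : Z) : Prop :=
  ∃ d : ℕ, SmoothOfRelativeDimensionAt d (i ≫ π) z ∧ SmoothOfRelativeDimensionAt (d + c) π (i z)

end AltGrass

end

/-!
Both sides of the equivalence say that a Jacobian matrix has independent rows.

Locally on the base, choose a frame of `E`. Near the point `z`, the universal subbundle `S` is the
graph of a `k × (n - k)` matrix of functions on `G`, after a permutation of the frame
(`exists_isGraphOn`: some maximal minor of `S ⟶ π^* E` is invertible at the point). By the
universal property of `G`, the entries of this matrix are coordinates: small affine open sets of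
`G` are principal open sets of an affine space over the base (`exists_chart`). Here the universal
property gives a morphism from the affine space to `G`, which is a monomorphism since a graph
determines its matrix; the matrix gives local sections of it, and a section of a monomorphism over
an open set is an open immersion.

In such a chart the isotropic locus is defined by `m * k.choose r` polynomials in the entries of
the matrix, the values of the forms on increasing families of rows (`isotropyIdeal_ideal`,
`isCutOutBy_isotropyIdeal`). That the ideal sheaf, which is defined as an infimum, is generated by
these values over every small affine open set follows from a gluing lemma for ideals
(`exists_idealSheafData`).

For a closed subscheme of an affine space that is cut out by `c` equations, smoothness of
codimension `c` at a point means that the Jacobian matrix of the equations has independent rows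
there (`IsCutOutBy.smoothOfCodimensionAt_iff`). If the rows are independent, some maximal minor is
invertible near the point, and the equations form a submersive presentation. Conversely, a smooth
algebra of relative dimension `d` has `d`-dimensional spaces of `K`-valued derivations, and
derivations of the quotient are the vectors killed by the Jacobian matrix.

Finally, the derivative of the value `ω (v₁, …, v_r)` along the `(i, j)` entry of the matrix
replaces, one at a time, the occurrences of the `i`-th row by the basis vector of index `j`. So the
rows of the Jacobian matrix are the images of the basis vectors of `(⋀^r V)^m` under `tangentMap`,
in coordinates of `Hom(V, E|_x / V)` (`tangentMap_injective_iff`).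
-/

noncomputable section

namespace AltGrass

open Scheme.Modules

section

variable {X T : Scheme.{u}}

/-! ### Subsheaves in terms of their sections -/

lemma app_injective_of_mono {M N : X.Modules} (φ : M ⟶ N) [Mono φ] (U : X.Opens) :
    Function.Injective (φ.app U) := by
  have h1 : Mono ((toPresheaf X).map φ) := inferInstance
  have h2 := (NatTrans.mono_iff_mono_app _).1 h1 (.op U)
  exact (AddCommGrpCat.mono_iff_injective _).1 h2

lemma mono_of_app_injective {M N : X.Modules} (φ : M ⟶ N)
    (h : ∀ U, Function.Injective (φ.app U)) : Mono φ where
  right_cancellation α β hαβ := by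
    ext U s
    exact h U congr(($hαβ).app U s)

/-- The section `t` of `N` over `V` belongs to the subsheaf `F`. -/
def MemSub {N : X.Modules} (F : Subobject N) (V : X.Opens) (t : Γ(N, V)) : Prop :=
  ∃ s, F.arrow.app V s = t

namespace MemSub
variable {N : X.Modules} {F : Subobject N} {V : X.Opens}

lemma smul (c : Γ(X, V)) {t : Γ(N, V)} (ht : MemSub F V t) : MemSub F V (c • t) := by
  obtain ⟨b, rfl⟩ := ht
  exact ⟨c • b, F.arrow.app_smul _ _⟩

lemma sum {ι : Type*} (s : Finset ι) {t : ι → Γ(N, V)} (h : ∀ i, MemSub F V (t i)) :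
    MemSub F V (∑ i ∈ s, t i) := by
  choose a ha using h
  exact ⟨∑ i ∈ s, a i, by rw [map_sum]; simp only [ha]⟩

lemma res {V' : X.Opens} (h : V' ≤ V) {t : Γ(N, V)} (ht : MemSub F V t) :
    MemSub F V' (AltGrass.res N h t) := by
  obtain ⟨b, rfl⟩ := ht
  exact ⟨AltGrass.res _ h b, app_res _ _ _⟩

end MemSub

/-- A morphism whose values are sections of a subsheaf factors through it. -/
lemma exists_lift_of_memSub {P N : X.Modules} {F : Subobject N} (φ : P ⟶ N)
    (h : ∀ V s, MemSub F V (φ.app V s)) : ∃ ψ : P ⟶ (F : X.Modules), ψ ≫ F.arrow = φ := by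
  choose a ha using h
  have hinj := fun V => app_injective_of_mono F.arrow V
  refine ⟨homMk (fun V => { toFun := a V
                            map_zero' := hinj V (by rw [ha, map_zero, map_zero])
                            map_add' := fun s t => hinj V (by rw [ha, map_add, map_add, ha, ha]) })
    (fun V c s => hinj V ?_) (fun {U V} h s => hinj V ?_), ?_⟩
  · change F.arrow.app V (a V (c • s)) = F.arrow.app V (c • a V s)
    rw [ha, Hom.app_smul, Hom.app_smul, ha]
  · change F.arrow.app V (a V (AltGrass.res P h s)) = F.arrow.app V (AltGrass.res _ h (a U s))
    rw [ha, app_res, app_res, ha]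
  · ext V s
    exact ha V s

lemma subobject_le_iff {N : X.Modules} {F F' : Subobject N} :
    F ≤ F' ↔ ∀ V t, MemSub F V t → MemSub F' V t := by
  constructor
  · rintro h V _ ⟨s, rfl⟩
    exact ⟨(Subobject.ofLE F F' h).app V s, congr(($(Subobject.ofLE_arrow h)).app V s)⟩
  · intro h
    obtain ⟨ψ, hψ⟩ := exists_lift_of_memSub (F := F') F.arrow (fun V s => h V _ ⟨s, rfl⟩)
    exact Subobject.le_of_comm ψ hψ

lemma memSub_mk {M N : X.Modules} (φ : M ⟶ N) [Mono φ] {V : X.Opens} {t : Γ(N, V)} :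
    MemSub (Subobject.mk φ) V t ↔ ∃ s, φ.app V s = t := by
  constructor
  · rintro ⟨s, rfl⟩
    exact ⟨(Subobject.underlyingIso φ).hom.app V s,
      congr(($(Subobject.underlyingIso_hom_comp_eq_mk φ)).app V s)⟩
  · rintro ⟨s, rfl⟩
    exact ⟨(Subobject.underlyingIso φ).inv.app V s,
      congr(($(Subobject.underlyingIso_arrow φ)).app V s)⟩

/-! ### Pullbacks of subsheaves -/

/-- Pulling back a section in two steps is pulling it back along the composite, by the description
of the unit of a composite adjunction. -/
lemma pullSec_comp {G : Scheme.{u}} (g : T ⟶ G) (π : G ⟶ X) (M : X.Modules) (U : X.Opens)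
    (s : Γ(M, U)) :
    ((pullbackComp g π).hom.app M).app _ (pullSec g _ (π ⁻¹ᵁ U) (pullSec π M U s)) =
      pullSec (g ≫ π) M U s := by
  have h1 := unit_conjugateEquiv
    ((pullbackPushforwardAdjunction π).comp (pullbackPushforwardAdjunction g))
    (pullbackPushforwardAdjunction (g ≫ π)) (pullbackComp g π).inv M
  rw [conjugateEquiv_pullbackComp_inv] at h1
  have h2 : pullSec g _ (π ⁻¹ᵁ U) (pullSec π M U s) =
      ((pullbackComp g π).inv.app M).app _ (pullSec (g ≫ π) M U s) := by
    refine Eq.trans ?_ congr(($h1).app U s)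
    simp [pullSec, Adjunction.comp_unit_app]
    rfl
  rw [h2]
  exact congr(($((pullbackComp g π).inv_hom_id_app M)).app _ (pullSec (g ≫ π) M U s))

lemma pullSec_map (g : T ⟶ X) {M N : X.Modules} (φ : M ⟶ N) (V : X.Opens) (s : Γ(M, V)) :
    ((pullback g).map φ).app (g ⁻¹ᵁ V) (pullSec g M V s) = pullSec g N V (φ.app V s) :=
  congr(($((pullbackPushforwardAdjunction g).unit.naturality φ)).app V s).symm

lemma exists_epi_imageSubobject {M N : X.Modules} (φ : M ⟶ N) :
    ∃ p : M ⟶ (Limits.imageSubobject φ : X.Modules), Epi p ∧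
      p ≫ (Limits.imageSubobject φ).arrow = φ :=
  ⟨Limits.factorThruImageSubobject φ, inferInstance, Limits.imageSubobject_arrow_comp φ⟩

/-- A morphism `P ⟶ g_* N` from maps on sections. -/
def homPush {G : Scheme.{u}} (g : T ⟶ G) {P : G.Modules} {N : T.Modules}
    (φ : ∀ V : G.Opens, Γ(P, V) →+ Γ(N, g ⁻¹ᵁ V))
    (hs : ∀ V (a : Γ(G, V)) (s : Γ(P, V)), φ V (a • s) = g.app V a • φ V s)
    (hr : ∀ {U V : G.Opens} (h : V ≤ U) (s : Γ(P, U)),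
      φ V (res P h s) = res N (g.preimage_mono h) (φ U s)) :
    P ⟶ (pushforward g).obj N :=
  homMk (N := (pushforward g).obj N) φ hs hr

/-- For `f = π ∘ g`, the comparison map `g^* π^* M ⟶ f^* M`. -/
def pullbackTrans {G : Scheme.{u}} {π : G ⟶ X} {g : T ⟶ G} {f : T ⟶ X} (h : g ≫ π = f)
    (M : X.Modules) : (pullback g).obj ((pullback π).obj M) ⟶ (pullback f).obj M :=
  (pullbackComp g π).hom.app M ≫ (pullbackCongr h).hom.app M

/-- For `f = π ∘ g`, the pullback along `g` of sections of `π^* M`, with values in `f^* M`. -/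
def pullSec₂ {G : Scheme.{u}} {π : G ⟶ X} {g : T ⟶ G} {f : T ⟶ X} (h : g ≫ π = f) (M : X.Modules)
    (V : G.Opens) : Γ((pullback π).obj M, V) →+ Γ((pullback f).obj M, g ⁻¹ᵁ V) where
  toFun t := (pullbackTrans h M).app _ (pullSec g _ V t)
  map_zero' := by
    refine Eq.trans (congrArg _ ?_) (map_zero _)
    exact map_zero (((pullbackPushforwardAdjunction g).unit.app _).app V).hom
  map_add' s t := by rw [pullSec_add, map_add]

section
variable {G : Scheme.{u}} {π : G ⟶ X} {g : T ⟶ G} {f : T ⟶ X} (h : g ≫ π = f)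

lemma preimage_le_of_comp_eq (h : g ≫ π = f) (U : X.Opens) : g ⁻¹ᵁ (π ⁻¹ᵁ U) ≤ f ⁻¹ᵁ U := by
  rw [← h]; exact le_rfl

variable (M : X.Modules)

lemma pullSec₂_def (V : G.Opens) (t : Γ((pullback π).obj M, V)) : pullSec₂ h M V t =
    (pullbackTrans h M).app _ (pullSec g _ V t) := rfl

lemma pullSec₂_smul (V : G.Opens) (a : Γ(G, V)) (t : Γ((pullback π).obj M, V)) :
    pullSec₂ h M V (a • t) = g.app V a • pullSec₂ h M V t := by
  rw [pullSec₂_def, pullSec_smul, Hom.app_smul, pullSec₂_def]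

lemma pullSec₂_res {V V' : G.Opens} (h' : V' ≤ V) (t : Γ((pullback π).obj M, V)) :
    pullSec₂ h M V' (res _ h' t) = res _ (g.preimage_mono h') (pullSec₂ h M V t) := by
  rw [pullSec₂_def, pullSec_res]
  exact app_res _ _ _

lemma pullSec₂_pullSec (U : X.Opens) (s : Γ(M, U)) :
    pullSec₂ h M (π ⁻¹ᵁ U) (pullSec π M U s) =
      res _ (preimage_le_of_comp_eq h U) (pullSec f M U s) := by
  subst h
  refine Eq.trans ?_ (res_self _ _ _).symm
  refine Eq.trans ?_ (pullSec_comp g π M U s)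
  rw [pullSec₂_def]
  simp [pullbackTrans, pullbackCongr]

/-- Pullback of sections as a morphism of sheaves. -/
def pullSec₂Hom : (pullback π).obj M ⟶ (pushforward g).obj ((pullback f).obj M) :=
  homPush g (fun V => pullSec₂ h M V)
    (fun V a s => pullSec₂_smul h M V a s) (fun h' s => pullSec₂_res h M h' s)

/-- Pulling back sections is transitive. Both sides are morphisms out of `π^* M`, so it suffices to
compare them on pulled back sections of `M`. -/
lemma pullSec₂_comp {T' : Scheme.{u}} {u : T' ⟶ T} {f' : T' ⟶ X} (h' : u ≫ f = f')
    (h'' : (u ≫ g) ≫ π = f') (V : G.Opens) (t : Γ((pullback π).obj M, V)) :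
    pullSec₂ h'' M V t = pullSec₂ h' M (g ⁻¹ᵁ V) (pullSec₂ h M V t) := by
  have hαβ : pullSec₂Hom h'' M = pullSec₂Hom h M ≫ (pushforward g).map (pullSec₂Hom h' M) := by
    refine pullback_hom_ext π M _ _ fun U s => ?_
    refine (pullSec₂_pullSec h'' M U s).trans ?_
    change _ = pullSec₂ h' M (g ⁻¹ᵁ (π ⁻¹ᵁ U)) (pullSec₂ h M (π ⁻¹ᵁ U) (pullSec π M U s))
    rw [pullSec₂_pullSec h, pullSec₂_res h', pullSec₂_pullSec h', res_res]
    rfl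
  exact congr(($hαβ).app V t)

lemma map_comp_pullbackTrans_app (S : Subobject ((pullback π).obj M)) (V : G.Opens)
    (s : Γ((S : G.Modules), V)) :
    ((pullback g).map S.arrow ≫ pullbackTrans h M).app _ (pullSec g _ V s) =
      pullSec₂ h M V (S.arrow.app V s) :=
  congrArg ((pullbackTrans h M).app (g ⁻¹ᵁ V)) (pullSec_map g S.arrow V s)

/-- A morphism to a pushforward `g_* N` whose values are sections of a subsheaf `F` of `N` factors
through `g_* F`. -/
lemma exists_hom_of_memSub {P : G.Modules} {N : T.Modules} (F : Subobject N)
    (α : P ⟶ (pushforward g).obj N) (hα : ∀ V s, MemSub F (g ⁻¹ᵁ V) (α.app V s)) :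
    ∃ β : P ⟶ (pushforward g).obj (F : T.Modules), ∀ V s, F.arrow.app (g ⁻¹ᵁ V) (β.app V s) = α.app V s := by
  choose a ha using hα
  have hinj := fun V => app_injective_of_mono F.arrow V
  refine ⟨homMk (N := (pushforward g).obj (F : T.Modules)) (fun V => AddMonoidHom.mk' (a V) (fun s t => hinj _ ?_))
    (fun V c s => hinj _ ?_) (fun {U V} h s => hinj _ ?_), fun V s => ha V s⟩
  · exact (ha V _).trans ((map_add (α.app V).hom s t).trans (Eq.symm
      ((map_add (F.arrow.app _).hom _ _).trans (congrArg₂ _ (ha V s) (ha V t)))))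
  · refine (ha V _).trans ((α.app_smul c s).trans (Eq.symm ((F.arrow.app_smul (g.app V c) _).trans ?_)))
    exact congrArg (g.app V c • ·) (ha V s)
  · refine (ha V _).trans ((app_res α h s).trans
      (Eq.symm ((app_res F.arrow (g.preimage_mono h) _).trans ?_)))
    exact congrArg (AltGrass.res N (g.preimage_mono h)) (ha U s)

lemma exists_epi_pullbackSub (S : Subobject ((pullback π).obj M)) :
    ∃ p : (pullback g).obj (S : G.Modules) ⟶ (pullbackSub S g f h : T.Modules), Epi p ∧
      p ≫ (pullbackSub S g f h).arrow = (pullback g).map S.arrow ≫ pullbackTrans h M :=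
  exists_epi_imageSubobject ((pullback g).map S.arrow ≫ pullbackTrans h M)

lemma memSub_pullbackSub (S : Subobject ((pullback π).obj M)) (V : G.Opens)
    (t : Γ((pullback π).obj M, V)) (ht : MemSub S V t) :
    MemSub (pullbackSub S g f h) (g ⁻¹ᵁ V) (pullSec₂ h M V t) := by
  obtain ⟨s, rfl⟩ := ht
  obtain ⟨p, -, hp⟩ := exists_epi_pullbackSub h M S
  rw [← map_comp_pullbackTrans_app, ← hp]
  exact ⟨_, rfl⟩

/-- The subsheaf `pullbackSub S g f h` is generated by the pullbacks of the sections of `S`: a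
morphism that sends these into a subsheaf sends all of `pullbackSub S g f h` there. The reason is
that epimorphisms lift against monomorphisms. -/
lemma memSub_of_memSub_pullbackSub (S : Subobject ((pullback π).obj M)) {N : T.Modules}
    (α : (pullback f).obj M ⟶ N) (F : Subobject N)
    (hF : ∀ (V : G.Opens) (t : Γ((pullback π).obj M, V)), MemSub S V t →
      MemSub F (g ⁻¹ᵁ V) (α.app _ (pullSec₂ h M V t)))
    {V : T.Opens} {t : Γ((pullback f).obj M, V)} (ht : MemSub (pullbackSub S g f h) V t) :
    MemSub F V (α.app V t) := by
  obtain ⟨β, hβ⟩ := exists_hom_of_memSub (g := g) F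
    (S.arrow ≫ pullSec₂Hom h M ≫ (pushforward g).map α) (fun V s => hF V _ ⟨s, rfl⟩)
  obtain ⟨γ, hγ⟩ := exists_pullback_hom g (S : G.Modules) β
  have hcomp : γ ≫ F.arrow = ((pullback g).map S.arrow ≫ pullbackTrans h M) ≫ α := by
    refine pullback_hom_ext g _ _ _ fun V s => ?_
    refine (congrArg (F.arrow.app (g ⁻¹ᵁ V)) (hγ V s)).trans ((hβ V s).trans ?_)
    exact congrArg (α.app (g ⁻¹ᵁ V)) (map_comp_pullbackTrans_app h M S V s).symm
  obtain ⟨p, hp, hp'⟩ := exists_epi_pullbackSub h M S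
  rw [← hp', Category.assoc] at hcomp
  have : StrongEpi p := strongEpi_of_epi p
  have sq : CommSq γ p F.arrow ((pullbackSub S g f h).arrow ≫ α) := ⟨hcomp⟩
  obtain ⟨s, rfl⟩ := ht
  exact ⟨sq.lift.app V s, congr(($(sq.fac_right)).app V s)⟩

lemma pullbackSub_le_iff (S : Subobject ((pullback π).obj M)) (F : Subobject ((pullback f).obj M)) :
    pullbackSub S g f h ≤ F ↔
      ∀ (V : G.Opens) (t : Γ((pullback π).obj M, V)), MemSub S V t →
        MemSub F (g ⁻¹ᵁ V) (pullSec₂ h M V t) :=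
  ⟨fun hle V t ht => subobject_le_iff.1 hle _ _ (memSub_pullbackSub h M S V t ht),
    fun hF => subobject_le_iff.2 fun _ _ ht =>
      memSub_of_memSub_pullbackSub h M S (𝟙 _) F hF ht⟩

instance mono_pushforward_map {N N' : T.Modules} (φ : N ⟶ N') [Mono φ] :
    Mono ((pushforward g).map φ) :=
  mono_of_app_injective _ fun U => app_injective_of_mono φ (g ⁻¹ᵁ U)

/-- Pulling back subsheaves is transitive, although the pullback of modules is not left exact. -/
lemma pullbackSub_comp (S : Subobject ((pullback π).obj M)) {T' : Scheme.{u}} {u : T' ⟶ T}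
    {f' : T' ⟶ X} (h' : u ≫ f = f') (h'' : (u ≫ g) ≫ π = f') :
    pullbackSub S (u ≫ g) f' h'' = pullbackSub (pullbackSub S g f h) u f' h' := by
  refine le_antisymm ?_ ?_
  · rw [pullbackSub_le_iff]
    intro V t ht
    rw [pullSec₂_comp h M h' h'']
    exact memSub_pullbackSub h' M _ _ _ (memSub_pullbackSub h M S V t ht)
  · -- The subsheaf of the pushforward that corresponds to the left hand side contains the pullbacks of
    -- the sections of `S`, hence all of `pullbackSub S g f h`.
    rw [pullbackSub_le_iff]
    intro V t ht
    have := memSub_of_memSub_pullbackSub h M S (pullSec₂Hom h' M)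
      (Subobject.mk ((pushforward u).map (pullbackSub S (u ≫ g) f' h'').arrow))
      (fun V t ht => by
        rw [memSub_mk]
        obtain ⟨s, hs⟩ := memSub_pullbackSub h'' M S V t ht
        exact ⟨s, hs.trans (pullSec₂_comp h M h' h'' V t)⟩) ht
    rw [memSub_mk] at this
    exact this

end

end

section

variable {X T : Scheme.{u}}

/-! ### Frames and graph subbundles -/

lemma IsFrame.coord_frame {M : X.Modules} {n : ℕ} {U : X.Opens} {e : Fin n → Γ(M, U)}
    (he : IsFrame M U e) {V : X.Opens} (h : V ≤ U) (l : Fin n) :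
    he.coord h (AltGrass.res M h (e l)) = Pi.single l 1 :=
  he.coord_eq _ (by simp [Pi.single_apply, ite_smul])

lemma IsFrame.ext_coord {M : X.Modules} {n : ℕ} {U : X.Opens} {e : Fin n → Γ(M, U)}
    (he : IsFrame M U e) {V : X.Opens} (h : V ≤ U) {s t : Γ(M, V)}
    (hst : he.coord h s = he.coord h t) : s = t := by
  rw [← he.coord_spec h s, hst, he.coord_spec h t]

section homOfFrame
variable {P N : X.Modules} {k : ℕ} {p : Fin k → Γ(P, ⊤)} (hp : IsFrame P ⊤ p)
  (t : Fin k → Γ(N, ⊤))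

/-- The morphism that sends a frame to given global sections. -/
def homOfFrame : P ⟶ N :=
  homMk (fun V => AddMonoidHom.mk' (fun s => ∑ l, hp.coord (le_top : V ≤ ⊤) s l • res N le_top (t l))
      (fun s s' => by simp [add_smul, Finset.sum_add_distrib]))
    (fun V a s => by simp [mul_smul, Finset.smul_sum])
    (fun {U V} h s => by
      simp only [AddMonoidHom.mk'_apply, map_sum, res_smul, res_res]
      refine Finset.sum_congr rfl fun l _ => ?_
      rw [← hp.coord_res le_top h s l])

lemma homOfFrame_app (V : X.Opens) (s : Γ(P, V)) : (homOfFrame hp t).app V s =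
    ∑ l, hp.coord (le_top : V ≤ ⊤) s l • res N le_top (t l) := rfl

lemma homOfFrame_app_frame (l : Fin k) : (homOfFrame hp t).app ⊤ (p l) = t l := by
  have h1 : hp.coord (le_top : (⊤ : X.Opens) ≤ ⊤) (p l) = Pi.single l 1 := by
    conv_lhs => rw [← res_self P le_rfl (p l)]
    exact hp.coord_frame le_rfl l
  rw [homOfFrame_app, h1]
  simp [Pi.single_apply, ite_smul, res_self]

lemma hom_ext_of_frame (hp : IsFrame P ⊤ p) {φ ψ : P ⟶ N} (h : ∀ l, φ.app ⊤ (p l) = ψ.app ⊤ (p l)) : φ = ψ := by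
  ext V s
  rw [← hp.coord_spec (le_top : V ≤ ⊤) s, map_sum, map_sum]
  simp only [Hom.app_smul, app_res, h]

/-- Two modules with frames of the same rank are isomorphic. -/
def isoOfFrames {t : Fin k → Γ(N, ⊤)} (ht : IsFrame N ⊤ t) : P ≅ N where
  hom := homOfFrame hp t
  inv := homOfFrame ht p
  hom_inv_id := hom_ext_of_frame hp fun l => by
    simp [homOfFrame_app_frame]
  inv_hom_id := hom_ext_of_frame ht fun l => by
    simp [homOfFrame_app_frame]
end homOfFrame

lemma IsFrame.restrict {M : X.Modules} {n : ℕ} {U : X.Opens} {e : Fin n → Γ(M, U)}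
    (he : IsFrame M U e) : ∃ e' : Fin n → Γ(M.restrict U.ι, ⊤), IsFrame (M.restrict U.ι) ⊤ e' := by
  have hU : U.ι ''ᵁ ⊤ ≤ U := by simp
  let e₀ : Fin n → Γ(M, U.ι ''ᵁ ⊤) := fun l => AltGrass.res M hU (e l)
  refine ⟨fun l => (e₀ l : Γ(M, U.ι ''ᵁ ⊤)), ?_⟩
  intro W h t
  have hW : U.ι ''ᵁ W ≤ U := (U.ι.image_mono le_top).trans hU
  obtain ⟨a, ha, hu⟩ := he (U.ι ''ᵁ W) hW (show Γ(M, U.ι ''ᵁ W) from t)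
  have key (b : Fin n → Γ(U, W)) :
      (∑ l, b l • AltGrass.res (M.restrict U.ι) h (e₀ l : Γ(M, U.ι ''ᵁ ⊤)) : Γ(M.restrict U.ι, W)) =
      (∑ l, ((U.ι.appIso W).inv (b l)) • AltGrass.res M hW (e l) : Γ(M, U.ι ''ᵁ W)) := by
    refine Finset.sum_congr rfl fun l _ => ?_
    exact congrArg (((U.ι.appIso W).inv (b l)) • ·)
      (res_res M hU (U.ι.image_mono le_top : U.ι ''ᵁ W ≤ _) (e l))
  refine ⟨fun l => (U.ι.appIso W).hom (a l), (key _).trans (Eq.trans ?_ ha), fun b hb => ?_⟩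
  · refine Finset.sum_congr rfl fun l _ => ?_
    exact congrArg (· • AltGrass.res M hW (e l)) congr($((U.ι.appIso W).hom_inv_id) (a l))
  · have h1 : (fun l => (U.ι.appIso W).inv (b l)) = a := hu _ ((key b).symm.trans hb)
    funext l
    rw [← h1]
    exact congr($((U.ι.appIso W).inv_hom_id) (b l)).symm

lemma IsFrame.isVectorBundle {M : X.Modules} {n : ℕ} {e : Fin n → Γ(M, ⊤)} (he : IsFrame M ⊤ e) :
    IsVectorBundle n M := by
  intro p
  obtain ⟨e', he'⟩ := he.restrict
  obtain ⟨e'', he''⟩ := isFrame_free (X := ((⊤ : X.Opens) : Scheme.{u})) n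
  exact ⟨⊤, trivial, ⟨isoOfFrames he' he''⟩⟩

lemma exists_isFrame (X : Scheme.{u}) (n : ℕ) :
    ∃ (Q : X.Modules) (q : Fin n → Γ(Q, ⊤)), IsFrame Q ⊤ q :=
  ⟨_, isFrame_free n⟩

/-- A free module of rank `n`. -/
def freeMod (X : Scheme.{u}) (n : ℕ) : X.Modules := (exists_isFrame X n).choose

/-- The standard frame of `freeMod X n`. -/
def freeFrame (X : Scheme.{u}) (n : ℕ) : Fin n → Γ(freeMod X n, ⊤) :=
  (exists_isFrame X n).choose_spec.choose

lemma isFrame_freeFrame (X : Scheme.{u}) (n : ℕ) : IsFrame (freeMod X n) ⊤ (freeFrame X n) :=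
  (exists_isFrame X n).choose_spec.choose_spec

section graph
variable {N : T.Modules} {n k : ℕ} (ε : Fin k ⊕ Fin (n - k) ≃ Fin n) {e : Fin n → Γ(N, ⊤)}
  (he : IsFrame N ⊤ e) (a : Fin k → Fin (n - k) → Γ(T, ⊤))

/-- The sections `e_i + ∑ j, a i j • e_j` that span the graph of the matrix `a`. -/
def graphSec (e : Fin n → Γ(N, ⊤)) (a : Fin k → Fin (n - k) → Γ(T, ⊤)) (i : Fin k) : Γ(N, ⊤) :=
  e (ε (.inl i)) + ∑ j, a i j • e (ε (.inr j))

/-- The condition on coordinate vectors to lie on the graph of the matrix `a`. -/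
def OnGraph {A : Type*} [CommRing A] (a : Fin k → Fin (n - k) → A) (c : Fin n → A) : Prop :=
  ∀ j, c (ε (.inr j)) = ∑ i, c (ε (.inl i)) * a i j

lemma coord_sum_graphSec {V : T.Opens} (b : Fin k → Γ(T, V)) :
    he.coord (le_top : V ≤ ⊤) (∑ i, b i • res N le_top (graphSec ε e a i)) =
      fun l => Sum.elim b (fun j => ∑ i, b i * resO le_top (a i j)) (ε.symm l) := by
  refine he.coord_eq le_top ?_
  rw [← Equiv.sum_comp ε, Fintype.sum_sum_type]
  simp only [Equiv.symm_apply_apply, Sum.elim_inl, Sum.elim_inr, graphSec, map_add, map_sum,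
    res_smul, smul_add, Finset.sum_add_distrib, Finset.smul_sum, Finset.sum_smul, mul_smul]
  congr 1
  exact Finset.sum_comm

lemma onGraph_iff {V : T.Opens} (t : Γ(N, V)) :
    OnGraph ε (fun i j => resO le_top (a i j)) (he.coord (le_top : V ≤ ⊤) t) ↔
      ∃ b : Fin k → Γ(T, V), ∑ i, b i • res N le_top (graphSec ε e a i) = t := by
  constructor
  · intro h
    refine ⟨fun i => he.coord le_top t (ε (.inl i)), he.ext_coord le_top ?_⟩
    rw [coord_sum_graphSec]
    funext l
    obtain ⟨l, rfl⟩ := ε.surjective l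
    rcases l with i | j
    · simp
    · simpa using (h j).symm
  · rintro ⟨b, rfl⟩ j
    rw [coord_sum_graphSec]
    simp

/-- The morphism `𝒪^k ⟶ N` given by the sections `graphSec`. -/
def graphHom : freeMod T k ⟶ N :=
  homOfFrame (isFrame_freeFrame T k) (graphSec ε e a)

lemma mono_graphHom (he : IsFrame N ⊤ e) (a : Fin k → Fin (n - k) → Γ(T, ⊤)) : Mono (graphHom ε (e := e) a) := by
  refine mono_of_app_injective _ fun V s t hst => ?_
  have h1 := congrArg (he.coord (le_top : V ≤ ⊤)) hst
  rw [graphHom, homOfFrame_app, homOfFrame_app, coord_sum_graphSec, coord_sum_graphSec] at h1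
  refine (isFrame_freeFrame T k).ext_coord le_top (funext fun i => ?_)
  simpa using congrFun h1 (ε (.inl i))

/-- The subsheaf of `N` spanned by the sections `e_i + ∑ j, a i j • e_j`. -/
def graphSub : Subobject N :=
  have := mono_graphHom ε he a
  Subobject.mk (graphHom ε (e := e) a)

lemma memSub_graphSub_iff_exists {V : T.Opens} (t : Γ(N, V)) :
    MemSub (graphSub ε he a) V t ↔
      ∃ b : Fin k → Γ(T, V), ∑ i, b i • res N le_top (graphSec ε e a i) = t := by
  have := mono_graphHom ε he a
  rw [graphSub, memSub_mk]
  constructor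
  · rintro ⟨s, rfl⟩
    exact ⟨_, rfl⟩
  · rintro ⟨b, rfl⟩
    refine ⟨∑ i, b i • res _ le_top (freeFrame T k i), ?_⟩
    rw [graphHom, homOfFrame_app, (isFrame_freeFrame T k).coord_eq le_top rfl]

lemma memSub_graphSub {V : T.Opens} (t : Γ(N, V)) : MemSub (graphSub ε he a) V t ↔
    OnGraph ε (fun i j => resO le_top (a i j)) (he.coord (le_top : V ≤ ⊤) t) := by
  rw [memSub_graphSub_iff_exists, onGraph_iff]

lemma isVectorBundle_graphSub : IsVectorBundle k (graphSub ε he a : T.Modules) := by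
  have := mono_graphHom ε he a
  have := (isFrame_freeFrame T k).map_iso
    (Subobject.underlyingIso (graphHom ε (e := e) a)).symm
  exact this.isVectorBundle

/-- The quotient by the graph of a matrix is free, on the classes of the `e (ε (inr j))`: the
projection `ρ` along the graph is a cokernel. -/
lemma isVectorBundle_cokernel_graphSub :
    IsVectorBundle (n - k) (Limits.cokernel (graphSub ε he a).arrow) := by
  obtain ⟨Q, q, hq⟩ := exists_isFrame T (n - k)
  let v : Fin n → Γ(Q, ⊤) := fun l => Sum.elim (fun i => - ∑ j, a i j • q j) q (ε.symm l)
  let ρ : N ⟶ Q := homOfFrame he v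
  have hρl (i : Fin k) : ρ.app ⊤ (e (ε (.inl i))) = - ∑ j, a i j • q j := by
    simp [ρ, homOfFrame_app_frame, v]
  have hρr (j : Fin (n - k)) : ρ.app ⊤ (e (ε (.inr j))) = q j := by
    simp [ρ, homOfFrame_app_frame, v]
  have hρ : (graphSub ε he a).arrow ≫ ρ = 0 := by
    ext V s
    obtain ⟨b, hb⟩ := (memSub_graphSub_iff_exists ε he a _).1
      (⟨s, rfl⟩ : MemSub (graphSub ε he a) V ((graphSub ε he a).arrow.app V s))
    have h0 (i : Fin k) : ρ.app ⊤ (graphSec ε e a i) = 0 := by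
      rw [graphSec, map_add, map_sum]
      simp only [Hom.app_smul, hρl, hρr]
      simp
    change ρ.app V ((graphSub ε he a).arrow.app V s) = 0
    rw [← hb, map_sum]
    simp [Hom.app_smul, app_res, h0]
  have hd (Z : T.Modules) (ψ : N ⟶ Z) (hψ : (graphSub ε he a).arrow ≫ ψ = 0) :
      ρ ≫ homOfFrame hq (fun j => ψ.app ⊤ (e (ε (.inr j)))) = ψ := by
    refine hom_ext_of_frame he fun l => ?_
    obtain ⟨l, rfl⟩ := ε.surjective l
    rcases l with i | j
    · have h0 : ψ.app ⊤ (graphSec ε e a i) = 0 := by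
        obtain ⟨s, hs⟩ := (memSub_graphSub_iff_exists ε he a (graphSec ε e a i)).2
          ⟨Pi.single i 1, by simp [Pi.single_apply, ite_smul, res_self]⟩
        rw [← hs]
        exact congr(($hψ).app ⊤ s)
      rw [graphSec, map_add, map_sum] at h0
      simp only [Hom.app_smul] at h0
      rw [Hom.comp_app, ConcreteCategory.comp_apply, hρl, map_neg, map_sum]
      simp only [Hom.app_smul, homOfFrame_app_frame hq]
      exact (eq_neg_of_add_eq_zero_left h0).symm
    · rw [Hom.comp_app, ConcreteCategory.comp_apply, hρr, homOfFrame_app_frame]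
  have hcolim : Limits.IsColimit (Limits.CokernelCofork.ofπ ρ hρ) :=
    Limits.CokernelCofork.IsColimit.ofπ ρ hρ
      (fun {Z} ψ hψ => homOfFrame hq (fun j => ψ.app ⊤ (e (ε (.inr j)))))
      (fun {Z} ψ hψ => hd Z ψ hψ)
      (fun {Z} ψ hψ m hm => by
        refine hom_ext_of_frame hq fun j => ?_
        rw [homOfFrame_app_frame, ← hm, Hom.comp_app, ConcreteCategory.comp_apply, hρr])
  have iso := (Limits.cokernelIsCokernel (graphSub ε he a).arrow).coconePointUniqueUpToIso hcolim
  exact (hq.map_iso (M := Q) iso.symm).isVectorBundle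

lemma isSubbundle_graphSub : IsSubbundle n k (graphSub ε he a) :=
  ⟨isVectorBundle_graphSub ε he a, isVectorBundle_cokernel_graphSub ε he a⟩

lemma memSub_graphSec (i : Fin k) : MemSub (graphSub ε he a) ⊤ (graphSec ε e a i) :=
  (memSub_graphSub_iff_exists ε he a (graphSec ε e a i)).2
          ⟨Pi.single i 1, by simp [Pi.single_apply, ite_smul, res_self]⟩

lemma graphSub_le_iff (F : Subobject N) :
    graphSub ε he a ≤ F ↔ ∀ i, MemSub F ⊤ (graphSec ε e a i) := by
  constructor
  · exact fun h i => subobject_le_iff.1 h _ _ (memSub_graphSec ε he a i)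
  · intro h
    refine subobject_le_iff.2 fun V t ht => ?_
    obtain ⟨b, rfl⟩ := (memSub_graphSub_iff_exists ε he a t).1 ht
    exact MemSub.sum _ fun i => ((h i).res le_top).smul _

lemma graphSub_injective {a b : Fin k → Fin (n - k) → Γ(T, ⊤)}
    (h : graphSub ε he a = graphSub ε he b) : a = b := by
  funext i j
  have h1 := memSub_graphSec ε he a i
  rw [h, memSub_graphSub] at h1
  have h2 := coord_sum_graphSec ε he a (V := ⊤) (Pi.single i 1)
  simp only [Pi.single_apply, ite_smul, one_smul, zero_smul, Finset.sum_ite_eq', Finset.mem_univ,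
    if_true, res_self] at h2
  have h3 := h1 j
  rw [h2] at h3
  simpa [resO_self, Pi.single_apply] using h3

end graph

end

section

variable {X T G : Scheme.{u}}

/-! ### Subsheaves that are graphs in a pulled back frame -/

section
variable {M : X.Modules} {n k : ℕ} {U : X.Opens} {e : Fin n → Γ(M, U)} (he : IsFrame M U e)
  (ε : Fin k ⊕ Fin (n - k) ≃ Fin n) {π : G ⟶ X} {g : T ⟶ G} {f : T ⟶ X} (h : g ≫ π = f)

/-- The pulled back frame, over a scheme that maps into the open set on which it is given. -/
def globalFrame (M : X.Modules) (e : Fin n → Γ(M, U)) (f : T ⟶ X) (hf : (⊤ : T.Opens) ≤ f ⁻¹ᵁ U) (l : Fin n) :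
    Γ((pullback f).obj M, ⊤) :=
  res _ hf (pullSec f M U (e l))

lemma isFrame_globalFrame (he : IsFrame M U e) (f : T ⟶ X) (hf : (⊤ : T.Opens) ≤ f ⁻¹ᵁ U) :
    IsFrame ((pullback f).obj M) ⊤ (globalFrame M e f hf) :=
  (he.pull f).res hf

lemma coord_globalFrame (f : T ⟶ X) (hf : (⊤ : T.Opens) ≤ f ⁻¹ᵁ U) {V : T.Opens}
    (hV : V ≤ f ⁻¹ᵁ U) (t : Γ((pullback f).obj M, V)) :
    (isFrame_globalFrame he f hf).coord le_top t = (he.pull f).coord hV t := by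
  refine (isFrame_globalFrame he f hf).coord_eq le_top ?_
  simp only [globalFrame, res_res]
  exact (he.pull f).coord_spec hV t

/-- Coordinates of pulled back sections. -/
lemma coord_pullSec₂ {V : G.Opens} (hV : V ≤ π ⁻¹ᵁ U) (hV' : g ⁻¹ᵁ V ≤ f ⁻¹ᵁ U)
    (t : Γ((pullback π).obj M, V)) (l : Fin n) :
    (he.pull f).coord hV' (pullSec₂ h M V t) l = g.app V ((he.pull π).coord hV t l) := by
  refine congrFun ((he.pull f).coord_eq hV' (a := fun l => g.app V ((he.pull π).coord hV t l)) ?_) l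
  conv_rhs => rw [← (he.pull π).coord_spec hV t, map_sum]
  refine Finset.sum_congr rfl fun l _ => ?_
  rw [pullSec₂_smul, pullSec₂_res, pullSec₂_pullSec, res_res]

lemma OnGraph.map {A B : Type*} [CommRing A] [CommRing B] (φ : A →+* B)
    {a : Fin k → Fin (n - k) → A} {c : Fin n → A} (hc : OnGraph ε a c) :
    OnGraph ε (fun i j => φ (a i j)) (fun l => φ (c l)) := by
  intro j
  simp only [hc j, map_sum, map_mul]

/-- Over the open set `W`, the subsheaf `S` of `π^* M` is the graph of the matrix `a`, in the frame
pulled back from `e`. -/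
def IsGraphOn (S : Subobject ((pullback π).obj M)) (W : G.Opens) (hW : W ≤ π ⁻¹ᵁ U)
    (a : Fin k → Fin (n - k) → Γ(G, W)) : Prop :=
  ∀ (V : G.Opens) (hV : V ≤ W) (t : Γ((pullback π).obj M, V)), MemSub S V t ↔
    OnGraph ε (fun i j => resO hV (a i j)) ((he.pull π).coord (hV.trans hW) t)

/-- The graph of a matrix, over a scheme that maps into the open set on which the frame is given. -/
def pullGraph (f : T ⟶ X) (hf : (⊤ : T.Opens) ≤ f ⁻¹ᵁ U) (a : Fin k → Fin (n - k) → Γ(T, ⊤)) :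
    Subobject ((pullback f).obj M) :=
  graphSub ε (isFrame_globalFrame he f hf) a

lemma isGraphOn_pullGraph (f : T ⟶ X) (hf : (⊤ : T.Opens) ≤ f ⁻¹ᵁ U)
    (a : Fin k → Fin (n - k) → Γ(T, ⊤)) :
    IsGraphOn he ε (pullGraph he ε f hf a) ⊤ hf a := by
  intro V hV t
  rw [pullGraph, memSub_graphSub, coord_globalFrame he f hf (hV.trans hf)]

/-- The basis sections of a graph. -/
def rowSec (π : G ⟶ X) {W : G.Opens} (hW : W ≤ π ⁻¹ᵁ U) (e : Fin n → Γ(M, U))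
    (a : Fin k → Fin (n - k) → Γ(G, W)) (i : Fin k) : Γ((pullback π).obj M, W) :=
  ∑ l, Sum.elim (Pi.single i 1) (a i) (ε.symm l) • res _ hW (pullSec π M U (e l))

lemma coord_rowSec {W : G.Opens} (hW : W ≤ π ⁻¹ᵁ U)
    (a : Fin k → Fin (n - k) → Γ(G, W)) (i : Fin k) :
    (he.pull π).coord hW (rowSec ε π hW e a i) =
      fun l => Sum.elim (Pi.single i 1) (a i) (ε.symm l) :=
  (he.pull π).coord_eq hW rfl

lemma onGraph_row {A : Type*} [CommRing A] (a : Fin k → Fin (n - k) → A) (i : Fin k) :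
    OnGraph ε a (fun l => Sum.elim (Pi.single i 1) (a i) (ε.symm l)) := by
  intro j
  simp [Pi.single_apply]

variable {he ε} in
lemma IsGraphOn.memSub_rowSec {S : Subobject ((pullback π).obj M)} {W : G.Opens}
    {hW : W ≤ π ⁻¹ᵁ U} {a : Fin k → Fin (n - k) → Γ(G, W)} (hS : IsGraphOn he ε S W hW a)
    (i : Fin k) : MemSub S W (rowSec ε π hW e a i) := by
  rw [hS W le_rfl, coord_rowSec he]
  simpa only [resO_self] using onGraph_row ε a i

lemma graphSec_eq_rowSec (f : T ⟶ X) (hf : (⊤ : T.Opens) ≤ f ⁻¹ᵁ U)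
    (a : Fin k → Fin (n - k) → Γ(T, ⊤)) (i : Fin k) :
    graphSec ε (globalFrame M e f hf) a i = rowSec ε f hf e a i := by
  rw [graphSec, rowSec, ← Equiv.sum_comp ε, Fintype.sum_sum_type]
  simp [globalFrame, Pi.single_apply, ite_smul]

/-- Pullback of a matrix of functions. -/
def pullMat (g : T ⟶ G) {W : G.Opens} (hW : (⊤ : T.Opens) ≤ g ⁻¹ᵁ W)
    (a : Fin k → Fin (n - k) → Γ(G, W)) : Fin k → Fin (n - k) → Γ(T, ⊤) :=
  fun i j => resO hW (g.app W (a i j))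

/-- The pullback of a graph is the graph of the pulled back matrix. -/
lemma IsGraphOn.pullbackSub_eq {S : Subobject ((pullback π).obj M)} {W : G.Opens}
    {hW : W ≤ π ⁻¹ᵁ U} {a : Fin k → Fin (n - k) → Γ(G, W)} (hS : IsGraphOn he ε S W hW a)
    (hgW : (⊤ : T.Opens) ≤ g ⁻¹ᵁ W) (hf : (⊤ : T.Opens) ≤ f ⁻¹ᵁ U) :
    pullbackSub S g f h = pullGraph he ε f hf (pullMat g hgW a) := by
  refine le_antisymm ?_ ?_
  · rw [pullbackSub_le_iff]
    intro V t ht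
    rw [isGraphOn_pullGraph he ε f hf _ _ le_top]
    have hVW : g ⁻¹ᵁ V ≤ g ⁻¹ᵁ (V ⊓ W) := le_inf le_rfl (le_top.trans hgW)
    have h1 := (hS (V ⊓ W) inf_le_right _).1 (ht.res inf_le_left)
    have h2 := h1.map ε (g.app (V ⊓ W)).hom
    have h3 := h2.map ε (resO hVW)
    have hc (l : Fin n) : (he.pull f).coord (le_top.trans hf) (pullSec₂ h M V t) l =
        resO hVW (g.app (V ⊓ W) ((he.pull π).coord (V := V ⊓ W) (inf_le_right.trans hW)
          (res _ inf_le_left t) l)) := by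
      rw [← coord_pullSec₂ he h (V := V ⊓ W) (inf_le_right.trans hW) (le_top.trans hf),
        ← (he.pull f).coord_res (le_top.trans hf) hVW, pullSec₂_res, res_res, res_self]
    have ha (i : Fin k) (j : Fin (n - k)) : resO (le_top : g ⁻¹ᵁ V ≤ ⊤) (pullMat g hgW a i j) =
        resO hVW (g.app (V ⊓ W) (resO inf_le_right (a i j))) := by
      rw [pullMat, app_resO, resO_resO, resO_resO]
    have hc' := funext hc
    simp only [ha]
    rw [hc']
    exact h3
  · rw [pullGraph, graphSub_le_iff]
    intro i
    have h1 := (memSub_pullbackSub h M S W _ (hS.memSub_rowSec i)).res hgW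
    refine Eq.mp (congrArg _ ?_) h1
    refine (he.pull f).ext_coord hf ?_
    funext l
    have hV : g ⁻¹ᵁ W ≤ f ⁻¹ᵁ U := (g.preimage_mono hW).trans (preimage_le_of_comp_eq h U)
    rw [graphSec_eq_rowSec, coord_rowSec he]
    refine ((he.pull f).coord_res hV hgW _ l).trans ?_
    rw [coord_pullSec₂ he h hW, coord_rowSec he]
    obtain ⟨l, rfl⟩ := ε.surjective l
    simp only [Equiv.symm_apply_apply]
    rcases l with i' | j
    · simp only [Sum.elim_inl, Pi.single_apply]
      split_ifs <;> simp
    · rfl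

/-- If the pullback of `S` along `g` is the graph of the matrix `a`, then its pullback along `u ≫
g` is the graph of the pullback of `a`. -/
lemma pullbackSub_comp_eq {S : Subobject ((pullback π).obj M)} {hf : (⊤ : T.Opens) ≤ f ⁻¹ᵁ U}
    {a : Fin k → Fin (n - k) → Γ(T, ⊤)} (hS : pullbackSub S g f h = pullGraph he ε f hf a)
    {T' : Scheme.{u}} {u : T' ⟶ T} {f' : T' ⟶ X} (h' : u ≫ f = f') (h'' : (u ≫ g) ≫ π = f')
    (hf' : (⊤ : T'.Opens) ≤ f' ⁻¹ᵁ U) :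
    pullbackSub S (u ≫ g) f' h'' = pullGraph he ε f' hf' (pullMat u le_top a) := by
  rw [pullbackSub_comp h M S h' h'', hS]
  exact (isGraphOn_pullGraph he ε f hf a).pullbackSub_eq he ε h' le_top hf'

lemma pullGraph_injective {f : T ⟶ X} {hf : (⊤ : T.Opens) ≤ f ⁻¹ᵁ U}
    {a b : Fin k → Fin (n - k) → Γ(T, ⊤)} (h : pullGraph he ε f hf a = pullGraph he ε f hf b) :
    a = b :=
  graphSub_injective ε _ h

lemma isSubbundle_pullGraph (f : T ⟶ X) (hf : (⊤ : T.Opens) ≤ f ⁻¹ᵁ U)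
    (a : Fin k → Fin (n - k) → Γ(T, ⊤)) : IsSubbundle n k (pullGraph he ε f hf a) :=
  isSubbundle_graphSub ε _ a

end

end

section

/-! ### Smooth algebras and the Jacobian matrix -/

section

open MvPolynomial

variable {R B ι γ : Type*} [CommRing R] [CommRing B] [Algebra R B] [Algebra (MvPolynomial ι R) B]
  [IsScalarTower R (MvPolynomial ι R) B]

/-- The Jacobian criterion: in a principal localization of a polynomial ring, equations with an
invertible maximal minor of the Jacobian matrix define a standard smooth algebra. -/
theorem isStandardSmoothOfRelativeDimension_quotient [Fintype ι] [Fintype γ] [DecidableEq γ]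
    (t : MvPolynomial ι R) [IsLocalization.Away t B] (P : γ → MvPolynomial ι R) (a : γ → ι)
    (ha : Function.Injective a)
    (hu : IsUnit (algebraMap (MvPolynomial ι R) B
      (Matrix.of fun i j => pderiv (a i) (P j)).det)) :
    Algebra.IsStandardSmoothOfRelativeDimension (Fintype.card ι - Fintype.card γ) R
      (B ⧸ Ideal.span (Set.range fun g => algebraMap (MvPolynomial ι R) B (P g))) := by
  let I := Ideal.span (Set.range P)
  have hI : Ideal.span (Set.range fun g => algebraMap (MvPolynomial ι R) B (P g)) =
      I.map (algebraMap (MvPolynomial ι R) B) := by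
    rw [Ideal.map_span, ← Set.range_comp]
    rfl
  rw [hI]
  have hloc : IsLocalization.Away (Ideal.Quotient.mk I t)
      (B ⧸ I.map (algebraMap (MvPolynomial ι R) B)) := by
    have : IsLocalization (Algebra.algebraMapSubmonoid (MvPolynomial ι R ⧸ I) (Submonoid.powers t))
      (B ⧸ I.map (algebraMap (MvPolynomial ι R) B)) := inferInstance
    rwa [Algebra.algebraMapSubmonoid_powers] at this
  -- The presentation by the equations `P`, followed by the inversion of `t`.
  let Q := Algebra.PreSubmersivePresentation.naive (R := R) (v := P) a ha
  let L := Algebra.PreSubmersivePresentation.localizationAway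
    (B ⧸ I.map (algebraMap (MvPolynomial ι R) B)) (Ideal.Quotient.mk I t)
  have : IsScalarTower R (MvPolynomial ι R ⧸ I) (B ⧸ I.map (algebraMap (MvPolynomial ι R) B)) :=
    IsScalarTower.of_algebraMap_eq (R := R) (S := MvPolynomial ι R ⧸ I)
      (A := B ⧸ I.map (algebraMap (MvPolynomial ι R) B)) fun x =>
        congrArg (Ideal.Quotient.mk (I.map (algebraMap (MvPolynomial ι R) B)))
          (IsScalarTower.algebraMap_apply R (MvPolynomial ι R) B x)
  have hunit : IsUnit (L.comp Q).jacobian := by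
    rw [Algebra.PreSubmersivePresentation.comp_jacobian_eq_jacobian_smul_jacobian,
      Algebra.smul_def]
    refine IsUnit.mul ?_ ?_
    · rw [Algebra.PreSubmersivePresentation.jacobian_eq_jacobiMatrix_det]
      have h2 : Q.jacobiMatrix = Matrix.of fun i j => pderiv (a i) (P j) := by
        ext1 i j
        exact Algebra.PreSubmersivePresentation.jacobiMatrix_naive a ha _ _ i j
      rw [h2]
      have h3 := hu.map (Ideal.Quotient.mk (I.map (algebraMap (MvPolynomial ι R) B)))
      convert h3 using 1
      have h4 (p : MvPolynomial ι R) :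
          algebraMap Q.Ring (MvPolynomial ι R ⧸ I) p = Ideal.Quotient.mk I p := by
        have : aeval (R := R) (fun i => Ideal.Quotient.mk I (X i)) p = Ideal.Quotient.mkₐ R I p := by
          congr 1
          ext
          simp
        rw [Algebra.Generators.algebraMap_apply]
        exact this
      exact congrArg (algebraMap (MvPolynomial ι R ⧸ I)
        (B ⧸ I.map (algebraMap (MvPolynomial ι R) B))) (h4 _)
    · rw [Algebra.PreSubmersivePresentation.localizationAway_jacobian]
      exact IsLocalization.Away.algebraMap_isUnit (Ideal.Quotient.mk I t)
  refine Algebra.SubmersivePresentation.isStandardSmoothOfRelativeDimension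
    (P := { toPreSubmersivePresentation := L.comp Q, jacobian_isUnit := hunit }) ?_
  simp [Algebra.Presentation.dimension, Nat.add_sub_add_left]

end

section

variable (R A A' K : Type*) [CommRing R] [CommRing A] [CommRing A'] [Field K] [Algebra R A]
  [Algebra R A'] [Algebra A A'] [IsScalarTower R A A'] [Algebra R K] [Algebra A K] [Algebra A' K]
  [IsScalarTower R A K] [IsScalarTower R A' K] [IsScalarTower A A' K]

/-- Restriction of derivations along `A → A'`. -/
def restrictDer : Derivation R A' K →ₗ[K] Derivation R A K where
  toFun d := d.compAlgebraMap A
  map_add' _ _ := rfl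
  map_smul' _ _ := rfl

/-- Derivations extend uniquely to a localization, because localizations are formally étale. -/
lemma restrictDer_bijective (t : A) [IsLocalization.Away t A'] :
    Function.Bijective (restrictDer R A A' K) := by
  have : Algebra.FormallyEtale A A' :=
    Algebra.FormallyEtale.of_isLocalization (Submonoid.powers t)
  have hbc := KaehlerDifferential.isBaseChange_of_formallyEtale R A A'
  constructor
  · intro d d' h
    apply (KaehlerDifferential.linearMapEquivDerivation R A').symm.injective
    refine hbc.algHom_ext' _ _ ?_
    ext a
    change d.liftKaehlerDifferential (KaehlerDifferential.map R R A A' (KaehlerDifferential.D R A a)) =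
      d'.liftKaehlerDifferential (KaehlerDifferential.map R R A A' (KaehlerDifferential.D R A a))
    rw [KaehlerDifferential.map_D, d.liftKaehlerDifferential_comp_D, d'.liftKaehlerDifferential_comp_D]
    exact congr($h a)
  · intro d
    let g : Ω[A'⁄R] →ₗ[A'] K := hbc.lift d.liftKaehlerDifferential
    refine ⟨g.compDer (KaehlerDifferential.D R A'), ?_⟩
    ext a
    change g (KaehlerDifferential.D R A' (algebraMap A A' a)) = d a
    have := hbc.lift_eq d.liftKaehlerDifferential (KaehlerDifferential.D R A a)
    rw [KaehlerDifferential.map_D] at this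
    refine this.trans (d.liftKaehlerDifferential_comp_D a)

/-- The relative dimension of a standard smooth algebra is the dimension of its tangent spaces. -/
lemma finrank_derivation_of_isStandardSmooth (d : ℕ)
    [Algebra.IsStandardSmoothOfRelativeDimension d R A] :
    Module.finrank K (Derivation R A K) = d := by
  have : Nontrivial A := (algebraMap A K).domain_nontrivial
  have := Algebra.IsStandardSmoothOfRelativeDimension.isStandardSmooth d (R := R) (S := A)
  have hr := Algebra.IsStandardSmoothOfRelativeDimension.rank_kaehlerDifferential (R := R) (S := A) d
  let b := Module.Free.chooseBasis A Ω[A⁄R]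
  have hcard : Cardinal.mk (Module.Free.ChooseBasisIndex A Ω[A⁄R]) = d := by
    rw [← hr, b.mk_eq_rank'']
  have hfin : Finite (Module.Free.ChooseBasisIndex A Ω[A⁄R]) := by
    rw [← Cardinal.lt_aleph0_iff_finite, hcard]
    exact Cardinal.natCast_lt_aleph0
  have := Fintype.ofFinite (Module.Free.ChooseBasisIndex A Ω[A⁄R])
  rw [Cardinal.mk_fintype, Nat.cast_inj] at hcard
  let e : Derivation R A K ≃ₗ[K] (Module.Free.ChooseBasisIndex A Ω[A⁄R] → K) :=
    { toFun := fun D i => D.liftKaehlerDifferential (b i)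
      map_add' := fun D D' => by
        funext i
        exact congr($((KaehlerDifferential.linearMapEquivDerivation R A).symm.map_add D D') (b i))
      map_smul' := fun c D => by
        funext i
        have : (c • D).liftKaehlerDifferential = c • D.liftKaehlerDifferential :=
          Derivation.liftKaehlerDifferential_unique _ _ (by ext; simp)
        exact congr($this (b i))
      invFun := fun v => (b.constr ℕ v).compDer (KaehlerDifferential.D R A)
      left_inv := fun D => by
        have : b.constr ℕ (fun i => D.liftKaehlerDifferential (b i)) = D.liftKaehlerDifferential :=
          b.ext fun i => by simp
        ext a
        simp [this]
      right_inv := fun v => by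
        funext i
        have : ((b.constr ℕ v).compDer (KaehlerDifferential.D R A)).liftKaehlerDifferential =
            b.constr ℕ v := Derivation.liftKaehlerDifferential_unique _ _ (by ext; simp)
        change ((b.constr ℕ v).compDer (KaehlerDifferential.D R A)).liftKaehlerDifferential (b i) = _
        rw [this]
        simp }
  rw [e.finrank_eq, Module.finrank_fintype_fun_eq_card, hcard]

end

/-- Derivations of a quotient are the derivations that kill the kernel. -/
lemma exists_derivation_quotient (R A C K : Type*) [CommRing R] [CommRing A] [CommRing C] [Field K]
    [Algebra R A] [Algebra R C] [Algebra A C] [IsScalarTower R A C] [Algebra R K] [Algebra A K]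
    [Algebra C K] [IsScalarTower A C K] (hC : Function.Surjective (algebraMap A C)) :
    ∃ e : Derivation R C K →ₗ[K] Derivation R A K, Function.Injective e ∧
      ∀ D, D ∈ LinearMap.range e ↔ ∀ f ∈ RingHom.ker (algebraMap A C), D f = 0 := by
  refine ⟨{ toFun := fun d => d.compAlgebraMap A
            map_add' := fun _ _ => rfl
            map_smul' := fun _ _ => rfl }, fun d d' h => ?_, fun D => ⟨?_, fun h => ?_⟩⟩
  · ext a
    obtain ⟨a, rfl⟩ := hC a
    exact congr($h a)
  · rintro ⟨d, rfl⟩ f hf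
    change d (algebraMap A C f) = 0
    rw [show algebraMap A C f = 0 from hf, map_zero]
  · let α := (IsScalarTower.toAlgHom R A C).toLinearMap
    have hα' : Function.Surjective α := hC
    have hα : LinearMap.ker α ≤ LinearMap.ker D.toLinearMap := fun f hf => h f hf
    let l : C →ₗ[R] K := (LinearMap.ker α).liftQ D.toLinearMap hα ∘ₗ
      (α.quotKerEquivOfSurjective hα').symm.toLinearMap
    have hl (a : A) : l (algebraMap A C a) = D a := by
      change (LinearMap.ker α).liftQ D.toLinearMap hα
        ((α.quotKerEquivOfSurjective hα').symm (α a)) = D a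
      rw [LinearMap.quotKerEquivOfSurjective_symm_apply]
      rfl
    refine ⟨Derivation.mk' l fun a b => ?_, ?_⟩
    · obtain ⟨a, rfl⟩ := hC a
      obtain ⟨b, rfl⟩ := hC b
      rw [← map_mul, hl, hl, hl, D.leibniz]
      simp only [algebraMap_smul]
    · ext a
      exact hl a

section

open MvPolynomial

lemma derivation_mvPolynomial {R K ι : Type*} [CommRing R] [Field K] [Fintype ι] [Algebra R K]
    [Algebra (MvPolynomial ι R) K] [IsScalarTower R (MvPolynomial ι R) K]
    (D : Derivation R (MvPolynomial ι R) K) (p : MvPolynomial ι R) :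
    D p = ∑ i, algebraMap (MvPolynomial ι R) K (pderiv i p) * D (X i) := by
  classical
  induction p using MvPolynomial.induction_on with
  | C a => simp
  | add p q hp hq => simp [hp, hq, add_mul, Finset.sum_add_distrib]
  | mul_X p j hp =>
    simp only [Derivation.leibniz, hp, pderiv_X, smul_eq_mul, Algebra.smul_def, map_add, map_mul,
      add_mul, Finset.sum_add_distrib, Finset.mul_sum]
    congr 1
    · rw [Finset.sum_eq_single j]
      · simp
      · intro i _ hi
        simp [hi.symm]
      · simp
    · exact Finset.sum_congr rfl fun i _ => by ring

/-- The space of `K`-valued derivations of a quotient of a principal localization of a polynomial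
ring is the kernel of the Jacobian matrix of the equations. -/
lemma finrank_derivation_eq_finrank_ker (R B C K : Type*) {ι γ : Type*} [CommRing R] [CommRing B]
    [CommRing C] [Field K] [Fintype ι] [Algebra R B] [Algebra (MvPolynomial ι R) B]
    [IsScalarTower R (MvPolynomial ι R) B] [Algebra R C] [Algebra B C] [IsScalarTower R B C]
    [Algebra C K] [Algebra B K] [IsScalarTower B C K] [Algebra R K]
    [IsScalarTower R B K] [Algebra (MvPolynomial ι R) K] [IsScalarTower (MvPolynomial ι R) B K]
    [IsScalarTower R (MvPolynomial ι R) K]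
    (t : MvPolynomial ι R) [IsLocalization.Away t B] (P : γ → MvPolynomial ι R)
    (hC : Function.Surjective (algebraMap B C))
    (hker : RingHom.ker (algebraMap B C) =
      Ideal.span (Set.range fun g => algebraMap (MvPolynomial ι R) B (P g))) :
    Module.finrank K (Derivation R C K) =
      Module.finrank K (LinearMap.ker (Matrix.of fun (g : γ) (i : ι) =>
        algebraMap (MvPolynomial ι R) K (pderiv i (P g))).mulVecLin) := by
  obtain ⟨e, he, her⟩ := exists_derivation_quotient R B C K hC
  have hres := restrictDer_bijective R (MvPolynomial ι R) B K t
  let x : Derivation R (MvPolynomial ι R) K →ₗ[K] (ι → K) :=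
    { toFun := fun D i => D (X i)
      map_add' := fun _ _ => rfl
      map_smul' := fun _ _ => rfl }
  have hx : Function.Bijective x :=
    ⟨fun D D' h => derivation_ext fun i => congrFun h i,
      fun v => ⟨mkDerivation R v, funext fun i => mkDerivation_X R v i⟩⟩
  let L := x ∘ₗ restrictDer R (MvPolynomial ι R) B K ∘ₗ e
  have hL : Function.Injective L := hx.1.comp (hres.1.comp he)
  have hrange : LinearMap.range L = LinearMap.ker (Matrix.of fun (g : γ) (i : ι) =>
        algebraMap (MvPolynomial ι R) K (pderiv i (P g))).mulVecLin := by
    ext v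
    obtain ⟨D, rfl⟩ := (hx.comp hres).2 v
    have h1 : x (restrictDer R (MvPolynomial ι R) B K D) ∈ LinearMap.range L ↔
        D ∈ LinearMap.range e :=
      ⟨fun ⟨d, hd⟩ => ⟨d, (hx.1.comp hres.1) hd⟩, fun ⟨d, hd⟩ => ⟨d, by rw [← hd]; rfl⟩⟩
    have h2 (g : γ) : (Matrix.of fun (g : γ) (i : ι) =>
        algebraMap (MvPolynomial ι R) K (pderiv i (P g))).mulVec
          (x (restrictDer R (MvPolynomial ι R) B K D)) g =
            D (algebraMap (MvPolynomial ι R) B (P g)) :=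
      (derivation_mvPolynomial (restrictDer R (MvPolynomial ι R) B K D) (P g)).symm
    refine h1.trans ((her D).trans ?_)
    rw [LinearMap.mem_ker]
    constructor
    · intro h
      funext g
      refine (h2 g).trans (h _ ?_)
      rw [hker]
      exact Ideal.subset_span ⟨g, rfl⟩
    · intro h f hf
      have hz (f) (hf : f ∈ RingHom.ker (algebraMap B C)) : algebraMap B K f = 0 := by
        rw [IsScalarTower.algebraMap_apply B C K, show algebraMap B C f = 0 from hf, map_zero]
      rw [hker] at hf
      induction hf using Submodule.span_induction with
      | mem _ hf =>
        obtain ⟨g, rfl⟩ := hf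
        exact (h2 g).symm.trans (congrFun h g)
      | zero => exact map_zero D
      | add _ _ _ _ h1 h2 => rw [map_add, h1, h2, add_zero]
      | smul b f hf h =>
        rw [smul_eq_mul, D.leibniz, h, smul_zero, Algebra.smul_def, hz f (hker ▸ hf), zero_mul,
          add_zero]
  rw [← hrange]
  exact (LinearEquiv.ofInjective L hL).finrank_eq

/-- The relative dimension of a smooth algebra is the dimension of the tangent space at every
`K`-valued point. -/
lemma finrank_derivation_of_locally {R C K : Type u} [CommRing R] [CommRing C] [Field K]
    [Algebra R C] [Algebra R K] [Algebra C K] [IsScalarTower R C K] (d : ℕ)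
    (hd : RingHom.Locally (RingHom.IsStandardSmoothOfRelativeDimension d) (algebraMap R C)) :
    Module.finrank K (Derivation R C K) = d := by
  obtain ⟨s, hs, h⟩ := hd
  -- One of the principal open sets on which the algebra is standard smooth contains the point.
  obtain ⟨t, hts, ht⟩ : ∃ t ∈ s, algebraMap C K t ≠ 0 := by
    by_contra! hcon
    have h1 : Ideal.span s ≤ RingHom.ker (algebraMap C K) := Ideal.span_le.2 hcon
    rw [hs] at h1
    exact one_ne_zero ((map_one (algebraMap C K)).symm.trans (h1 (Submodule.mem_top (x := 1))))
  have h := h t hts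
  rw [← IsScalarTower.algebraMap_eq, RingHom.isStandardSmoothOfRelativeDimension_algebraMap] at h
  let κ' : Localization.Away t →+* K := IsLocalization.Away.lift t (g := algebraMap C K) ht.isUnit
  let := κ'.toAlgebra
  have h1 : IsScalarTower C (Localization.Away t) K :=
    .of_algebraMap_eq fun c => (IsLocalization.Away.lift_eq t ht.isUnit c).symm
  have h2 : IsScalarTower R (Localization.Away t) K := .of_algebraMap_eq fun c => by
    rw [IsScalarTower.algebraMap_apply R C (Localization.Away t),
      ← IsScalarTower.algebraMap_apply C (Localization.Away t) K,
      ← IsScalarTower.algebraMap_apply R C K]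
  rw [← finrank_derivation_of_isStandardSmooth R (Localization.Away t) K d]
  exact (LinearEquiv.ofBijective _
    (restrictDer_bijective R C (Localization.Away t) K t)).finrank_eq.symm

section

variable {R B C K : Type u} [CommRing R] [CommRing B] [CommRing C] [Field K]

/-- The Jacobian criterion for a quotient `q` of a principal localization `ψ` of a polynomial ring,
in terms of ring homomorphisms. -/
lemma isStandardSmoothOfRelativeDimension_comp {ι γ : Type*} [Fintype ι] [Fintype γ] [DecidableEq γ]
    (ψ : MvPolynomial ι R →+* B) (t : MvPolynomial ι R)
    (hψ : letI := ψ.toAlgebra; IsLocalization.Away t B) (P : γ → MvPolynomial ι R) (q : B →+* C)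
    (hq : Function.Surjective q) (hker : RingHom.ker q = Ideal.span (Set.range fun g => ψ (P g)))
    (a : γ → ι) (ha : Function.Injective a)
    (hu : IsUnit (ψ (Matrix.of fun i j => pderiv (a i) (P j)).det)) :
    RingHom.IsStandardSmoothOfRelativeDimension (Fintype.card ι - Fintype.card γ)
      (q.comp (ψ.comp MvPolynomial.C)) := by
  algebraize [ψ, q, ψ.comp MvPolynomial.C, q.comp (ψ.comp MvPolynomial.C)]
  have : IsScalarTower R (MvPolynomial ι R) B := .of_algebraMap_eq fun _ => rfl
  have h1 := isStandardSmoothOfRelativeDimension_quotient (R := R) (B := B) t P a ha hu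
  have hker' : RingHom.ker (IsScalarTower.toAlgHom R B C) =
    Ideal.span (Set.range fun g => algebraMap (MvPolynomial ι R) B (P g)) := hker
  rw [← hker'] at h1
  exact Algebra.IsStandardSmoothOfRelativeDimension.of_algEquiv _
    (Ideal.quotientKerAlgEquivOfSurjective (f := IsScalarTower.toAlgHom R B C) hq)

/-- If a quotient `q` of a principal localization `ψ` of a polynomial ring is smooth of relative
dimension `d`, then `d` is the dimension of the kernel of the Jacobian matrix at every `K`-valued
point `κ`. -/
lemma finrank_ker_jacobian {ι γ : Type*} [Fintype ι] (ψ : MvPolynomial ι R →+* B)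
    (t : MvPolynomial ι R) (hψ : letI := ψ.toAlgebra; IsLocalization.Away t B)
    (P : γ → MvPolynomial ι R) (q : B →+* C) (hq : Function.Surjective q)
    (hker : RingHom.ker q = Ideal.span (Set.range fun g => ψ (P g))) (κ : C →+* K) (d : ℕ)
    (hd : RingHom.Locally (RingHom.IsStandardSmoothOfRelativeDimension d)
      (q.comp (ψ.comp MvPolynomial.C))) :
    Module.finrank K (LinearMap.ker (Matrix.of fun (g : γ) (i : ι) =>
      κ (q (ψ (pderiv i (P g))))).mulVecLin) = d := by
  algebraize [ψ, q, κ, κ.comp q, (κ.comp q).comp ψ, ψ.comp MvPolynomial.C,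
    q.comp (ψ.comp MvPolynomial.C), (κ.comp q).comp (ψ.comp MvPolynomial.C)]
  have : IsScalarTower R (MvPolynomial ι R) B := .of_algebraMap_eq fun _ => rfl
  have : IsScalarTower R (MvPolynomial ι R) K := .of_algebraMap_eq fun _ => rfl
  have : IsScalarTower R C K := .of_algebraMap_eq fun _ => rfl
  rw [← finrank_derivation_of_locally (R := R) (C := C) (K := K) d hd]
  exact (finrank_derivation_eq_finrank_ker R B C K t P hq hker).symm

end

end

end

section

/-! ### The equations of isotropy and their Jacobian matrix -/

section

open MvPolynomial

variable {n k r m : ℕ} (ε : Fin k ⊕ Fin (n - k) ≃ Fin n)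

/-- The `i`-th basis vector of the graph of the matrix `a`. -/
def graphRow {A : Type*} [CommRing A] (a : Fin k → Fin (n - k) → A) (i : Fin k) (l : Fin n) : A :=
  Sum.elim (Pi.single i 1) (a i) (ε.symm l)

lemma map_graphRow {A B : Type*} [CommRing A] [CommRing B] (φ : A →+* B)
    (a : Fin k → Fin (n - k) → A) (i : Fin k) (l : Fin n) :
    φ (graphRow ε a i l) = graphRow ε (fun i j => φ (a i j)) i l := by
  obtain ⟨l, rfl⟩ := ε.surjective l
  rcases l with i' | j
  · simp only [graphRow, Equiv.symm_apply_apply, Sum.elim_inl, Pi.single_apply]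
    split_ifs <;> simp
  · simp [graphRow]

/-- The value of the form with coefficients `w` on the rows `t` of the graph of the generic matrix.
-/
def graphPoly {R : Type*} [CommRing R] (w : (Fin r → Fin n) → R) (t : Fin r → Fin k) :
    MvPolynomial (Fin k × Fin (n - k)) R :=
  ∑ l, C (w l) * ∏ s, graphRow ε (fun i j => X (i, j)) (t s) (l s)

lemma map_graphPoly {R A : Type*} [CommRing R] [CommRing A] (w : (Fin r → Fin n) → R)
    (t : Fin r → Fin k) (ψ : MvPolynomial (Fin k × Fin (n - k)) R →+* A) :
    ψ (graphPoly ε w t) =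
      ∑ l, ψ (C (w l)) * ∏ s, graphRow ε (fun i j => ψ (X (i, j))) (t s) (l s) := by
  simp only [graphPoly, map_sum, map_mul, map_prod, map_graphRow]

lemma pderiv_graphRow {R : Type*} [CommRing R] (p : Fin k × Fin (n - k)) (i : Fin k) (l : Fin n) :
    pderiv p (graphRow ε (fun i j => (X (i, j) : MvPolynomial (Fin k × Fin (n - k)) R)) i l) =
      if i = p.1 then (Pi.single (ε (.inr p.2)) 1 : Fin n → MvPolynomial (Fin k × Fin (n - k)) R) l else 0 := by
  classical
  obtain ⟨l, rfl⟩ := ε.surjective l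
  rcases l with i' | j
  · simp only [graphRow, Equiv.symm_apply_apply, Sum.elim_inl, Pi.single_apply]
    split_ifs <;> simp_all
  · obtain ⟨p, q⟩ := p
    simp only [graphRow, Equiv.symm_apply_apply, Sum.elim_inr, pderiv_X, Pi.single_apply,
      EmbeddingLike.apply_eq_iff_eq, Sum.inr.injEq, Prod.mk.injEq]
    split_ifs <;> simp_all

lemma derivation_prod {R A M : Type*} [CommRing R] [CommRing A] [Algebra R A] [AddCommGroup M]
    [Module A M] [Module R M] (D : Derivation R A M) {ι : Type*} [DecidableEq ι] (S : Finset ι)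
    (f : ι → A) : D (∏ i ∈ S, f i) = ∑ i ∈ S, (∏ j ∈ S.erase i, f j) • D (f i) := by
  induction S using Finset.induction_on with
  | empty => simp
  | insert a S ha ih =>
    rw [Finset.prod_insert ha, D.leibniz, ih, Finset.sum_insert ha, Finset.erase_insert ha,
      Finset.smul_sum, add_comm]
    congr 1
    refine Finset.sum_congr rfl fun i hi => ?_
    have hia : a ≠ i := fun h => ha (h ▸ hi)
    rw [Finset.erase_insert_of_ne hia, Finset.prod_insert (fun h => ha (Finset.mem_of_mem_erase h)),
      mul_smul]

/-- The partial derivatives of `graphPoly`: differentiating along `X i j` replaces, one at a time,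
the rows of index `i` by the basis vector of index `j`. -/
lemma map_pderiv_graphPoly {R A : Type*} [CommRing R] [CommRing A] (w : (Fin r → Fin n) → R)
    (t : Fin r → Fin k) (ψ : MvPolynomial (Fin k × Fin (n - k)) R →+* A)
    (p : Fin k × Fin (n - k)) :
    ψ (pderiv p (graphPoly ε w t)) = ∑ s, if t s = p.1 then ∑ l, ψ (C (w l)) *
      ∏ s', (Function.update (fun s => graphRow ε (fun i j => ψ (X (i, j))) (t s)) s
        (Pi.single (ε (.inr p.2)) 1) : Fin r → Fin n → A) s' (l s') else 0 := by
  classical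
  simp only [graphPoly, map_sum]
  have h (l : Fin r → Fin n) : ψ (pderiv p (C (w l) * ∏ s, graphRow ε (fun i j => X (i, j)) (t s) (l s))) =
      ∑ s, if t s = p.1 then ψ (C (w l)) *
      ∏ s', (Function.update (fun s => graphRow ε (fun i j => ψ (X (i, j))) (t s)) s
        (Pi.single (ε (.inr p.2)) 1) : Fin r → Fin n → A) s' (l s') else 0 := by
    rw [pderiv_C_mul, derivation_prod, map_mul, map_sum, Finset.mul_sum]
    refine Finset.sum_congr rfl fun s _ => ?_
    rw [pderiv_graphRow]
    split_ifs with hs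
    · rw [smul_eq_mul, map_mul, map_prod, ← Finset.prod_erase_mul _ _ (Finset.mem_univ s),
        Function.update_self]
      congr 2
      · refine Finset.prod_congr rfl fun s' hs' => ?_
        rw [Function.update_of_ne (Finset.ne_of_mem_erase hs'), map_graphRow]
      · simp only [Pi.single_apply]
        split_ifs <;> simp
    · simp
  simp only [h]
  rw [Finset.sum_comm]
  refine Finset.sum_congr rfl fun s _ => ?_
  split_ifs <;> simp

end

section

variable {K W : Type*} [Field K] [AddCommGroup W] [Module K W] {n k r m : ℕ}
  (ε : Fin k ⊕ Fin (n - k) ≃ Fin n) (b : Module.Basis (Fin n) K W) (a : Fin k → Fin (n - k) → K)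

/-- The basis vectors of a graph in a vector space with a given basis. -/
def graphVec (i : Fin k) : W := ∑ l, graphRow ε a i l • b l

lemma graphVec_eq (i : Fin k) :
    graphVec ε b a i = b (ε (.inl i)) + ∑ j, a i j • b (ε (.inr j)) := by
  rw [graphVec, ← Equiv.sum_comp ε, Fintype.sum_sum_type]
  simp [graphRow, Pi.single_apply, ite_smul]

/-- The directional derivatives of the values of the forms on the basis of a graph. -/
def graphJacobian (ω : Fin m → W [⋀^Fin r]→ₗ[K] K) :
    Matrix (Fin m × Set.powersetCard (Fin k) r) (Fin k × Fin (n - k)) K :=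
  Matrix.of fun g p => ∑ s : Fin r,
    if Set.powersetCard.ofFinEmbEquiv.symm g.2 s = p.1 then
      ω g.1 (Function.update (fun s => graphVec ε b a (Set.powersetCard.ofFinEmbEquiv.symm g.2 s)) s
        (b (ε (.inr p.2)))) else 0

lemma repr_graphVec (i : Fin k) : ⇑(b.repr (graphVec ε b a i)) = graphRow ε a i :=
  b.repr_sum_self _

lemma sum_update_graphRow (t : Fin r → Fin k) (s : Fin r) (q : Fin n) (s' : Fin r) :
    ∑ l, (Function.update (fun s => graphRow ε a (t s)) s (Pi.single q 1) : Fin r → Fin n → K) s' l • b l =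
      Function.update (fun s => graphVec ε b a (t s)) s (b q) s' := by
  rcases eq_or_ne s' s with rfl | h
  · simp [Pi.single_apply, ite_smul]
  · simp [h, graphVec]

open MvPolynomial in
/-- The Jacobian matrix of the equations of isotropy, evaluated at a point. -/
lemma map_pderiv_eq_graphJacobian {R : Type*} [CommRing R] (ω : Fin m → W [⋀^Fin r]→ₗ[K] K)
    (w : Fin m → (Fin r → Fin n) → R) (ψ : MvPolynomial (Fin k × Fin (n - k)) R →+* K)
    (hw : ∀ i l, ψ (C (w i l)) = ω i (b ∘ l)) (ha : ∀ i j, ψ (X (i, j)) = a i j)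
    (g : Fin m × Set.powersetCard (Fin k) r) (p : Fin k × Fin (n - k)) :
    ψ (pderiv p (graphPoly ε (w g.1) (Set.powersetCard.ofFinEmbEquiv.symm g.2))) =
      graphJacobian ε b a ω g p := by
  rw [map_pderiv_graphPoly, graphJacobian, Matrix.of_apply]
  refine Finset.sum_congr rfl fun s _ => ?_
  split_ifs with hs
  · rw [alt_expand (ω g.1) b _ _ (sum_update_graphRow ε b a _ s (ε (.inr p.2)))]
    simp only [hw, ha]
  · rfl

variable {ε b a} {V : Submodule K W}

lemma graphVec_mem (hV : ∀ v, v ∈ V ↔ OnGraph ε a (b.repr v)) (i : Fin k) :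
    graphVec ε b a i ∈ V := by
  rw [hV, repr_graphVec]
  exact onGraph_row ε a i

/-- The vectors `graphVec` form a basis of the graph. -/
lemma exists_basis_graph (hV : ∀ v, v ∈ V ↔ OnGraph ε a (b.repr v)) :
    ∃ β : Module.Basis (Fin k) K V, ∀ i, (β i : W) = graphVec ε b a i := by
  have hcoord (c : Fin k → K) (i : Fin k) :
      b.repr (∑ i, c i • graphVec ε b a i) (ε (.inl i)) = c i := by
    simp [Finsupp.finsetSum_apply, repr_graphVec, graphRow, Pi.single_apply]
  have hcoord' (c : Fin k → K) (j : Fin (n - k)) :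
      b.repr (∑ i, c i • graphVec ε b a i) (ε (.inr j)) = ∑ i, c i * a i j := by
    simp [Finsupp.finsetSum_apply, repr_graphVec, graphRow]
  let v : Fin k → V := fun i => ⟨graphVec ε b a i, graphVec_mem hV i⟩
  have hsum (c : Fin k → K) : ((∑ i, c i • v i : V) : W) = ∑ i, c i • graphVec ε b a i := by
    simp [v]
  refine ⟨Module.Basis.mk (v := v) ?_ ?_, fun i => by rw [Module.Basis.mk_apply]⟩
  · rw [Fintype.linearIndependent_iff]
    intro c hc i
    have h1 := hcoord c i
    rwa [← hsum, hc, ZeroMemClass.coe_zero, map_zero, Finsupp.zero_apply, eq_comm] at h1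
  · rintro x -
    have hx : ∑ i, b.repr x (ε (.inl i)) • v i = x := by
      refine Subtype.ext (b.repr.injective (Finsupp.ext fun l => ?_))
      rw [hsum]
      obtain ⟨l, rfl⟩ := ε.surjective l
      rcases l with i | j
      · exact hcoord _ i
      · exact (hcoord' _ j).trans ((hV x).1 x.2 j).symm
    rw [← hx]
    exact Submodule.sum_mem _ fun i _ => Submodule.smul_mem _ _ (Submodule.subset_span ⟨i, rfl⟩)

/-- For a graph `V`, the classes of the `b (ε (inr j))` form a basis of `W ⧸ V`. In the
corresponding bases of `(⋀^r V)^m` and `Hom(V, W ⧸ V)`, the matrix of `tangentMap` is the transpose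
of the Jacobian matrix, so the map is injective if and only if the rows of the Jacobian matrix are
linearly independent. -/
lemma tangentMap_injective_iff (hV : ∀ v, v ∈ V ↔ OnGraph ε a (b.repr v))
    (ω : Fin m → W [⋀^Fin r]→ₗ[K] K) (h : ∀ i, IsIsotropicSubspace (ω i) V) :
    Function.Injective (tangentMap ω h) ↔ LinearIndependent K (graphJacobian ε b a ω).row := by
  obtain ⟨β, hβ⟩ := exists_basis_graph hV
  let φ (p : Fin k × Fin (n - k)) : V →ₗ[K] W ⧸ V :=
    (β.coord p.1).smulRight (V.mkQ (b (ε (.inr p.2))))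
  let E : Module.Dual K (V →ₗ[K] W ⧸ V) →ₗ[K] (Fin k × Fin (n - k) → K) :=
    { toFun := fun L p => L (φ p)
      map_add' := fun _ _ => rfl
      map_smul' := fun _ _ => rfl }
  -- The vectors `b (ε (inr j))` span the quotient, because `b (ε (inl i))` is a combination of
  -- them modulo `V`.
  have hspan : Submodule.span K (Set.range fun j => V.mkQ (b (ε (.inr j)))) = ⊤ := by
    have h1 : (⊤ : Submodule K (W ⧸ V)) = (Submodule.span K (Set.range b)).map V.mkQ := by
      rw [b.span_eq, Submodule.map_top, LinearMap.range_eq_top.2 V.mkQ_surjective]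
    rw [h1, eq_comm]
    refine le_antisymm ?_ (h1 ▸ le_top)
    rw [Submodule.map_span_le]
    rintro _ ⟨l, rfl⟩
    obtain ⟨l, rfl⟩ := ε.surjective l
    rcases l with i | j
    · have h2 : V.mkQ (b (ε (.inl i))) = - ∑ j, a i j • V.mkQ (b (ε (.inr j))) := by
        have h3 : V.mkQ (graphVec ε b a i) = 0 := by
          simpa using graphVec_mem hV i
        rw [graphVec_eq, map_add, map_sum] at h3
        simpa [_root_.map_smul] using eq_neg_of_add_eq_zero_left h3
      rw [h2]
      exact Submodule.neg_mem _ (Submodule.sum_mem _ fun j _ =>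
        Submodule.smul_mem _ _ (Submodule.subset_span ⟨j, rfl⟩))
    · exact Submodule.subset_span ⟨j, rfl⟩
  have hE : Function.Injective E := by
    rw [← LinearMap.ker_eq_bot, LinearMap.ker_eq_bot']
    intro L hL
    ext ψ
    have h1 (i : Fin k) : ∃ c : Fin (n - k) → K, ∑ j, c j • V.mkQ (b (ε (.inr j))) = ψ (β i) :=
      (Submodule.mem_span_range_iff_exists_fun K).1 (hspan ▸ Submodule.mem_top)
    choose c hc using h1
    have h2 : ψ = ∑ i, ∑ j, c i j • φ (i, j) := by
      refine β.ext fun i => ?_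
      rw [← hc]
      simp [φ, Finsupp.single_apply, ite_smul, smul_ite]
    rw [h2, LinearMap.zero_apply, map_sum]
    refine Finset.sum_eq_zero fun i _ => ?_
    rw [map_sum]
    refine Finset.sum_eq_zero fun j _ => ?_
    rw [_root_.map_smul, show L (φ (i, j)) = 0 from congrFun hL (i, j), smul_zero]
  let B : Module.Basis (Fin m × Set.powersetCard (Fin k) r) K (Fin m → ⋀[K]^r V) :=
    (Pi.basis fun _ => β.exteriorPower r).reindex (Equiv.sigmaEquivProd _ _)
  have hB (g : Fin m × Set.powersetCard (Fin k) r) :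
      E (tangentMap ω h (B g)) = (graphJacobian ε b a ω).row g := by
    classical
    obtain ⟨i, σ⟩ := g
    funext p
    have h1 : B (i, σ) = Pi.single i (exteriorPower.ιMulti K r
        (β ∘ Set.powersetCard.ofFinEmbEquiv.symm σ)) := by
      simp only [B, Module.Basis.reindex_apply, Equiv.sigmaEquivProd_symm_apply, Pi.basis_apply]
      rw [exteriorPower.basis_apply]
      rfl
    change ∑ i', exteriorPower.alternatingMapLinearEquiv (tangentForm (ω i') (h i') (φ p))
      (B (i, σ) i') = _
    rw [h1, Finset.sum_eq_single i]
    · rw [Pi.single_eq_same, exteriorPower.alternatingMapLinearEquiv_apply_ιMulti]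
      have h3 (v : Fin r → V) : tangentForm (ω i) (h i) (φ p) v =
        ∑ s, slot (ω i) (h i) v s (φ p (v s)) := rfl
      rw [h3]
      refine Finset.sum_congr rfl fun s _ => ?_
      have h2 : φ p ((β ∘ Set.powersetCard.ofFinEmbEquiv.symm σ) s) =
          if Set.powersetCard.ofFinEmbEquiv.symm σ s = p.1 then
            V.mkQ (b (ε (.inr p.2))) else 0 := by
        simp [φ, Finsupp.single_apply, ite_smul]
      rw [h2]
      split_ifs
      · refine (slot_mk (ω i) (h i) _ s _).trans ?_
        simp only [Function.comp_apply, hβ]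
      · rw [map_zero]
    · intro i' _ hi'
      rw [Pi.single_eq_of_ne hi', map_zero]
    · simp
  have hB' : (E ∘ₗ tangentMap ω h) ∘ B = (graphJacobian ε b a ω).row := funext hB
  rw [← hB']
  constructor
  · intro hinj
    exact B.linearIndependent.map' _ (LinearMap.ker_eq_bot.2 (hE.comp hinj))
  · intro hli
    have h1 : Function.Injective (E ∘ₗ tangentMap ω h) :=
      LinearMap.injective_of_linearIndependent B.span_eq hli
    exact Function.Injective.of_comp (f := E) h1

end

end

section

variable {X T G : Scheme.{u}}

/-! ### Values of functions at ring-valued points -/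

section
variable {A : Type u} [CommRing A]

/-- The value at an `A`-valued point of a function defined on a neighbourhood of it. -/
def evalPt (z : Spec (.of A) ⟶ G) {W : G.Opens} (hz : ⊤ ≤ z ⁻¹ᵁ W) : Γ(G, W) →+* A :=
  (Scheme.ΓSpecIso (.of A)).hom.hom.comp ((resO hz).comp (z.app W).hom)

lemma evalPt_apply (z : Spec (.of A) ⟶ G) {W : G.Opens} (hz : ⊤ ≤ z ⁻¹ᵁ W) (a : Γ(G, W)) :
    evalPt z hz a = (Scheme.ΓSpecIso (.of A)).hom (resO hz (z.app W a)) := rfl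

lemma evalPt_res (z : Spec (.of A) ⟶ G) {W W' : G.Opens} (h : W' ≤ W) (hz : ⊤ ≤ z ⁻¹ᵁ W')
    (a : Γ(G, W)) : evalPt z hz (resO h a) = evalPt z (hz.trans (z.preimage_mono h)) a := by
  rw [evalPt_apply, evalPt_apply, app_resO, resO_resO]

lemma evalPt_comp (z : Spec (.of A) ⟶ G) (π : G ⟶ X) {x : Spec (.of A) ⟶ X} (h : z ≫ π = x)
    {U : X.Opens} (hz : ⊤ ≤ z ⁻¹ᵁ (π ⁻¹ᵁ U)) (hx : ⊤ ≤ x ⁻¹ᵁ U) (a : Γ(X, U)) :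
    evalPt z hz (π.app U a) = evalPt x hx a := by
  subst h
  rw [evalPt_apply, evalPt_apply, Scheme.Hom.comp_app]
  rfl

lemma fromSpec_app {W : G.Opens} (hW : IsAffineOpen W) (a : Γ(G, W)) :
    hW.fromSpec.app W a = resO le_top ((Scheme.ΓSpecIso Γ(G, W)).inv a) := by
  rw [hW.fromSpec_app_of_le W le_rfl]
  exact congrArg (fun a => resO le_top ((Scheme.ΓSpecIso Γ(G, W)).inv a)) (resO_self (le_refl W) a)

lemma SpecMap_app_top {B B' : CommRingCat.{u}} (φ : B ⟶ B') (b : B) :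
    (Spec.map φ).app ⊤ ((Scheme.ΓSpecIso B).inv b) = (Scheme.ΓSpecIso B').inv (φ b) :=
  congr($(Scheme.ΓSpecIso_inv_naturality φ) b).symm

lemma evalPt_fromSpec {W : G.Opens} (hW : IsAffineOpen W) (φ : Γ(G, W) ⟶ .of A)
    (hz : ⊤ ≤ (Spec.map φ ≫ hW.fromSpec) ⁻¹ᵁ W) (a : Γ(G, W)) :
    evalPt (Spec.map φ ≫ hW.fromSpec) hz a = φ a := by
  have h2 : (Spec.map φ ≫ hW.fromSpec).app W a =
      (Spec.map φ).app _ (hW.fromSpec.app W a) := by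
    rw [Scheme.Hom.comp_app]
    rfl
  rw [evalPt_apply, h2, fromSpec_app, app_resO, SpecMap_app_top]
  refine Eq.trans (congrArg (Scheme.ΓSpecIso (.of A)).hom
    ((resO_resO le_top hz _).trans (resO_self le_top _))) ?_
  exact congr($((Scheme.ΓSpecIso (.of A)).inv_hom_id) (φ a))

lemma evalPt_bijective (z : Spec (.of A) ⟶ G) [IsOpenImmersion z] (hz : ⊤ ≤ z ⁻¹ᵁ z.opensRange) :
    Function.Bijective (evalPt z hz) := by
  have h1 := z.isIso_app z.opensRange le_rfl
  have h2 : IsIso ((Spec (.of A)).presheaf.map (homOfLE hz).op) := by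
    have : z ⁻¹ᵁ z.opensRange = ⊤ := top_le_iff.1 hz
    have h3 : homOfLE hz = eqToHom this.symm := rfl
    rw [h3]
    infer_instance
  let e := asIso (z.app z.opensRange ≫ (Spec (.of A)).presheaf.map (homOfLE hz).op ≫
    (Scheme.ΓSpecIso (.of A)).hom)
  exact e.commRingCatIsoToRingEquiv.bijective

end

section
variable {K : Type u} [Field K]

lemma Spec_field_eq (p q : Spec (CommRingCat.of K)) : p = q :=
  Subsingleton.elim (α := PrimeSpectrum K) p q

lemma top_le_preimage_of_mem {z : Spec (.of K) ⟶ G} {W : G.Opens} {p : Spec (CommRingCat.of K)}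
    (h : z p ∈ W) : ⊤ ≤ z ⁻¹ᵁ W := by
  intro q _
  rw [Spec_field_eq q p]
  exact h

lemma mem_of_top_le_preimage {z : Spec (.of K) ⟶ G} {W : G.Opens} (h : ⊤ ≤ z ⁻¹ᵁ W)
    (p : Spec (CommRingCat.of K)) : z p ∈ W := h trivial

lemma top_le_preimage_basicOpen (z : Spec (.of K) ⟶ G) {W : G.Opens} (hz : ⊤ ≤ z ⁻¹ᵁ W) (a : Γ(G, W))
    (ha : evalPt z hz a ≠ 0) : ⊤ ≤ z ⁻¹ᵁ (G.basicOpen a) := by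
  have h1 : IsUnit (resO hz (z.app W a)) := by
    have h2 : IsUnit ((Scheme.ΓSpecIso (.of K)).hom (resO hz (z.app W a))) := ha.isUnit
    exact (MulEquiv.isUnit_map (Scheme.ΓSpecIso (.of K)).commRingCatIsoToRingEquiv).1 h2
  rw [Scheme.preimage_basicOpen]
  have h3 := Scheme.basicOpen_of_isUnit _ h1
  rw [← h3]
  exact (Scheme.basicOpen_res _ _ (homOfLE hz).op).trans_le inf_le_right

end

/-! ### Functionals on the fibre of a quotient bundle -/

section
variable {M : X.Modules} {n k : ℕ} {U : X.Opens} {e : Fin n → Γ(M, U)} (he : IsFrame M U e)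
  {π : G ⟶ X} (S : Subobject ((pullback π).obj M)) {K : Type u} [Field K]

/-- A linear functional on the fibre that vanishes on the subbundle `S` comes from the quotient
bundle. The reason is that functionals on the fibre of a bundle `N` at `z` are morphisms
`N ⟶ z_* 𝒪`, to which the universal property of the cokernel applies. So the fibre of the quotient
bundle is the quotient of the fibres. -/
lemma exists_functional_quotient {W : G.Opens} (hW : W ≤ π ⁻¹ᵁ U) (z : Spec (.of K) ⟶ G)
    (hz : ⊤ ≤ z ⁻¹ᵁ W) {s : Fin k → Γ((S : G.Modules), W)} (hs : IsFrame (S : G.Modules) W s)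
    {r : ℕ} {q : Fin r → Γ(Limits.cokernel S.arrow, W)}
    (hq : IsFrame (Limits.cokernel S.arrow) W q) (v : Fin n → K)
    (hv : ∀ i, ∑ l, evalPt z hz ((he.pull π).coord hW (S.arrow.app W (s i)) l) * v l = 0) :
    ∃ w : Fin r → K, ∀ l, v l = ∑ m, evalPt z hz (hq.coord le_rfl
      ((Limits.cokernel.π S.arrow).app W (res _ hW (pullSec π M U (e l)))) m) * w m := by
  set x : Spec (.of K) ⟶ X := z ≫ π with hx
  have hxU : ⊤ ≤ x ⁻¹ᵁ U := hz.trans (z.preimage_mono hW)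
  let ΓK := Scheme.ΓSpecIso (.of K)
  have hΓ (a : K) : ΓK.hom (ΓK.inv a) = a := congr($(ΓK.inv_hom_id) a)
  let P : (Spec (CommRingCat.of K)).Modules := unitMod (Spec (.of K))
  let Λ : (pullback x).obj M ⟶ P :=
    homOfFrame (isFrame_globalFrame he x hxU) (fun l => unitSec ⊤ (ΓK.inv (v l)))
  have hΛ (V : (Spec (CommRingCat.of K)).Opens) (t : Γ((pullback x).obj M, V)) :
      (unitSec V).symm (Λ.app V t) =
        ∑ l, (he.pull x).coord (le_top.trans hxU) t l * resO le_top (ΓK.inv (v l)) := by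
    rw [homOfFrame_app, map_sum, ← coord_globalFrame he x hxU]
    rfl
  let Λ' : (pullback π).obj M ⟶ (pushforward z).obj P := pullSec₂Hom hx.symm M ≫ (pushforward z).map Λ
  have hΛ' (V : G.Opens) (t : Γ((pullback π).obj M, V)) :
    Λ'.app V t = Λ.app (z ⁻¹ᵁ V) (pullSec₂ hx.symm M V t) := rfl
  -- The value of `Λ'` near the point, in terms of coordinates.
  have key (V : G.Opens) (hV : V ≤ W) (t : Γ((pullback π).obj M, V)) :
      (unitSec (z ⁻¹ᵁ V)).symm (Λ.app (z ⁻¹ᵁ V) (pullSec₂ hx.symm M V t)) =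
        ∑ l, z.app V ((he.pull π).coord (hV.trans hW) t l) * resO le_top (ΓK.inv (v l)) := by
    rw [hΛ]
    refine Finset.sum_congr rfl fun l _ => ?_
    rw [← coord_pullSec₂ he hx.symm (hV.trans hW)]
  have hrow (i : Fin k) : Λ.app (z ⁻¹ᵁ W) (pullSec₂ hx.symm M W (S.arrow.app W (s i))) = 0 := by
    refine (unitSec (z ⁻¹ᵁ W)).symm.injective ?_
    rw [key W le_rfl, map_zero]
    have hinj : Function.Injective (ΓK.hom.hom.comp (resO hz)) := by
      refine (ΓK.commRingCatIsoToRingEquiv).injective.comp ?_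
      have htop : z ⁻¹ᵁ W = ⊤ := top_le_iff.1 hz
      intro a b hab
      have := congrArg (resO (le_top : z ⁻¹ᵁ W ≤ ⊤)) hab
      rwa [resO_resO, resO_resO, resO_self, resO_self] at this
    refine hinj ?_
    rw [map_zero, map_sum, ← hv i]
    refine Finset.sum_congr rfl fun l _ => ?_
    rw [map_mul]
    congr 1
    refine Eq.trans ?_ (hΓ (v l))
    change ΓK.hom (resO hz (resO le_top _)) = _
    rw [resO_resO, resO_self]
  have hzero : S.arrow ≫ Λ' = 0 := by
    ext V t
    change Λ.app (z ⁻¹ᵁ V) (pullSec₂ hx.symm M V (S.arrow.app V t)) = 0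
    refine (unitSec (z ⁻¹ᵁ V)).symm.injective ?_
    rw [map_zero]
    refine eq_of_locally_res _ _ fun p hp => ⟨z ⁻¹ᵁ (V ⊓ W), z.preimage_mono inf_le_left,
      ⟨hp, mem_of_top_le_preimage hz p⟩, ?_⟩
    have hVW : V ⊓ W ≤ V := inf_le_left
    rw [map_zero, ← unitSec_symm_res, ← app_res, ← pullSec₂_res hx.symm M hVW, ← app_res S.arrow hVW,
      ← hs.coord_spec (inf_le_right : V ⊓ W ≤ W) (res _ hVW t)]
    simp only [map_sum, Hom.app_smul, pullSec₂_smul, app_res, pullSec₂_res, hrow, map_zero, smul_zero,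
      Finset.sum_const_zero]
  let Ψ : Limits.cokernel S.arrow ⟶ (pushforward z).obj P := Limits.cokernel.desc _ Λ' hzero
  have hΨ : Limits.cokernel.π S.arrow ≫ Ψ = Λ' := Limits.cokernel.π_desc _ _ _
  let Ψ' : Γ(Limits.cokernel S.arrow, W) →+ Γ(Spec (CommRingCat.of K), z ⁻¹ᵁ W) :=
    (unitSec (z ⁻¹ᵁ W)).symm.toAddMonoidHom.comp (Ψ.app W).hom
  have hΨ' (b : Γ(G, W)) (s) : Ψ' (b • s) = z.app W b * Ψ' s := by
    change (unitSec (z ⁻¹ᵁ W)).symm (Ψ.app W (b • s)) = _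
    rw [Hom.app_smul]
    rfl
  let w' (m : Fin r) : Γ(Spec (CommRingCat.of K), z ⁻¹ᵁ W) := Ψ' (q m)
  refine ⟨fun m => ΓK.hom (resO hz (w' m)), fun l => ?_⟩
  have h1 : (he.pull π).coord hW (res _ hW (pullSec π M U (e l))) = Pi.single l 1 :=
    (he.pull π).coord_frame hW l
  have h2 := key W le_rfl (res _ hW (pullSec π M U (e l)))
  rw [h1] at h2
  have h3 : Λ.app (z ⁻¹ᵁ W) (pullSec₂ hx.symm M W (res _ hW (pullSec π M U (e l)))) =
      Ψ.app W ((Limits.cokernel.π S.arrow).app W (res _ hW (pullSec π M U (e l)))) :=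
    congr(($hΨ).app W (res _ hW (pullSec π M U (e l)))).symm
  rw [h3] at h2
  change Ψ' ((Limits.cokernel.π S.arrow).app W (res _ hW (pullSec π M U (e l)))) = _ at h2
  rw [← hq.coord_spec le_rfl ((Limits.cokernel.π S.arrow).app W (res _ hW (pullSec π M U (e l)))),
    map_sum] at h2
  have h4 := congrArg (ΓK.hom.hom.comp (resO hz)) h2
  rw [map_sum, map_sum, Finset.sum_eq_single l] at h4
  · refine Eq.trans ?_ (h4.symm.trans (Finset.sum_congr rfl fun m _ => ?_))
    · rw [Pi.single_eq_same, map_one, one_mul]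
      refine (hΓ (v l)).symm.trans ?_
      change _ = ΓK.hom (resO hz (resO le_top _))
      rw [resO_resO, resO_self]
    · rw [hΨ', res_self]
      exact map_mul (ΓK.hom.hom.comp (resO hz)) (z.app W _) (w' m)
  · intro l' _ hl'
    rw [Pi.single_eq_of_ne hl', map_zero, zero_mul, map_zero]
  · simp

end

/-! ### A subbundle is locally a graph -/

section
variable {n k : ℕ} {K : Type*} [Field K]

/-- An injection `Fin k → Fin n` extends to a splitting of `Fin n`. -/
lemma exists_equiv_inl_eq {a : Fin k → Fin n} (ha : Function.Injective a) :
    ∃ ε : Fin k ⊕ Fin (n - k) ≃ Fin n, ∀ i, ε (.inl i) = a i := by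
  classical
  have hcard : Fintype.card ((Set.range a)ᶜ : Set (Fin n)) = n - k := by
    rw [Fintype.card_compl_set, Set.card_range_of_injective ha, Fintype.card_fin, Fintype.card_fin]
  let e₂ := (Fintype.equivFinOfCardEq hcard).symm
  exact ⟨(Equiv.sumCongr (Equiv.ofInjective a ha) e₂).trans (Equiv.Set.sumCompl (Set.range a)),
    fun i => by simp⟩

/-- A matrix whose rank is the number of its rows has an invertible maximal minor. -/
lemma exists_minor_ne_zero {γ ι : Type*} [Fintype γ] [DecidableEq γ] [Fintype ι] (C : Matrix γ ι K)
    (hC : Fintype.card γ ≤ C.rank) :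
    ∃ c : γ → ι, Function.Injective c ∧ (C.submatrix id c).det ≠ 0 := by
  obtain ⟨κ, a, ha, hspan, hli⟩ := exists_linearIndependent' K C.col
  have hfin : Finite κ := Finite.of_injective a ha
  have := Fintype.ofFinite κ
  have hcard : Fintype.card γ = Fintype.card κ := by
    refine le_antisymm ?_ ?_
    · have h1 := finrank_span_eq_card hli
      rw [hspan, ← Matrix.rank_eq_finrank_span_cols] at h1
      omega
    · simpa using hli.fintype_card_le_finrank
  let f := Fintype.equivOfCardEq hcard
  refine ⟨a ∘ f, ha.comp f.injective, ?_⟩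
  have h2 : LinearIndependent K (C.submatrix id (a ∘ f)).col := hli.comp f f.injective
  exact (Matrix.isUnit_iff_isUnit_det _).1 (Matrix.linearIndependent_cols_iff_isUnit.1 h2) |>.ne_zero

/-- If the kernel of a matrix with `n` columns lies in the span of `n - k` vectors, the rank is at
least `k`. -/
lemma le_rank_of_ker_le (hkn : k ≤ n) (C : Matrix (Fin k) (Fin n) K) (D : Matrix (Fin n) (Fin (n - k)) K)
    (h : ∀ v, C.mulVec v = 0 → ∃ w, v = D.mulVec w) : k ≤ C.rank := by
  have h1 : LinearMap.ker C.mulVecLin ≤ LinearMap.range D.mulVecLin := by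
    intro v hv
    obtain ⟨w, rfl⟩ := h v hv
    exact ⟨w, rfl⟩
  have h2 := Submodule.finrank_mono h1
  have h3 := D.rank_le_width
  have h4 := LinearMap.finrank_range_add_finrank_ker C.mulVecLin
  rw [Module.finrank_fin_fun] at h4
  change C.rank + _ = n at h4
  change _ ≤ D.rank at h2
  omega

/-- The row space of a matrix with an invertible minor is a graph. -/
lemma onGraph_iff_exists_vecMul {A : Type*} [CommRing A] (ε : Fin k ⊕ Fin (n - k) ≃ Fin n)
    (C : Matrix (Fin k) (Fin n) A) (hC : IsUnit (C.submatrix id (fun i => ε (.inl i))).det)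
    (a : Matrix (Fin k) (Fin (n - k)) A)
    (ha : C.submatrix id (fun i => ε (.inl i)) * a = C.submatrix id (fun j => ε (.inr j)))
    (c : Fin n → A) : OnGraph ε a c ↔ ∃ b : Fin k → A, Matrix.vecMul b C = c := by
  have key (b : Fin k → A) : (fun j => Matrix.vecMul b C (ε (.inr j))) =
      Matrix.vecMul (fun i => Matrix.vecMul b C (ε (.inl i))) a := by
    have h1 : (fun j => Matrix.vecMul b C (ε (.inr j))) =
      Matrix.vecMul b (C.submatrix id (fun j => ε (.inr j))) := rfl
    rw [h1, ← ha, ← Matrix.vecMul_vecMul]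
    rfl
  constructor
  · intro h
    refine ⟨Matrix.vecMul (fun i => c (ε (.inl i))) (C.submatrix id (fun i => ε (.inl i)))⁻¹, ?_⟩
    have h1 (i : Fin k) : Matrix.vecMul (Matrix.vecMul (fun i => c (ε (.inl i)))
        (C.submatrix id (fun i => ε (.inl i)))⁻¹) C (ε (.inl i)) = c (ε (.inl i)) := by
      have h2 : Matrix.vecMul (Matrix.vecMul (fun i => c (ε (.inl i)))
        (C.submatrix id (fun i => ε (.inl i)))⁻¹) (C.submatrix id (fun i => ε (.inl i))) =
          fun i => c (ε (.inl i)) := by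
        rw [Matrix.vecMul_vecMul, Matrix.nonsing_inv_mul _ hC, Matrix.vecMul_one]
      exact congrFun h2 i
    funext l
    obtain ⟨l, rfl⟩ := ε.surjective l
    rcases l with i | j
    · exact h1 i
    · refine (congrFun (key _) j).trans ?_
      simp only [h1]
      exact (h j).symm
  · rintro ⟨b, rfl⟩ j
    exact congrFun (key b) j

end

section
variable {M : X.Modules} {n k : ℕ} {U : X.Opens} {e : Fin n → Γ(M, U)} (he : IsFrame M U e)
  {π : G ⟶ X} {S : Subobject ((pullback π).obj M)} {K : Type u} [Field K]

/-- Near every field-valued point, a subbundle `S` is a graph in suitable coordinates. The matrix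
`C` of a frame of `S` has rank `k` at the point, because the functionals on the fibre that vanish
on `S` come from the quotient bundle, so they form a space of dimension at most `n - k`; inverting
a maximal minor of `C` gives the matrix of the graph. -/
lemma exists_isGraphOn (hkn : k ≤ n) (hS : IsSubbundle n k S) (z : Spec (.of K) ⟶ G)
    (hz : ⊤ ≤ z ⁻¹ᵁ (π ⁻¹ᵁ U)) :
    ∃ (ε : Fin k ⊕ Fin (n - k) ≃ Fin n) (W : G.Opens) (hW : W ≤ π ⁻¹ᵁ U)
      (a : Fin k → Fin (n - k) → Γ(G, W)), ⊤ ≤ z ⁻¹ᵁ W ∧ IsGraphOn he ε S W hW a := by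
  let p : Spec (CommRingCat.of K) := IsLocalRing.closedPoint K
  obtain ⟨W₁, hp₁, s, hs⟩ := isVectorBundle_frame hS.1 (z p)
  obtain ⟨W₂, hp₂, q, hq⟩ := isVectorBundle_frame hS.2 (z p)
  let W : G.Opens := W₁ ⊓ W₂ ⊓ π ⁻¹ᵁ U
  have hW : W ≤ π ⁻¹ᵁ U := inf_le_right
  have hzW : ⊤ ≤ z ⁻¹ᵁ W :=
    le_inf (le_inf (top_le_preimage_of_mem hp₁) (top_le_preimage_of_mem hp₂)) hz
  have hs := hs.res (inf_le_left.trans inf_le_left : W ≤ W₁)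
  have hq := hq.res (inf_le_left.trans inf_le_right : W ≤ W₂)
  set s' := fun l => res (S : G.Modules) (inf_le_left.trans inf_le_left : W ≤ W₁) (s l)
  set q' := fun l => res (Limits.cokernel S.arrow) (inf_le_left.trans inf_le_right : W ≤ W₂) (q l)
  let C : Matrix (Fin k) (Fin n) Γ(G, W) := fun i l => (he.pull π).coord hW (S.arrow.app W (s' i)) l
  let D : Matrix (Fin n) (Fin (n - k)) Γ(G, W) := fun l m => hq.coord le_rfl
      ((Limits.cokernel.π S.arrow).app W (res _ hW (pullSec π M U (e l)))) m
  have hrank : k ≤ (C.map (evalPt z hzW)).rank := by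
    refine le_rank_of_ker_le hkn _ (D.map (evalPt z hzW)) fun v hv => ?_
    obtain ⟨w, hw⟩ := exists_functional_quotient he S hW z hzW hs hq v (fun i => congrFun hv i)
    exact ⟨w, funext hw⟩
  obtain ⟨c, hc, hdet⟩ := exists_minor_ne_zero _ ((Fintype.card_fin k).trans_le hrank)
  obtain ⟨ε, hε⟩ := exists_equiv_inl_eq hc
  set N : Matrix (Fin k) (Fin k) Γ(G, W) := C.submatrix id (fun i => ε (.inl i)) with hN
  have hdet : evalPt z hzW N.det ≠ 0 := by
    rw [RingHom.map_det]
    have hc' : c = fun i => ε (.inl i) := funext fun i => (hε i).symm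
    rw [hc'] at hdet
    exact hdet
  let W' := G.basicOpen N.det
  have hW' : W' ≤ W := G.basicOpen_le _
  have hunit : IsUnit (N.map (resO hW')).det := by
    have h1 : IsUnit (resO hW' N.det) := G.toRingedSpace.isUnit_res_basicOpen N.det
    rwa [RingHom.map_det] at h1
  let a : Matrix (Fin k) (Fin (n - k)) Γ(G, W') :=
    (N.map (resO hW'))⁻¹ * (C.submatrix id (fun j => ε (.inr j))).map (resO hW')
  have ha : N.map (resO hW') * a = (C.submatrix id (fun j => ε (.inr j))).map (resO hW') := by
    rw [← Matrix.mul_assoc, Matrix.mul_nonsing_inv _ hunit, Matrix.one_mul]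
  refine ⟨ε, W', hW'.trans hW, a, top_le_preimage_basicOpen z hzW _ hdet, fun V hV t => ?_⟩
  have haV : (C.map (resO (hV.trans hW'))).submatrix id (fun i => ε (.inl i)) * a.map (resO hV) =
      (C.map (resO (hV.trans hW'))).submatrix id (fun j => ε (.inr j)) := by
    have h1 := congrArg (fun m => m.map (resO hV)) ha
    simp only [Matrix.map_mul] at h1
    refine Eq.trans ?_ (h1.trans ?_)
    · congr 1
      ext i j
      exact (resO_resO hW' hV _).symm
    · ext i j
      exact resO_resO hW' hV _
  have hunitV : IsUnit ((C.map (resO (hV.trans hW'))).submatrix id (fun i => ε (.inl i))).det := by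
    have h1 := hunit.map (resO hV)
    rw [RingHom.map_det] at h1
    convert h1 using 2
    ext i j
    exact (resO_resO hW' hV _).symm
  rw [show (fun i j => resO hV (a i j)) = a.map (resO hV) from rfl,
    onGraph_iff_exists_vecMul ε _ hunitV _ haV]
  have hcoord (b : Fin k → Γ(G, V)) : (he.pull π).coord (hV.trans (hW'.trans hW))
      (S.arrow.app V (∑ i, b i • res _ (hV.trans hW') (s' i))) =
      Matrix.vecMul b (C.map (resO (hV.trans hW'))) := by
    rw [map_sum, map_sum]
    funext l
    rw [Finset.sum_apply]
    refine Finset.sum_congr rfl fun i _ => ?_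
    rw [Hom.app_smul, _root_.map_smul, Pi.smul_apply, smul_eq_mul, app_res]
    congr 1
    exact (he.pull π).coord_res hW (hV.trans hW') _ l
  constructor
  · rintro ⟨s, rfl⟩
    refine ⟨hs.coord (hV.trans hW') s, ?_⟩
    rw [← hcoord, hs.coord_spec]
  · rintro ⟨b, hb⟩
    refine ⟨∑ i, b i • res _ (hV.trans hW') (s' i), ?_⟩
    refine (he.pull π).ext_coord (hV.trans (hW'.trans hW)) ?_
    rw [hcoord, hb]

end

end

section

variable {X T G : Scheme.{u}}

/-! ### Gluing ideals -/

section

lemma resO_mem_map_iff {W V : G.Opens} (hW : IsAffineOpen W) (g : Γ(G, W)) (hV : V = G.basicOpen g)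
    (h : V ≤ W) (I : Ideal Γ(G, W)) (x : Γ(G, W)) :
    resO h x ∈ I.map (resO h) ↔ ∃ n : ℕ, g ^ n * x ∈ I := by
  subst hV
  have := hW.isLocalization_basicOpen g
  refine (IsLocalization.algebraMap_mem_map_algebraMap_iff (Submonoid.powers g)
    (S := Γ(G, G.basicOpen g)) I x).trans ?_
  exact ⟨fun ⟨_, ⟨n, rfl⟩, h⟩ => ⟨n, h⟩, fun ⟨n, h⟩ => ⟨_, ⟨n, rfl⟩, h⟩⟩

lemma exists_resO_eq_mul_pow {W : G.Opens} (hW : IsAffineOpen W) (g : Γ(G, W))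
    (y : Γ(G, G.basicOpen g)) :
    ∃ (n : ℕ) (x : Γ(G, W)), y * resO (G.basicOpen_le g) g ^ n = resO (G.basicOpen_le g) x := by
  have := hW.isLocalization_basicOpen g
  obtain ⟨⟨x, ⟨_, n, rfl⟩⟩, h⟩ := IsLocalization.surj (Submonoid.powers g) y
  refine ⟨n, x, Eq.trans ?_ h⟩
  rw [map_pow]
  rfl

/-- A compatible family of ideals on the members of a basis of affine open sets (closed under
passing to smaller affine open sets) extends to an ideal sheaf: over an arbitrary affine open set,
it consists of the functions whose restrictions to the members of the basis belong to the given
ideals. -/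
theorem exists_idealSheafData (good : G.Opens → Prop) (J : ∀ U : G.Opens, Ideal Γ(G, U))
    (haff : ∀ W, good W → IsAffineOpen W)
    (hgood : ∀ V W : G.Opens, V ≤ W → good W → IsAffineOpen V → good V)
    (hcov : ∀ p : G, ∃ W, p ∈ W ∧ good W)
    (hJ : ∀ (V W : G.Opens) (h : V ≤ W), good W → good V → J V = (J W).map (resO h)) :
    ∃ I : G.IdealSheafData, ∀ (U : G.affineOpens) (x : Γ(G, U)),
      x ∈ I.ideal U ↔ ∀ (V : G.Opens) (h : V ≤ U), good V → resO h x ∈ J V := by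
  let F (U : G.affineOpens) : Ideal Γ(G, U) := ⨅ V : { V : G.Opens // V ≤ U ∧ good V },
    (J V.1).comap (resO V.2.1)
  have hF (U : G.affineOpens) (x : Γ(G, U)) :
      x ∈ F U ↔ ∀ (V : G.Opens) (h : V ≤ U), good V → resO h x ∈ J V := by
    simp only [F, Ideal.mem_iInf, Ideal.mem_comap]
    exact ⟨fun h V hV hg => h ⟨V, hV, hg⟩, fun h V => h V.1 V.2.1 V.2.2⟩
  refine ⟨{ ideal := F, map_ideal_basicOpen := fun U f => ?_ }, hF⟩
  refine le_antisymm ?_ fun y hy => ?_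
  · refine Ideal.map_le_iff_le_comap.2 fun x hx => ?_
    refine (hF (G.affineBasicOpen f) (resO (G.basicOpen_le f) x)).2 fun V hV hg => ?_
    exact Eq.mp (congrArg (· ∈ J V) (resO_resO (G.basicOpen_le f) hV x).symm)
      ((hF U x).1 hx V (hV.trans (G.basicOpen_le f)) hg)
  · have hy := (hF (G.affineBasicOpen f) y).1 hy
    obtain ⟨N, x, hx⟩ := exists_resO_eq_mul_pow U.2 f y
    -- A finite cover of `U` by members of the basis that are principal in `U`.
    obtain ⟨S, hS, hSg⟩ : ∃ S : Finset Γ(G, U), Ideal.span (S : Set Γ(G, U)) = ⊤ ∧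
        ∀ g ∈ S, good (G.basicOpen g) := by
      let S₀ : Set Γ(G, U) := {g | good (G.basicOpen g)}
      have h0 : Ideal.span S₀ = ⊤ := by
        rw [← U.2.self_le_iSup_basicOpen_iff]
        intro p hp
        obtain ⟨W, hpW, hW⟩ := hcov p
        obtain ⟨g, hg, hpg⟩ := U.2.exists_basicOpen_le ⟨p, hpW⟩ hp
        exact Opens.mem_iSup.2 ⟨⟨g, hgood _ _ hg hW (U.2.basicOpen g)⟩, hpg⟩
      obtain ⟨S, hS, hS'⟩ := (Ideal.span_eq_top_iff_finite S₀).1 h0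
      exact ⟨S, hS', fun g hg => hS hg⟩
    have hpow (g : Γ(G, U)) (hg : g ∈ S) : ∃ m : ℕ,
        resO (G.basicOpen_le g) (f ^ m * x) ∈ J (G.basicOpen g) := by
      have hgg := hSg g hg
      have hV : G.basicOpen (resO (G.basicOpen_le g) f) = G.basicOpen g ⊓ G.basicOpen f :=
        Scheme.basicOpen_res _ _ _
      have hle : G.basicOpen (resO (G.basicOpen_le g) f) ≤ G.basicOpen g := G.basicOpen_le _
      have hle' : G.basicOpen (resO (G.basicOpen_le g) f) ≤ G.basicOpen f :=
        hV.trans_le inf_le_right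
      have hgood' := hgood _ _ hle hgg ((haff _ hgg).basicOpen _)
      have h1 := (resO_mem_map_iff (haff _ hgg) _ rfl hle (J (G.basicOpen g))
        (resO (G.basicOpen_le g) x)).1 (by
          rw [← hJ _ _ hle hgg hgood', resO_resO, ← resO_resO (G.basicOpen_le f) hle', ← hx, map_mul]
          exact Ideal.mul_mem_right _ _ (hy _ hle' hgood'))
      obtain ⟨m, hm⟩ := h1
      exact ⟨m, by rwa [map_mul, map_pow]⟩
    choose! m hm using hpow
    let M := S.sup m
    have hxF : f ^ M * x ∈ F U := by
      refine (hF U _).2 fun V hV hg => ?_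
      have hspan : Ideal.span (resO hV '' (S : Set Γ(G, U))) = ⊤ := by
        rw [← Ideal.map_span, hS, Ideal.map_top]
      refine Submodule.mem_of_span_eq_top_of_smul_pow_mem (J V) _ hspan _ ?_
      rintro ⟨_, g, hgS, rfl⟩
      have h1 : resO (G.basicOpen_le g) (f ^ M * x) ∈ J (G.basicOpen g) := by
        have h2 : f ^ M * x = f ^ (M - m g) * (f ^ m g * x) := by
          rw [← mul_assoc, ← pow_add, Nat.sub_add_cancel (Finset.le_sup hgS)]
        rw [h2, map_mul]
        exact Ideal.mul_mem_left _ _ (hm g hgS)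
      have hV' : G.basicOpen (resO hV g) = V ⊓ G.basicOpen g := Scheme.basicOpen_res _ _ _
      have hle : G.basicOpen (resO hV g) ≤ V := G.basicOpen_le _
      have hle' : G.basicOpen (resO hV g) ≤ G.basicOpen g := hV'.trans_le inf_le_right
      have hgood' := hgood _ _ hle hg ((haff _ hg).basicOpen _)
      refine (resO_mem_map_iff (haff _ hg) _ rfl hle (J V) (resO hV (f ^ M * x))).1 ?_
      rw [← hJ _ _ hle hg hgood', resO_resO, ← resO_resO (G.basicOpen_le g) hle',
        hJ _ _ hle' (hSg g hgS) hgood']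
      exact Ideal.mem_map_of_mem _ h1
    have hunit : IsUnit (resO (G.basicOpen_le f) f ^ (M + N)) :=
      (G.toRingedSpace.isUnit_res_basicOpen f : IsUnit (resO (G.basicOpen_le f) f)).pow _
    refine (Ideal.mul_unit_mem_iff_mem _ hunit).1 ?_
    have h3 := Ideal.mem_map_of_mem (resO (G.basicOpen_le f)) hxF
    rw [map_mul, ← hx, map_pow] at h3
    have h4 : y * resO (G.basicOpen_le f) f ^ (M + N) =
      resO (G.basicOpen_le f) f ^ M * (y * resO (G.basicOpen_le f) f ^ N) := by ring
    rw [h4]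
    exact h3

end

/-! ### Generators of the ideal of the isotropic locus -/

section

/-- An ideal that contains the values of an alternating form on increasing families of the `ρ i`
contains its values on all families. -/
lemma alt_comp_mem_span {R N : Type*} [CommRing R] [AddCommGroup N] [Module R N] {k r : ℕ}
    (A : N [⋀^Fin r]→ₗ[R] R) (ρ : Fin k → N) (τ : Fin r → Fin k) (I : Ideal R)
    (hI : ∀ σ : Set.powersetCard (Fin k) r, A (ρ ∘ Set.powersetCard.ofFinEmbEquiv.symm σ) ∈ I) :
    A (ρ ∘ τ) ∈ I := by
  by_cases hτ : Function.Injective τ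
  · let s := Tuple.sort τ
    have hmono : StrictMono (τ ∘ s) :=
      (Tuple.monotone_sort τ).strictMono_of_injective (hτ.comp s.injective)
    let e : Fin r ↪o Fin k := OrderEmbedding.ofStrictMono _ hmono
    have h1 := hI (Set.powersetCard.ofFinEmbEquiv e)
    rw [Equiv.symm_apply_apply] at h1
    have h2 : A (ρ ∘ τ) = Equiv.Perm.sign s⁻¹ • A (ρ ∘ e) := by
      rw [← A.map_perm]
      congr 1
      funext j
      simp [e]
    rw [h2, Units.smul_def, zsmul_eq_mul]
    exact Ideal.mul_mem_left _ _ h1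
  · rw [Function.not_injective_iff] at hτ
    obtain ⟨i, j, hij, hne⟩ := hτ
    rw [A.map_eq_zero_of_eq _ (congrArg ρ hij) hne]
    exact I.zero_mem

variable {M : X.Modules} {n k r m : ℕ} (hM : IsVectorBundle n M) (ω : Fin m → AltForm M r)
  (π : G ⟶ X) (S : Subobject ((pullback π).obj M))

/-- The sections `ρ` span the subsheaf `S` over every open subset of `W`. -/
structure Spans (S : Subobject ((pullback π).obj M)) (W : G.Opens)
    (ρ : Fin k → Γ((pullback π).obj M, W)) : Prop where
  memSub (i : Fin k) : MemSub S W (ρ i)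
  exists_eq (V : G.Opens) (h : V ≤ W) (t : Γ((pullback π).obj M, V)) : MemSub S V t →
    ∃ c : Fin k → Γ(G, V), ∑ i, c i • res _ h (ρ i) = t

variable {π S} in
lemma Spans.res {W : G.Opens} {ρ : Fin k → Γ((pullback π).obj M, W)} (hρ : Spans π S W ρ)
    {W' : G.Opens} (h : W' ≤ W) : Spans π S W' (fun i => res _ h (ρ i)) where
  memSub i := (hρ.memSub i).res h
  exists_eq V hV t ht := by
    obtain ⟨c, hc⟩ := hρ.exists_eq V (hV.trans h) t ht
    exact ⟨c, by simpa only [res_res] using hc⟩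

/-- The ideal generated by the values of the forms on the sections of `S` over `U`. -/
def valueIdeal (U : G.Opens) : Ideal Γ(G, U) :=
  Ideal.span {f | ∃ (i : Fin m) (t : Fin r → Γ((pullback π).obj M, U)), (∀ j, MemSub S U (t j)) ∧
    ((ω i).pullback hM π).app U t = f}

lemma valueIdeal_eq {W : G.Opens} {ρ : Fin k → Γ((pullback π).obj M, W)} (hρ : Spans π S W ρ) :
    valueIdeal hM ω π S W = Ideal.span (Set.range fun g : Fin m × Set.powersetCard (Fin k) r =>
      ((ω g.1).pullback hM π).app W (ρ ∘ Set.powersetCard.ofFinEmbEquiv.symm g.2)) := by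
  refine le_antisymm (Ideal.span_le.2 ?_) (Ideal.span_le.2 ?_)
  · rintro _ ⟨i, t, ht, rfl⟩
    choose c hc using fun j => hρ.exists_eq W le_rfl (t j) (ht j)
    simp only [res_self] at hc
    rw [alt_expand _ ρ c t hc]
    refine Ideal.sum_mem _ fun l _ => Ideal.mul_mem_right _ _ ?_
    exact alt_comp_mem_span _ ρ l _ fun σ => Ideal.subset_span ⟨(i, σ), rfl⟩
  · rintro _ ⟨⟨i, σ⟩, rfl⟩
    exact Ideal.subset_span ⟨i, _, fun j => hρ.memSub _, rfl⟩

/-- Where `S` is spanned by sections, the ideals generated by the values of the forms are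
compatible with restriction. -/
lemma valueIdeal_res {W : G.Opens} {ρ : Fin k → Γ((pullback π).obj M, W)} (hρ : Spans π S W ρ)
    {V : G.Opens} (h : V ≤ W) :
    valueIdeal hM ω π S V = (valueIdeal hM ω π S W).map (resO h) := by
  rw [valueIdeal_eq hM ω π S hρ, valueIdeal_eq hM ω π S (hρ.res h), Ideal.map_span, ← Set.range_comp]
  congr 2
  funext g
  exact (AltForm.res_app _ h _).symm

lemma exists_spans (hS : IsVectorBundle k (S : G.Modules)) (p : G) :
    ∃ (W : G.Opens) (ρ : Fin k → Γ((pullback π).obj M, W)), p ∈ W ∧ IsAffineOpen W ∧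
      Spans π S W ρ := by
  obtain ⟨W, hp, s, hs⟩ := isVectorBundle_frame hS p
  have hsp : Spans π S W (fun i => S.arrow.app W (s i)) :=
    { memSub := fun i => ⟨s i, rfl⟩
      exists_eq := by
        rintro V h _ ⟨t, rfl⟩
        refine ⟨hs.coord h t, ?_⟩
        conv_rhs => rw [← hs.coord_spec h t, map_sum]
        simp only [Hom.app_smul, app_res] }
  obtain ⟨W', hW', hp', hle⟩ := exists_isAffineOpen_mem_and_subset hp
  exact ⟨W', _, hp', hW', hsp.res hle⟩

/-- Over an affine open set over which `S` is spanned by sections, the ideal of the isotropic locus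
is generated by the values of the forms on these sections. -/
theorem isotropyIdeal_ideal (hS : IsVectorBundle k (S : G.Modules)) (W : G.affineOpens)
    {ρ : Fin k → Γ((pullback π).obj M, W)} (hρ : Spans π S W ρ) :
    (isotropyIdeal hM ω π S).ideal W =
      Ideal.span (Set.range fun g : Fin m × Set.powersetCard (Fin k) r =>
        ((ω g.1).pullback hM π).app W (ρ ∘ Set.powersetCard.ofFinEmbEquiv.symm g.2)) := by
  rw [← valueIdeal_eq hM ω π S hρ]
  let good (W : G.Opens) : Prop :=
    IsAffineOpen W ∧ ∃ ρ : Fin k → Γ((pullback π).obj M, W), Spans π S W ρ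
  have hcov (p : G) : ∃ W, p ∈ W ∧ good W := by
    obtain ⟨W, ρ, hp, hW, hρ⟩ := exists_spans π S hS p
    exact ⟨W, hp, hW, ρ, hρ⟩
  obtain ⟨I, hI⟩ := exists_idealSheafData good (valueIdeal hM ω π S) (fun W h => h.1)
    (fun V W h ⟨_, ρ, hρ⟩ hV => ⟨hV, _, hρ.res h⟩) hcov
    (fun V W h ⟨_, ρ, hρ⟩ _ => valueIdeal_res hM ω π S hρ h)
  have hIgood (W : G.affineOpens) (hW : good W) : I.ideal W = valueIdeal hM ω π S W := by
    ext x
    rw [hI]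
    constructor
    · intro h
      have := h W le_rfl hW
      rwa [resO_self] at this
    · intro hx V h _
      obtain ⟨_, ρ, hρ⟩ := hW
      rw [valueIdeal_res hM ω π S hρ h]
      exact Ideal.mem_map_of_mem _ hx
  have hIeq : isotropyIdeal hM ω π S = I := by
    refine le_antisymm (sInf_le ?_) (le_sInf ?_)
    · intro i U s
      refine (hI U _).2 fun V h _ => ?_
      rw [AltForm.res_app]
      refine Ideal.subset_span ⟨i, _, fun j => ?_, rfl⟩
      exact MemSub.res (F := S) h ⟨s j, rfl⟩
    · intro I' hI'
      choose W hpW hW using hcov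
      refine Scheme.IdealSheafData.le_of_iSup_eq_top (fun p => ⟨W p, (hW p).1⟩)
        (top_le_iff.1 fun p _ => Opens.mem_iSup.2 ⟨p, hpW p⟩) fun p => ?_
      rw [hIgood _ (hW p)]
      refine Ideal.span_le.2 ?_
      rintro _ ⟨i, t, ht, rfl⟩
      choose s hs using ht
      have := hI' i ⟨W p, (hW p).1⟩ s
      simp only [hs] at this
      exact this
  rw [hIeq, hIgood W ⟨W.2, ρ, hρ⟩]

end

end

section

variable {X T G : Scheme.{u}}

/-! ### Affine charts of the Grassmannian -/

section

variable {M : X.Modules} {n k : ℕ} {U : X.Opens} {e : Fin n → Γ(M, U)} (he : IsFrame M U e)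
  (hU : IsAffineOpen U) (ε : Fin k ⊕ Fin (n - k) ≃ Fin n) {π : G ⟶ X}
  {S : Subobject ((pullback π).obj M)}

/-- The coordinate ring of a chart. -/
abbrev ChartRing (k l : ℕ) (U : X.Opens) : Type u := MvPolynomial (Fin k × Fin l) Γ(X, U)

/-- The structure morphism of a chart, to the base scheme. -/
def chartToBase (k l : ℕ) (hU : IsAffineOpen U) : Spec (.of (ChartRing k l U)) ⟶ X :=
  Spec.map (CommRingCat.ofHom (MvPolynomial.C : Γ(X, U) →+* ChartRing k l U)) ≫ hU.fromSpec

lemma top_le_fromSpec {A : CommRingCat.{u}} (φ : Γ(X, U) ⟶ A) :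
    ⊤ ≤ (Spec.map φ ≫ hU.fromSpec) ⁻¹ᵁ U := by
  intro p _
  have : hU.fromSpec (Spec.map φ p) ∈ hU.fromSpec.opensRange := ⟨_, rfl⟩
  rwa [hU.opensRange_fromSpec] at this

/-- The generic matrix on a chart. -/
def chartMat (k l : ℕ) (U : X.Opens) (i : Fin k) (j : Fin l) : Γ(Spec (.of (ChartRing k l U)), ⊤) :=
  (Scheme.ΓSpecIso (.of (ChartRing k l U))).inv (MvPolynomial.X (i, j))

/-- The homomorphism from the coordinate ring of a chart that is given by a matrix of functions. -/
def chartHom (π : G ⟶ X) {l : ℕ} {W : G.Opens} (hW : W ≤ π ⁻¹ᵁ U)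
    (a : Fin k → Fin l → Γ(G, W)) : ChartRing k l U →+* Γ(G, W) :=
  MvPolynomial.eval₂Hom ((resO hW).comp (π.app U).hom) (fun p => a p.1 p.2)

lemma chartHom_C {l : ℕ} {W : G.Opens} (hW : W ≤ π ⁻¹ᵁ U) (a : Fin k → Fin l → Γ(G, W))
    (c : Γ(X, U)) : chartHom π hW a (MvPolynomial.C c) = resO hW (π.app U c) :=
  MvPolynomial.eval₂Hom_C _ _ _

lemma chartHom_X {l : ℕ} {W : G.Opens} (hW : W ≤ π ⁻¹ᵁ U) (a : Fin k → Fin l → Γ(G, W))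
    (p : Fin k × Fin l) : chartHom π hW a (MvPolynomial.X p) = a p.1 p.2 :=
  MvPolynomial.eval₂Hom_X' _ _ _

lemma resO_chartHom {l : ℕ} {W W' : G.Opens} (hW : W ≤ π ⁻¹ᵁ U) (h : W' ≤ W)
    (a : Fin k → Fin l → Γ(G, W)) (p : ChartRing k l U) :
    resO h (chartHom π hW a p) = chartHom π (h.trans hW) (fun i j => resO h (a i j)) p := by
  refine congr($(MvPolynomial.ringHom_ext (f := (resO h).comp (chartHom π hW a))
    (g := chartHom π (h.trans hW) (fun i j => resO h (a i j))) (fun c => ?_) fun p => ?_) p)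
  · simp only [RingHom.comp_apply, chartHom_C, resO_resO]
  · simp only [RingHom.comp_apply, chartHom_X]

/-- The graph of the generic matrix is a subbundle, so it defines a morphism from the chart to the
Grassmannian. -/
lemma exists_chart_map (hG : IsGrassmannian M n k π S) :
    ∃ g : Spec (.of (ChartRing k (n - k) U)) ⟶ G, ∃ h : g ≫ π = chartToBase k (n - k) hU,
      pullbackSub S g _ h = pullGraph he ε (chartToBase k (n - k) hU) (top_le_fromSpec hU _)
        (chartMat k (n - k) U) :=
  (hG.existsUnique _ _ (isSubbundle_pullGraph he ε _ _ _)).exists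

variable {he hU ε} {g : Spec (.of (ChartRing k (n - k) U)) ⟶ G}
  {h : g ≫ π = chartToBase k (n - k) hU}

/-- Over an open set where the universal subbundle is a graph, the matrix of that graph gives a
section of the chart morphism `g`. -/
lemma chartHom_comp (hG : IsGrassmannian M n k π S)
    (hg : pullbackSub S g _ h = pullGraph he ε (chartToBase k (n - k) hU) (top_le_fromSpec hU _)
        (chartMat k (n - k) U)) {W : G.Opens} (hWa : IsAffineOpen W) {hW : W ≤ π ⁻¹ᵁ U}
    {a : Fin k → Fin (n - k) → Γ(G, W)} (hS : IsGraphOn he ε S W hW a) :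
    Spec.map (CommRingCat.ofHom (chartHom π hW a)) ≫ g = hWa.fromSpec := by
  have hbase : Spec.map (CommRingCat.ofHom (chartHom π hW a)) ≫ chartToBase k (n - k) hU =
      hWa.fromSpec ≫ π := by
    rw [← IsAffineOpen.SpecMap_appLE_fromSpec π hU hWa hW, chartToBase, ← Category.assoc,
      ← Spec.map_comp]
    congr 2
    ext c
    exact chartHom_C hW a c
  have hgW : ⊤ ≤ hWa.fromSpec ⁻¹ᵁ W := hWa.fromSpec_preimage_self.ge
  have hf : ⊤ ≤ (hWa.fromSpec ≫ π) ⁻¹ᵁ U := hgW.trans (hWa.fromSpec.preimage_mono hW)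
  have h1 := hS.pullbackSub_eq he ε (g := hWa.fromSpec) rfl hgW hf
  have h'' : (Spec.map (CommRingCat.ofHom (chartHom π hW a)) ≫ g) ≫ π = hWa.fromSpec ≫ π := by
    rw [Category.assoc, h, hbase]
  have h2 := pullbackSub_comp_eq he ε h hg hbase h'' hf
  refine (hG.existsUnique _ _ (isSubbundle_pullGraph he ε _ hf _)).unique ⟨h'', h2⟩ ⟨rfl, ?_⟩
  rw [h1]
  congr 1
  funext i j
  have h3 := SpecMap_app_top (CommRingCat.ofHom (chartHom π hW a)) (MvPolynomial.X (i, j))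
  rw [pullMat, fromSpec_app, resO_resO]
  refine Eq.trans ?_ (congrArg (resO le_top) h3.symm)
  refine (resO_self le_top _).trans (Eq.trans ?_ (resO_self le_top _).symm)
  exact congrArg (Scheme.ΓSpecIso Γ(G, W)).inv (chartHom_X hW a (i, j)).symm

/-- The chart morphism is a monomorphism, because a graph determines its matrix. -/
lemma mono_chart (hg : pullbackSub S g _ h = pullGraph he ε (chartToBase k (n - k) hU)
    (top_le_fromSpec hU _) (chartMat k (n - k) U)) : Mono g := by
  refine ⟨fun {T'} u v huv => ?_⟩
  have hb : u ≫ chartToBase k (n - k) hU = v ≫ chartToBase k (n - k) hU := by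
    rw [← h, ← Category.assoc, huv, Category.assoc]
  have hf : ⊤ ≤ (u ≫ chartToBase k (n - k) hU) ⁻¹ᵁ U :=
    u.preimage_mono (top_le_fromSpec hU (CommRingCat.ofHom MvPolynomial.C))
  have h1 := pullbackSub_comp_eq he ε h hg (u := u) rfl (by rw [Category.assoc, h]) hf
  have h2 := pullbackSub_comp_eq he ε h hg (u := v) hb.symm (by rw [Category.assoc, h, hb]) hf
  have h3 : pullMat u le_top (chartMat k (n - k) U) = pullMat v le_top (chartMat k (n - k) U) := by
    refine pullGraph_injective he ε (h1.symm.trans (Eq.trans ?_ h2))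
    congr 1
  have hb' : u ≫ Spec.map (CommRingCat.ofHom MvPolynomial.C) =
      v ≫ Spec.map (CommRingCat.ofHom (MvPolynomial.C : Γ(X, U) →+* ChartRing k (n - k) U)) := by
    rw [chartToBase, ← Category.assoc, ← Category.assoc] at hb
    exact (cancel_mono _).1 hb
  refine ext_of_isAffine ?_
  rw [← cancel_epi (Scheme.ΓSpecIso (.of (ChartRing k (n - k) U))).inv]
  refine CommRingCat.hom_ext (MvPolynomial.ringHom_ext (fun c => ?_) fun p => ?_)
  · have h4 := congr(Scheme.Hom.appTop $hb' ((Scheme.ΓSpecIso _).inv c))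
    rw [Scheme.Hom.comp_appTop, Scheme.Hom.comp_appTop] at h4
    have h5 := SpecMap_app_top
      (CommRingCat.ofHom (MvPolynomial.C : Γ(X, U) →+* ChartRing k (n - k) U)) c
    exact (congrArg u.appTop h5).symm.trans (h4.trans (congrArg v.appTop h5))
  · have h4 := congrFun (congrFun h3 p.1) p.2
    simp only [pullMat] at h4
    exact (resO_self le_top _).symm.trans (h4.trans (resO_self le_top _))

end

/-- A morphism is an open immersion if its composition with a monomorphism is one. -/
lemma isOpenImmersion_of_comp_mono {B T G : Scheme.{u}} (j : B ⟶ T) (g : T ⟶ G) [Mono g]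
    [hjg : IsOpenImmersion (j ≫ g)] : IsOpenImmersion j := by
  have : MorphismProperty.HasOfPostcompProperty @IsOpenImmersion
      (MorphismProperty.monomorphisms Scheme.{u}) := by
    rw [MorphismProperty.hasOfPostcompProperty_iff_le_diagonal]
    intro X Y f hf
    have : Mono f := hf
    change IsOpenImmersion (Limits.pullback.diagonal f)
    infer_instance
  exact MorphismProperty.of_postcomp @IsOpenImmersion (W' := MorphismProperty.monomorphisms Scheme.{u})
    j g (inferInstanceAs (Mono g)) hjg

section

variable {M : X.Modules} {n k : ℕ} {U : X.Opens} {e : Fin n → Γ(M, U)} {he : IsFrame M U e}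
   {ε : Fin k ⊕ Fin (n - k) ≃ Fin n} {π : G ⟶ X}
  {S : Subobject ((pullback π).obj M)}

lemma IsGraphOn.res {W : G.Opens} {hW : W ≤ π ⁻¹ᵁ U} {a : Fin k → Fin (n - k) → Γ(G, W)}
    (hS : IsGraphOn he ε S W hW a) {W' : G.Opens} (h : W' ≤ W) :
    IsGraphOn he ε S W' (h.trans hW) (fun i j => resO h (a i j)) := by
  intro V hV t
  simpa only [resO_resO] using hS V (hV.trans h) t

/-- The inclusion of `W` factors as a section `Spec ψ` of the chart morphism `g`, followed by `g`.
As `g` is a monomorphism, `Spec ψ` is an open immersion, and `W'` is a principal open set of the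
chart that is contained in the image of `Spec ψ`. -/
lemma exists_chart_aux (hU : IsAffineOpen U) (hG : IsGrassmannian M n k π S) {W : G.Opens}
    (hWa : IsAffineOpen W) {hW : W ≤ π ⁻¹ᵁ U} {a : Fin k → Fin (n - k) → Γ(G, W)}
    (hS : IsGraphOn he ε S W hW a) {p : G} (hp : p ∈ W) {O : G.Opens} (hpO : p ∈ O) :
    ∃ (W' : G.Opens) (h : W' ≤ W) (t : ChartRing k (n - k) U), W' ≤ O ∧ p ∈ W' ∧ IsAffineOpen W' ∧
      letI := (chartHom π (h.trans hW) (fun i j => resO h (a i j))).toAlgebra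
      IsLocalization.Away t Γ(G, W') := by
  obtain ⟨g, h, hg⟩ := exists_chart_map he hU ε hG
  have hmono := mono_chart hg
  let ψ := CommRingCat.ofHom (chartHom π hW a)
  have hψ : Spec.map ψ ≫ g = hWa.fromSpec := chartHom_comp hG hg hWa hS
  have hj : IsOpenImmersion (Spec.map ψ) := by
    have : IsOpenImmersion (Spec.map ψ ≫ g) := hψ ▸ hWa.isOpenImmersion_fromSpec
    exact isOpenImmersion_of_comp_mono (Spec.map ψ) g
  obtain ⟨q, rfl⟩ : p ∈ Set.range hWa.fromSpec := hWa.range_fromSpec ▸ hp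
  have hq : g (Spec.map ψ q) = hWa.fromSpec q := by rw [← hψ]; rfl
  obtain ⟨_, ⟨_, ⟨t, rfl⟩, rfl⟩, hqt, ht⟩ :=
    (PrimeSpectrum.isBasis_basic_opens (R := ChartRing k (n - k) U)).exists_subset_of_mem_open
      (u := ((Spec.map ψ).opensRange ⊓ g ⁻¹ᵁ O).carrier)
      (a := Spec.map ψ q)
      ⟨⟨q, rfl⟩, show g (Spec.map ψ q) ∈ O by rw [hq]; exact hpO⟩ (Opens.isOpen _)
  let A := Localization.Away t
  let s := Spec.map (CommRingCat.ofHom (algebraMap (ChartRing k (n - k) U) A))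
  have hs : Set.range s = (PrimeSpectrum.basicOpen t).carrier :=
    PrimeSpectrum.localization_away_comap_range A t
  have hs_le : Set.range s ⊆ Set.range (Spec.map ψ) := hs.trans_subset fun x hx => (ht hx).1
  have hs_imm : IsOpenImmersion s := inferInstance
  let l := IsOpenImmersion.lift (Spec.map ψ) s hs_le
  have hl : l ≫ Spec.map ψ = s := IsOpenImmersion.lift_fac _ _ _
  have hl_imm : IsOpenImmersion l := by
    have : IsOpenImmersion (l ≫ Spec.map ψ) := hl ▸ hs_imm
    exact IsOpenImmersion.of_comp l (Spec.map ψ)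
  obtain ⟨φ, hφ⟩ := Spec.map_surjective l
  have hφψ : ψ ≫ φ = CommRingCat.ofHom (algebraMap (ChartRing k (n - k) U) A) := by
    refine Spec.map_injective ?_
    rw [Spec.map_comp, hφ, hl]
  let v := Spec.map φ ≫ hWa.fromSpec
  have hv_imm : IsOpenImmersion v := by
    have : IsOpenImmersion (Spec.map φ) := hφ ▸ hl_imm
    infer_instance
  have hv : v = s ≫ g := by
    rw [← hl, Category.assoc, hψ, ← hφ]
  have hvW : v.opensRange ≤ W := by
    rintro _ ⟨x, rfl⟩
    exact hWa.range_fromSpec.le ⟨Spec.map φ x, rfl⟩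
  have hvtop : ⊤ ≤ v ⁻¹ᵁ v.opensRange := fun x _ => ⟨x, rfl⟩
  refine ⟨v.opensRange, hvW, t, ?_, ?_, isAffineOpen_opensRange v, ?_⟩
  · rintro _ ⟨x, rfl⟩
    rw [hv]
    exact (ht (hs.le ⟨x, rfl⟩)).2
  · obtain ⟨x, hx⟩ := hs.ge hqt
    refine ⟨x, ?_⟩
    rw [hv, ← hq, ← hx]
    rfl
  · let E := RingEquiv.ofBijective _ (evalPt_bijective v hvtop)
    have hE (x : ChartRing k (n - k) U) :
        E (chartHom π (hvW.trans hW) (fun i j => resO hvW (a i j)) x) = algebraMap _ A x := by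
      rw [← resO_chartHom hW hvW]
      refine (evalPt_res v hvW hvtop _).trans ((evalPt_fromSpec hWa φ _ _).trans ?_)
      exact congr($hφψ x)
    let := (chartHom π (hvW.trans hW) (fun i j => resO hvW (a i j))).toAlgebra
    let E' : A ≃ₐ[ChartRing k (n - k) U] Γ(G, v.opensRange) :=
      AlgEquiv.ofRingEquiv (f := E.symm) fun x => by
        rw [RingEquiv.symm_apply_eq]
        exact (hE x).symm
    exact IsLocalization.isLocalization_of_algEquiv _ E'

/-- Around every point where the universal subbundle is a graph, there are arbitrarily small affine
open sets of the Grassmannian that are principal open sets of a chart, and whose coordinates are the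
entries of the matrix of the graph. -/
theorem exists_chart (hU : IsAffineOpen U) (hG : IsGrassmannian M n k π S) {W : G.Opens}
    {hW : W ≤ π ⁻¹ᵁ U} {a : Fin k → Fin (n - k) → Γ(G, W)} (hS : IsGraphOn he ε S W hW a) {p : G}
    (hp : p ∈ W) {O : G.Opens} (hpO : p ∈ O) :
    ∃ (W' : G.Opens) (h : W' ≤ W) (a' : Fin k → Fin (n - k) → Γ(G, W'))
      (t : ChartRing k (n - k) U), W' ≤ O ∧ p ∈ W' ∧ IsAffineOpen W' ∧
      (a' = fun i j => resO h (a i j)) ∧ IsGraphOn he ε S W' (h.trans hW) a' ∧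
      letI := (chartHom π (h.trans hW) a').toAlgebra; IsLocalization.Away t Γ(G, W') := by
  obtain ⟨W₁, hW₁, hp₁, hle⟩ := exists_isAffineOpen_mem_and_subset hp
  have hle : W₁ ≤ W := hle
  obtain ⟨W', h, t, hO, hpW', hW', ht⟩ := exists_chart_aux hU hG hW₁ (hS.res hle) hp₁ hpO
  refine ⟨W', h.trans hle, _, t, hO, hpW', hW', ?_, (hS.res hle).res h, ht⟩
  funext i j
  exact resO_resO _ _ _

end

end

section

variable {X T G Z : Scheme.{u}}

/-! ### Smoothness at a point in terms of affine open sets -/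

section

lemma smoothOfRelativeDimensionAt_of_appLE {p : Z ⟶ X} {d : ℕ} {U : X.Opens} (hU : IsAffineOpen U)
    {V : Z.Opens} (hV : IsAffineOpen V) (h : V ≤ p ⁻¹ᵁ U)
    (hd : RingHom.IsStandardSmoothOfRelativeDimension d (p.appLE U V h).hom) {z : Z} (hz : z ∈ V) :
    SmoothOfRelativeDimensionAt d p z := by
  refine ⟨V, hz, ⟨fun y => ?_⟩⟩
  have : IsAffine V := hV
  have htop : ⊤ ≤ (V.ι ≫ p) ⁻¹ᵁ U := fun y _ => h y.2
  refine ⟨U, hU, ⊤, isAffineOpen_top _, trivial, htop, ?_⟩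
  have h1 : (V.ι ≫ p).appLE U ⊤ htop = p.appLE U V h ≫ V.ι.appLE V ⊤ V.ι_preimage_self.ge := by
    rw [← Scheme.Hom.appLE_comp_appLE V.ι p U V ⊤ h V.ι_preimage_self.ge]
  have h2 : IsIso (V.ι.appLE V ⊤ V.ι_preimage_self.ge) := by
    have h3 : IsIso (V.ι.app V) := V.ι.isIso_app V (by simp)
    have h4 : homOfLE V.ι_preimage_self.ge = eqToHom V.ι_preimage_self.symm := rfl
    rw [Scheme.Hom.appLE, h4]
    infer_instance
  rw [h1]
  exact (RingHom.isStandardSmoothOfRelativeDimension_respectsIso.cancel_right_isIso _ _).2 hd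

/-- Smoothness at `z` passes to all pairs of affine open sets in a neighbourhood of `z`. -/
lemma SmoothOfRelativeDimensionAt.locally_appLE {p : Z ⟶ X} {d : ℕ} {z : Z}
    (h : SmoothOfRelativeDimensionAt d p z) :
    ∃ O : Z.Opens, z ∈ O ∧ ∀ (U : X.Opens) (V : Z.Opens) (e : V ≤ p ⁻¹ᵁ U), IsAffineOpen U →
      IsAffineOpen V → V ≤ O →
      RingHom.Locally (RingHom.IsStandardSmoothOfRelativeDimension d) (p.appLE U V e).hom := by
  obtain ⟨O, hz, hO⟩ := h
  refine ⟨O, hz, fun U V e hU hV hVO => ?_⟩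
  have hV' : IsAffineOpen (O.ι ⁻¹ᵁ V) := hV.preimage_of_isOpenImmersion O.ι (by simpa using hVO)
  have h1 := HasRingHomProperty.appLE (@SmoothOfRelativeDimension d) (O.ι ≫ p) hO ⟨U, hU⟩
    ⟨_, hV'⟩ (O.ι.preimage_mono e)
  have h2 : (O.ι ≫ p).appLE U (O.ι ⁻¹ᵁ V) (O.ι.preimage_mono e) = p.appLE U V e ≫ O.ι.app V := by
    rw [← Scheme.Hom.appLE_comp_appLE O.ι p U V _ e le_rfl, Scheme.Hom.appLE_eq_app]
  have h3 : IsIso (O.ι.app V) := O.ι.isIso_app V (by simpa using hVO)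
  have h4 : RingHom.Locally (RingHom.IsStandardSmoothOfRelativeDimension d)
    ((O.ι.app V).hom.comp (p.appLE U V e).hom) := by
    rw [h2] at h1
    exact h1
  exact ((RingHom.locally_respectsIso
    RingHom.isStandardSmoothOfRelativeDimension_respectsIso).cancel_right_isIso _ _).1 h4

end

/-! ### Matrices with independent rows -/

section

variable {K γ ι : Type*} [Field K] [Fintype γ] [Fintype ι] (A : Matrix γ ι K)

lemma exists_minor_of_linearIndependent_row [DecidableEq γ] (hA : LinearIndependent K A.row) :
    ∃ c : γ → ι, Function.Injective c ∧ (Matrix.of fun i j => A j (c i)).det ≠ 0 := by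
  obtain ⟨c, hc, h⟩ := exists_minor_ne_zero A hA.rank_matrix.ge
  exact ⟨c, hc, by rwa [← Matrix.det_transpose] at h⟩

lemma linearIndependent_row_iff : LinearIndependent K A.row ↔
    Module.finrank K (LinearMap.ker A.mulVecLin) + Fintype.card γ = Fintype.card ι := by
  have h1 := LinearMap.finrank_range_add_finrank_ker A.mulVecLin
  rw [Module.finrank_fintype_fun_eq_card] at h1
  change A.rank + _ = _ at h1
  rw [linearIndependent_iff_card_eq_finrank_span, Set.finrank, ← A.rank_eq_finrank_span_row]
  omega

end


/-! ### The fibre at a field-valued point -/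

section

variable {M : X.Modules} {n k r m : ℕ} {U : X.Opens} {e : Fin n → Γ(M, U)} (he : IsFrame M U e)
  (ε : Fin k ⊕ Fin (n - k) ≃ Fin n) {K : Type u} [Field K] (x : Spec (.of K) ⟶ X)
  (hx : ⊤ ≤ x ⁻¹ᵁ U)

/-- The basis of the fibre that is given by a frame. The ring of global functions of `Spec K` is
identified with `K` by `Scheme.ΓSpecIso`. -/
def fiberBasis : Module.Basis (Fin n) K (fiber K x M) :=
  Module.Basis.ofEquivFun
    { toFun := fun t l => (Scheme.ΓSpecIso (.of K)).hom
        ((isFrame_globalFrame he x hx).coord le_rfl t l)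
      map_add' := fun s t => by
        funext l
        exact (congrArg (fun c => (Scheme.ΓSpecIso (.of K)).hom (c l))
          (((isFrame_globalFrame he x hx).coord le_rfl).map_add s t)).trans (map_add _ _ _)
      map_smul' := fun c t => by
        funext l
        refine (congrArg (fun c => (Scheme.ΓSpecIso (.of K)).hom (c l))
          (((isFrame_globalFrame he x hx).coord le_rfl).map_smul
            ((Scheme.ΓSpecIso (.of K)).inv c) t)).trans
          ((map_mul (Scheme.ΓSpecIso (.of K)).hom.hom _ _).trans ?_)
        exact congrArg (· * _) (congr($((Scheme.ΓSpecIso (.of K)).inv_hom_id) c))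
      invFun := fun v => ∑ l, (Scheme.ΓSpecIso (.of K)).inv (v l) • globalFrame M e x hx l
      left_inv := fun t => by
        refine Eq.trans (Finset.sum_congr rfl fun l _ => ?_)
          ((isFrame_globalFrame he x hx).coord_spec le_rfl t)
        rw [res_self]
        exact congrArg (· • _) (congr($((Scheme.ΓSpecIso (.of K)).hom_inv_id) _))
      right_inv := fun v => by
        funext l
        refine Eq.trans (congrArg (fun c => (Scheme.ΓSpecIso (.of K)).hom (c l))
          ((isFrame_globalFrame he x hx).coord_eq le_rfl
            (a := fun l => (Scheme.ΓSpecIso (.of K)).inv (v l)) ?_)) ?_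
        · exact Finset.sum_congr rfl fun l _ => congrArg _ (res_self _ _ _)
        · exact congr($((Scheme.ΓSpecIso (.of K)).inv_hom_id) (v l)) }

lemma fiberBasis_repr (t : fiber K x M) (l : Fin n) : (fiberBasis he x hx).repr t l =
    (Scheme.ΓSpecIso (.of K)).hom ((isFrame_globalFrame he x hx).coord le_rfl t l) := by
  rw [fiberBasis, Module.Basis.ofEquivFun_repr_apply]
  rfl

lemma fiberBasis_apply (l : Fin n) : fiberBasis he x hx l = globalFrame M e x hx l := by
  refine (fiberBasis he x hx).repr.injective (Finsupp.ext fun l' => ?_)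
  refine Eq.trans ?_
    (fiberBasis_repr he x hx (show fiber K x M from globalFrame M e x hx l) l').symm
  rw [Module.Basis.repr_self]
  have h1 := (isFrame_globalFrame he x hx).coord_frame le_rfl l
  rw [res_self] at h1
  rw [h1, Finsupp.single_apply, Pi.single_apply]
  rcases eq_or_ne l' l with rfl | h
  · rw [if_pos rfl, if_pos rfl, map_one]
  · rw [if_neg h, if_neg h.symm, map_zero]

lemma atFiber_fiberBasis (hM : IsVectorBundle n M) (ω : AltForm M r) (l : Fin r → Fin n) :
    ω.atFiber hM x (fiberBasis he x hx ∘ l) = evalPt x hx (ω.app U (e ∘ l)) := by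
  have h1 : fiberBasis he x hx ∘ l = fun j => res _ hx (pullSec x M U (e (l j))) :=
    funext fun j => fiberBasis_apply he x hx (l j)
  rw [h1, evalPt_apply]
  refine congrArg (Scheme.ΓSpecIso (.of K)).hom ?_
  rw [← AltForm.res_app]
  exact congrArg _ ((ω.existsUnique_pullback hM x).choose_spec.1 U (e ∘ l))

/-- The subspace of the fibre that corresponds to a graph is a graph. -/
lemma mem_globalSubspace_pullGraph (a : Fin k → Fin (n - k) → Γ(Spec (.of K), ⊤))
    (v : fiber K x M) : v ∈ globalSubspace (pullGraph he ε x hx a) ↔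
      OnGraph ε (fun i j => (Scheme.ΓSpecIso (.of K)).hom (a i j)) ((fiberBasis he x hx).repr v) := by
  have h1 : v ∈ globalSubspace (pullGraph he ε x hx a) ↔ MemSub (pullGraph he ε x hx a) ⊤ v :=
    Iff.rfl
  refine h1.trans ((memSub_graphSub ε (isFrame_globalFrame he x hx) a
    (v : Γ((Scheme.Modules.pullback x).obj M, ⊤))).trans ?_)
  have hinj : Function.Injective (Scheme.ΓSpecIso (.of K)).hom.hom :=
    (Scheme.ΓSpecIso (.of K)).commRingCatIsoToRingEquiv.injective
  constructor
  · intro h j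
    have h2 := congrArg (Scheme.ΓSpecIso (.of K)).hom.hom (h j)
    simp only [resO_self, map_sum, map_mul] at h2
    simp only [fiberBasis_repr]
    exact h2
  · intro h j
    apply hinj
    have h2 := h j
    simp only [fiberBasis_repr] at h2
    simp only [resO_self, map_sum, map_mul]
    exact h2

end

/-! ### Equations of the isotropic locus in a chart -/

section

variable {M : X.Modules} {n k r m : ℕ} {U : X.Opens} {e : Fin n → Γ(M, U)} {he : IsFrame M U e}
  {ε : Fin k ⊕ Fin (n - k) ≃ Fin n} {π : G ⟶ X} {S : Subobject ((pullback π).obj M)}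

/-- The rows of the matrix span the graph. -/
lemma IsGraphOn.spans {W : G.Opens} {hW : W ≤ π ⁻¹ᵁ U} {a : Fin k → Fin (n - k) → Γ(G, W)}
    (hS : IsGraphOn he ε S W hW a) : Spans π S W (rowSec ε π hW e a) where
  memSub := hS.memSub_rowSec
  exists_eq V hV t ht := by
    have h1 := (hS V hV t).1 ht
    refine ⟨fun i => (he.pull π).coord (hV.trans hW) t (ε (.inl i)),
      (he.pull π).ext_coord (hV.trans hW) ?_⟩
    have hrow (i : Fin k) : (he.pull π).coord (hV.trans hW) (AltGrass.res _ hV (rowSec ε π hW e a i)) =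
        fun l => graphRow ε (fun i j => resO hV (a i j)) i l := by
      funext l
      rw [(he.pull π).coord_res hW hV, coord_rowSec he]
      exact map_graphRow ε (resO hV) a i l
    simp only [map_sum, _root_.map_smul, hrow]
    funext l
    obtain ⟨l, rfl⟩ := ε.surjective l
    rcases l with i | j
    · simp [graphRow, Pi.single_apply]
    · simpa [graphRow] using (h1 j).symm

/-- The values of the forms on the rows of the matrix are polynomials in the entries. -/
lemma pullback_app_rowSec (hM : IsVectorBundle n M) (ω : AltForm M r) {W : G.Opens}
    (hW : W ≤ π ⁻¹ᵁ U) (a : Fin k → Fin (n - k) → Γ(G, W)) (τ : Fin r → Fin k) :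
    (ω.pullback hM π).app W (rowSec ε π hW e a ∘ τ) =
      chartHom π hW a (graphPoly ε (fun l => ω.app U (e ∘ l)) τ) := by
  refine (alt_expand ((ω.pullback hM π).app W) (fun l => AltGrass.res _ hW (pullSec π M U (e l)))
    (fun s => graphRow ε a (τ s)) (rowSec ε π hW e a ∘ τ) fun s => rfl).trans ?_
  rw [map_graphPoly]
  refine Finset.sum_congr rfl fun l _ => ?_
  rw [chartHom_C]
  simp only [chartHom_X]
  congr 1
  refine Eq.trans (AltForm.res_app _ hW _).symm ?_
  exact congrArg _ ((ω.existsUnique_pullback hM π).choose_spec.1 U (e ∘ l))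

lemma IsGraphOn.isotropyIdeal_ideal (hM : IsVectorBundle n M) (ω : Fin m → AltForm M r)
    (hSv : IsVectorBundle k (S : G.Modules)) (W : G.affineOpens) {hW : W.1 ≤ π ⁻¹ᵁ U}
    {a : Fin k → Fin (n - k) → Γ(G, W.1)} (hS : IsGraphOn he ε S W hW a) :
    (isotropyIdeal hM ω π S).ideal W =
      Ideal.span (Set.range fun g : Fin m × Set.powersetCard (Fin k) r => chartHom π hW a
        (graphPoly ε (fun l => (ω g.1).app U (e ∘ l)) (Set.powersetCard.ofFinEmbEquiv.symm g.2))) := by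
  rw [AltGrass.isotropyIdeal_ideal hM ω π S hSv W hS.spans]
  simp only [pullback_app_rowSec]

end

end

section

variable {X T G Z : Scheme.{u}}

/-! ### Smoothness of closed subschemes of the Grassmannian -/

section

open MvPolynomial

variable {M : X.Modules} {n k : ℕ} {U : X.Opens} {e : Fin n → Γ(M, U)} {he : IsFrame M U e}
  {ε : Fin k ⊕ Fin (n - k) ≃ Fin n} {π : G ⟶ X} {S : Subobject ((pullback π).obj M)}
  {γ : Type*}

/-- The closed subscheme `j : Z ⟶ G` is defined, on every affine chart of the Grassmannian, by the
polynomials `P` in the entries of the matrix. -/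
def IsCutOutBy (he : IsFrame M U e) (ε : Fin k ⊕ Fin (n - k) ≃ Fin n) (S : Subobject ((pullback π).obj M))
    (j : Z ⟶ G) (P : γ → ChartRing k (n - k) U) : Prop :=
  ∀ (W : G.Opens) (hW : W ≤ π ⁻¹ᵁ U) (a : Fin k → Fin (n - k) → Γ(G, W)), IsAffineOpen W →
    IsGraphOn he ε S W hW a → RingHom.ker (j.app W).hom =
      Ideal.span (Set.range fun g => chartHom π hW a (P g))

lemma app_comp_chartHom_comp_C (j : Z ⟶ G) {W : G.Opens} (hW : W ≤ π ⁻¹ᵁ U)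
    (a : Fin k → Fin (n - k) → Γ(G, W)) :
    (j.app W).hom.comp ((chartHom π hW a).comp C) =
      ((j ≫ π).appLE U (j ⁻¹ᵁ W) (j.preimage_mono hW)).hom := by
  rw [← Scheme.Hom.appLE_comp_appLE j π U W _ hW le_rfl, Scheme.Hom.appLE_eq_app]
  ext c
  simp only [RingHom.comp_apply, chartHom_C]
  rfl

/-- The Jacobian criterion: where a maximal minor of the Jacobian matrix of the equations does not
vanish, the subscheme is smooth. -/
lemma IsCutOutBy.smooth [Fintype γ] [DecidableEq γ] {j : Z ⟶ G} [IsClosedImmersion j]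
    {P : γ → ChartRing k (n - k) U} (hP : IsCutOutBy he ε S j P) (hU : IsAffineOpen U)
    (hG : IsGrassmannian M n k π S) {W : G.Opens} {hW : W ≤ π ⁻¹ᵁ U}
    {a : Fin k → Fin (n - k) → Γ(G, W)} (hS : IsGraphOn he ε S W hW a) {z : Z}
    {c : γ → Fin k × Fin (n - k)} (hc : Function.Injective c)
    (hz : j z ∈ G.basicOpen
      (chartHom π hW a (Matrix.of fun i i' => pderiv (c i) (P i')).det)) :
    SmoothOfRelativeDimensionAt (Fintype.card (Fin k × Fin (n - k)) - Fintype.card γ) (j ≫ π) z := by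
  obtain ⟨W', h, a', t, hO, hzW', hW', rfl, hS', ht⟩ :=
    exists_chart hU hG hS (G.basicOpen_le _ hz) hz
  refine smoothOfRelativeDimensionAt_of_appLE hU (hW'.preimage j) (j.preimage_mono (h.trans hW)) ?_
    hzW'
  rw [← app_comp_chartHom_comp_C j (h.trans hW) (fun i i' => resO h (a i i'))]
  refine isStandardSmoothOfRelativeDimension_comp _ t ht P _
    (j.app_surjective W' hW') (hP W' _ _ hW' hS') c hc ?_
  rw [← resO_chartHom hW h, ← resO_resO (G.basicOpen_le _) hO]
  exact (G.toRingedSpace.isUnit_res_basicOpen _).map _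

/-- The relative tangent space at a `K`-valued point is the kernel of the Jacobian matrix, so this
kernel has the relative dimension as its dimension if the subscheme is smooth. -/
lemma IsCutOutBy.finrank_ker {j : Z ⟶ G} [IsClosedImmersion j]
    {P : γ → ChartRing k (n - k) U} (hP : IsCutOutBy he ε S j P) (hU : IsAffineOpen U)
    (hG : IsGrassmannian M n k π S) {W : G.Opens} {hW : W ≤ π ⁻¹ᵁ U}
    {a : Fin k → Fin (n - k) → Γ(G, W)} (hS : IsGraphOn he ε S W hW a) {K : Type u} [Field K]
    (z : Spec (.of K) ⟶ Z) (hz : ⊤ ≤ (z ≫ j) ⁻¹ᵁ W) {d : ℕ} (p : Spec (CommRingCat.of K))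
    (hd : SmoothOfRelativeDimensionAt d (j ≫ π) (z p)) :
    Module.finrank K (LinearMap.ker (Matrix.of fun (g : γ) (i : Fin k × Fin (n - k)) =>
      evalPt (z ≫ j) hz (chartHom π hW a (pderiv i (P g)))).mulVecLin) = d := by
  obtain ⟨O, hzO, hO⟩ := hd.locally_appLE
  -- A neighbourhood of `z p` in `Z` is the preimage of one in `G`, as `j` is a closed immersion.
  obtain ⟨O', hO'o, hO'⟩ := j.isClosedEmbedding.isInducing.isOpen_iff.1 O.2
  obtain ⟨W', h, a', t, hWO, hzW', hW', rfl, hS', ht⟩ :=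
    exists_chart (p := j (z p)) (O := ⟨O', hO'o⟩) hU hG hS
      (mem_of_top_le_preimage (z := z ≫ j) hz p) (show z p ∈ j ⁻¹' O' from hO' ▸ hzO)
  have hle : j ⁻¹ᵁ W' ≤ O := fun q hq => by
    have h1 : q ∈ j ⁻¹' O' := hWO hq
    rwa [hO'] at h1
  have hzW'' : ⊤ ≤ z ⁻¹ᵁ (j ⁻¹ᵁ W') := top_le_preimage_of_mem (z := z) (p := p) hzW'
  have h1 := finrank_ker_jacobian (chartHom π (h.trans hW) fun i i' => resO h (a i i')) t ht P
    (j.app W').hom (j.app_surjective W' hW') (hP W' _ _ hW' hS') (evalPt z hzW'') d (by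
      rw [app_comp_chartHom_comp_C j (h.trans hW) (fun i i' => resO h (a i i'))]
      exact hO U _ _ hU (hW'.preimage j) hle)
  rw [← h1]
  refine congrArg (fun A : Matrix γ (Fin k × Fin (n - k)) K =>
    Module.finrank K (LinearMap.ker A.mulVecLin)) (Matrix.ext fun g i => ?_)
  rw [Matrix.of_apply, Matrix.of_apply]
  refine Eq.trans ?_ (evalPt_comp z j rfl hzW'' (show ⊤ ≤ (z ≫ j) ⁻¹ᵁ W' from hzW'') _).symm
  rw [← resO_chartHom hW h, evalPt_res]

/-- The whole Grassmannian is cut out by the empty family of equations. -/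
lemma isCutOutBy_id : IsCutOutBy he ε S (𝟙 G) (Empty.elim : Empty → ChartRing k (n - k) U) := by
  intro W hW a _ _
  rw [Set.range_eq_empty, Ideal.span_empty, Scheme.Hom.id_app]
  exact (RingHom.injective_iff_ker_eq_bot _).1 Function.injective_id

/-- A closed subscheme that is cut out by `c` equations is smooth of codimension `c` at a
`K`-valued point if and only if the Jacobian matrix of the equations has independent rows there. -/
lemma IsCutOutBy.smoothOfCodimensionAt_iff [Fintype γ] {j : Z ⟶ G} [IsClosedImmersion j]
    {P : γ → ChartRing k (n - k) U} (hP : IsCutOutBy he ε S j P) (hU : IsAffineOpen U)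
    (hG : IsGrassmannian M n k π S) {W : G.Opens} {hW : W ≤ π ⁻¹ᵁ U}
    {a : Fin k → Fin (n - k) → Γ(G, W)} (hS : IsGraphOn he ε S W hW a) {K : Type u} [Field K]
    (z : Spec (.of K) ⟶ Z) (hz : ⊤ ≤ (z ≫ j) ⁻¹ᵁ W) (p : Spec (CommRingCat.of K)) :
    SmoothOfCodimensionAt (Fintype.card γ) j π (z p) ↔
      LinearIndependent K (Matrix.of fun (g : γ) (i : Fin k × Fin (n - k)) =>
        evalPt (z ≫ j) hz (chartHom π hW a (pderiv i (P g)))).row := by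
  classical
  have hzp : j (z p) ∈ W := mem_of_top_le_preimage (z := z ≫ j) hz p
  constructor
  · rintro ⟨d, h1, h2⟩
    -- The kernel has dimension `d`, and `G`, with no equations, has relative dimension `k * (n - k)`.
    have h3 := isCutOutBy_id.finrank_ker hU hG hS (z ≫ j) (by simpa using hz) p
      (d := d + Fintype.card γ) (by rw [Category.id_comp]; exact h2)
    rw [linearIndependent_row_iff, hP.finrank_ker hU hG hS z hz p h1, ← h3]
    rw [(Submodule.eq_top_iff'.2 fun v => LinearMap.mem_ker.2 (Subsingleton.elim _ _) :
      LinearMap.ker _ = ⊤), finrank_top, Module.finrank_fintype_fun_eq_card]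
  · intro h
    have hle : Fintype.card γ ≤ Fintype.card (Fin k × Fin (n - k)) :=
      (Nat.le_add_left _ _).trans_eq ((linearIndependent_row_iff _).1 h)
    obtain ⟨c, hc, hdet⟩ := exists_minor_of_linearIndependent_row _ h
    refine ⟨_, hP.smooth hU hG hS hc ?_, ?_⟩
    · refine mem_of_top_le_preimage (z := z ≫ j) (top_le_preimage_basicOpen _ hz _ ?_) p
      rw [RingHom.map_det, RingHom.map_det]
      exact hdet
    · rw [Nat.sub_add_cancel hle]
      have h1 := isCutOutBy_id.smooth hU hG hS (z := j (z p)) (c := Empty.elim)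
        (fun i => i.elim) (by
          rw [Matrix.det_isEmpty, map_one, Scheme.basicOpen_of_isUnit _ isUnit_one]
          exact hzp)
      rwa [Category.id_comp] at h1

end

section

open MvPolynomial

variable {M : X.Modules} {n k r m : ℕ} {U : X.Opens} {e : Fin n → Γ(M, U)} {he : IsFrame M U e}
  {ε : Fin k ⊕ Fin (n - k) ≃ Fin n} {π : G ⟶ X} {S : Subobject ((pullback π).obj M)}

lemma isCutOutBy_isotropyIdeal (hM : IsVectorBundle n M) (ω : Fin m → AltForm M r)
    (hSv : IsVectorBundle k (S : G.Modules)) :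
    IsCutOutBy he ε S (isotropyIdeal hM ω π S).subschemeι
      fun g : Fin m × Set.powersetCard (Fin k) r => graphPoly ε (fun l => (ω g.1).app U (e ∘ l))
        (Set.powersetCard.ofFinEmbEquiv.symm g.2) := by
  intro W hW a hWa hS
  exact ((isotropyIdeal hM ω π S).ker_subschemeι_app ⟨W, hWa⟩).trans
    (hS.isotropyIdeal_ideal hM ω hSv ⟨W, hWa⟩)

/-- The Jacobian matrix of the equations of isotropy, evaluated at a point, is the matrix
`graphJacobian` of the forms on the fibre. -/
lemma evalPt_pderiv_eq_graphJacobian (hM : IsVectorBundle n M) (ω : Fin m → AltForm M r)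
    {W : G.Opens} (hW : W ≤ π ⁻¹ᵁ U) (a : Fin k → Fin (n - k) → Γ(G, W)) {K : Type u} [Field K]
    {x : Spec (.of K) ⟶ X} (hx : ⊤ ≤ x ⁻¹ᵁ U) (z : Spec (.of K) ⟶ G) (hzx : z ≫ π = x)
    (hz : ⊤ ≤ z ⁻¹ᵁ W) (g : Fin m × Set.powersetCard (Fin k) r) (p : Fin k × Fin (n - k)) :
    evalPt z hz (chartHom π hW a (pderiv p (graphPoly ε (fun l => (ω g.1).app U (e ∘ l))
      (Set.powersetCard.ofFinEmbEquiv.symm g.2)))) =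
    graphJacobian ε (fiberBasis he x hx) (fun i i' => evalPt z hz (a i i'))
      (fun i => (ω i).atFiber hM x) g p := by
  refine map_pderiv_eq_graphJacobian ε (fiberBasis he x hx) _ (fun i => (ω i).atFiber hM x)
    (fun i l => (ω i).app U (e ∘ l)) ((evalPt z hz).comp (chartHom π hW a)) (fun i l => ?_)
    (fun i i' => ?_) g p
  · rw [RingHom.comp_apply, chartHom_C, evalPt_res, evalPt_comp z π hzx _ hx, atFiber_fiberBasis]
  · rw [RingHom.comp_apply, chartHom_X]

end

end

end AltGrass

end

theorem mainTheorem6 {X : Scheme.{u}} (n k r m : ℕ) (hkn : k < n)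
    -- a vector bundle of rank `n` on `X` with `m` alternating forms
    (E : X.Modules) (hE : AltGrass.IsVectorBundle n E) (ω : Fin m → AltGrass.AltForm E r)
    -- the Grassmannian `G(k, E)` with its universal subbundle
    (G : Scheme.{u}) (π : G ⟶ X) (S : Subobject ((Scheme.Modules.pullback π).obj E))
    (hG : AltGrass.IsGrassmannian E n k π S)
    -- a `K`-valued point `x` of `X` and a `K`-valued point `z` over `x`
    (K : Type u) [Field K] (x : Spec (.of K) ⟶ X)
    (z : Spec (.of K) ⟶ AltGrass.genAltGrassmannian hE ω π S)
    (hz : (z ≫ (AltGrass.isotropyIdeal hE ω π S).subschemeι) ≫ π = x)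
    -- the isotropic subspace of the fibre that corresponds to `z`
    (V : Submodule K (AltGrass.fiber K x E))
    (hzV : AltGrass.globalSubspace (AltGrass.pullbackSub S
      (z ≫ (AltGrass.isotropyIdeal hE ω π S).subschemeι) x hz) = V)
    (hV : ∀ i, AltGrass.IsIsotropicSubspace ((ω i).atFiber hE x) V) :
    AltGrass.SmoothOfCodimensionAt (m * k.choose r) (AltGrass.isotropyIdeal hE ω π S).subschemeι π
        (z (IsLocalRing.closedPoint (CommRingCat.of K))) ↔
      Function.Injective (AltGrass.tangentMap (fun i => (ω i).atFiber hE x) hV) := by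
  open AltGrass in
  classical
  let p : Spec (CommRingCat.of K) := IsLocalRing.closedPoint (CommRingCat.of K)
  let j := (isotropyIdeal hE ω π S).subschemeι
  obtain ⟨U₀, hp₀, e₀, he₀⟩ := isVectorBundle_frame hE (x p)
  obtain ⟨U, hU, hpU, hle⟩ := exists_isAffineOpen_mem_and_subset hp₀
  have he := he₀.res (U' := U) hle
  generalize (fun l => AltGrass.res E hle (e₀ l)) = e at he
  have hx : ⊤ ≤ x ⁻¹ᵁ U := top_le_preimage_of_mem (p := p) hpU
  obtain ⟨ε, W, hW, a, hzW, hS⟩ := exists_isGraphOn he hkn.le hG.isSubbundle (z ≫ j) (by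
    have h1 := hx
    rw [← hz] at h1
    exact h1)
  -- In the basis of the fibre given by the frame, `V` is the graph of the values of the matrix `a`.
  rw [hS.pullbackSub_eq he ε hz hzW hx] at hzV
  have hVg (v : fiber K x E) : v ∈ V ↔
      OnGraph ε (fun i i' => evalPt (z ≫ j) hzW (a i i')) ((fiberBasis he x hx).repr v) := by
    rw [← hzV]
    exact mem_globalSubspace_pullGraph he ε x hx _ v
  have hcard : Fintype.card (Fin m × Set.powersetCard (Fin k) r) = m * k.choose r := by
    rw [Fintype.card_prod, Fintype.card_fin, ← Nat.card_eq_fintype_card (α := Set.powersetCard _ _),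
      Set.powersetCard.card, Nat.card_eq_fintype_card, Fintype.card_fin]
  rw [tangentMap_injective_iff hVg, ← hcard]
  refine ((isCutOutBy_isotropyIdeal (he := he) (ε := ε) hE ω
    hG.isSubbundle.1).smoothOfCodimensionAt_iff hU hG hS z hzW p).trans (iff_of_eq ?_)
  exact congrArg (fun A : Matrix _ _ K => LinearIndependent K A.row) (Matrix.ext fun g q =>
    evalPt_pderiv_eq_graphJacobian hE ω hW a hx (z ≫ j) hz hzW g q)
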